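/- Setting. Let $m,n\ge 1$, let $D$ be a probability distribution, and let $g_\xi:\mathbb R^n\to\mathbb R^m$ be differentiable with Jacobian $g_\xi'$ for $\xi\in\mathrm{supp}(D)$. Put $g(x)=\mathbb E_{\xi\sim D}[g_\xi(x)]$ and $\Phi(x)=f(g(x))+h(x)$, where $f:\mathbb R^m\to\mathbb R$ is convex and $l_f$-Lipschitz, $g$ is differentiable and $l_g$-Lipschitz with $L_g$-Lipschitz Jacobian (operator norm), and $h:\mathbb R^n\to\mathbb R\cup\{+\infty\}$ is closed, convex and proper. Suppose that for all $\xi\in\mathrm{supp}(D)$ and all $x,y\in\mathbb R^n$ $$\|g_\xi(x)-g(x)\|_2\le\sigma_g,\quad \|g'_\xi(x)-g'(x)\|_{\rm op}\le\sigma_{g'},\quad \|g_\xi(x)-g_\xi(y)\|_2\le\widehat l_g\|x-y\|_2,\quad \|g'_\xi(x)-g'_\xi(y)\|_{\rm op}\le\widehat L_g\|x-y\|_2 .$$ Let $M>5l_fL_g$, $\Phi^*:=\inf_x\Phi(x)>-\infty$, and let the starting point $x_0^0$ satisfy $\Phi(x_0^0)<\infty$. The generalized gradient is $\mathcal G_M(x)=M(x-x_+)$,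 where $x_+$ is the unique minimizer of $y\mapsto f(g(x)+g'(x)(y-x))+h(y)+\frac M2\|y-x\|_2^2$. Algorithm. Given $K,\tau,A,B,a,b\in\mathbb N_+$ and $\overline\epsilon,\overline\delta>0$, for $k=0,\dots,K-1$ and $i=0,\dots,\tau-1$ the algorithm draws fresh independent batches $\mathcal A_i^k,\mathcal B_i^k$ of i.i.d. samples from $D$, of sizes $A,B$ if $i=0$ and $a,b$ if $i>0$, and forms (estimator $\mathrm{Est}_1$) $$\widetilde g_0^k=\frac1A\sum_{\xi\in\mathcal A_0^k}g_\xi(x_0^k),\qquad \widetilde J_0^k=\frac1B\sum_{\xi\in\mathcal B_0^k}g'_\xi(x_0^k),$$ $$\widetilde g_i^k=\frac1a\sum_{\xi\in\mathcal A_i^k}\bigl(g_\xi(x_i^k)-g_\xi(x_0^k)\bigr)+\widetilde g_0^k,\qquad \widetilde J_i^k=\frac1b\sum_{\xi\in\mathcal B_i^k}\bigl(g'_\xi(x_i^k)-g'_\xi(x_0^k)\bigr)+\widetilde J_0^k\qquad(i>0).$$ Then $x_{i+1}^k$ is the output of a randomized solver, run with fresh randomness and tolerances $\overline\epsilon,\overline\delta$,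 on the function $s(y)=f(\widetilde g_i^k+\widetilde J_i^k(y-x_i^k))+h(y)+\frac M2\|y-x_i^k\|_2^2$; and $x_0^{k+1}=x_\tau^k$. For any tolerances $\overline\epsilon,\overline\delta>0$ and any such subproblem $s$, the solver returns, with probability at least $1-\overline\delta$, a point $x_{\rm sol}$ with $s(x_{\rm sol})\le\inf s+\overline\epsilon$. Claim. There are constants $C_\Sigma,C_A,C_B,C_a,C_b>0$ and $\epsilon_0>0$, depending only on $l_f,l_g,L_g,\widehat l_g,\widehat L_g,\sigma_g,\sigma_{g'},M$ and an upper bound on $\Phi(x_0^0)-\Phi^*$, such that the following holds for all $\Delta\in(0,1)$, all integers $\tau\ge1$ and all $\epsilon\in(0,\epsilon_0)$. Run the algorithm with $\overline\delta=\Delta/(2K\tau)$, $\overline\epsilon=\epsilon/(5\cdot30M)$ and $$K=\Bigl\lceil\frac{C_\Sigma\epsilon^{-1}}{\tau}\Bigr\rceil,\quad A=\Bigl\lceil C_A\epsilon^{-2}\log\frac{4(m+1)K\tau}{\Delta}\Bigr\rceil,\quad B=\Bigl\lceil C_B\epsilon^{-1}\log\frac{4(m+n)K\tau}{\Delta}\Bigr\rceil,$$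 $$a=\Bigl\lceil C_a\tau^2\epsilon^{-1}\log\frac{4(m+1)K\tau}{\Delta}\Bigr\rceil,\quad b=\Bigl\lceil C_b\tau^2\log\frac{4(m+n)K\tau}{\Delta}\Bigr\rceil .$$ (i) With probability at least $1-\Delta$, $$\frac1{K\tau}\sum_{k=0}^{K-1}\sum_{i=0}^{\tau-1}\|\mathcal G_M(x_i^k)\|_2^2\le\epsilon .$$ (ii) In every run, provided $\tau=O(\epsilon^{-1})$, the numbers of evaluations of $g_\xi(\cdot)$ and of $g_\xi'(\cdot)$ are respectively $$\widetilde\Theta\bigl((\epsilon^{-3}\tau^{-1}+\epsilon^{-2}\tau^2)\log(1/\Delta)\bigr)\quad\text{and}\quad\widetilde\Theta\bigl((\epsilon^{-2}\tau^{-1}+\epsilon^{-1}\tau^2)\log(1/\Delta)\bigr)$$ as $\epsilon\to0$, where $\widetilde\Theta$ hides constants and powers of $\log(1/\epsilon)$. That is, for all $C_\tau>0$ and $\Delta_{\max}\in(0,1)$ there are $c_1,c_2,\epsilon_1>0$ and $q\in\mathbb N$ such that for all $\epsilon\in(0,\epsilon_1)$, $\Delta\in(0,\Delta_{\max}]$ and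 integers $1\le\tau\le C_\tau\epsilon^{-1}$ each number lies between $c_1R$ and $c_2R\log(1/\epsilon)^q$, where $R$ is the corresponding rate displayed above, including its factor $\log(1/\Delta)$. -/

import Mathlib

open MeasureTheory Set
open scoped NNReal ENNReal

universe u v

noncomputable section

namespace ProxLinearVR

/-- `ℝ^d` with the Euclidean norm. -/
abbrev Vec (d : ℕ) : Type := EuclideanSpace ℝ (Fin d)

/-- `m × n` Jacobians, as linear maps `ℝ^n → ℝ^m`; the norm is the operator (spectral) norm. -/
abbrev Jac (m n : ℕ) : Type := Vec n →L[ℝ] Vec m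

/-- There is an event of probability at least `q` on which `A` holds. -/
def HoldsWithProb {Ω : Type*} [MeasurableSpace Ω] (P : Measure Ω) (q : ℝ) (A : Ω → Prop) : Prop :=
  ∃ E : Set Ω, MeasurableSet E ∧ ENNReal.ofReal q ≤ P E ∧ ∀ ω ∈ E, A ω

/-! ### The composite problem `min_x f(g(x)) + h(x)` with `g(x) = 𝔼_{ξ ∼ D} g_ξ(x)` -/

/-- The data of the problem: `f`, `h`, the sampling distribution `D`, and the two oracles
`(ξ, x) ↦ g_ξ(x)` and `(ξ, x) ↦ g_ξ'(x)`. -/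
structure Problem (m n : ℕ) (Ξ : Type u) [MeasurableSpace Ξ] where
  f : Vec m → ℝ
  h : Vec n → EReal
  D : Measure Ξ
  [isProb : IsProbabilityMeasure D]
  sample : Ξ → Vec n → Vec m
  sampleJac : Ξ → Vec n → Jac m n

attribute [instance] Problem.isProb

/-- A closed (lower semicontinuous), convex (convex epigraph), proper function
`ℝ^n → ℝ ∪ {+∞}`. -/
structure ClosedConvexProper {n : ℕ} (h : Vec n → EReal) : Prop where
  closed : LowerSemicontinuous h
  convex : Convex ℝ {q : Vec n × ℝ | h q.1 ≤ (q.2 : EReal)}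
  ne_bot : ∀ x, h x ≠ ⊥
  exists_ne_top : ∃ x, h x ≠ ⊤

namespace Problem

variable {m n : ℕ} {Ξ : Type u} [MeasurableSpace Ξ]

/-- The inner map `g(x) = 𝔼_{ξ ∼ D} g_ξ(x)`. -/
def g (p : Problem m n Ξ) (x : Vec n) : Vec m := ∫ ξ, p.sample ξ x ∂p.D

/-- The objective `Φ(x) = f(g(x)) + h(x)`. -/
def objective (p : Problem m n Ξ) (x : Vec n) : EReal := (p.f (p.g x) : EReal) + p.h x

/-- The prox-linear model `y ↦ f(w + J (y - x)) + h(y) + (M/2) ‖y - x‖²`. -/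
def model (p : Problem m n Ξ) (M : ℝ) (w : Vec m) (J : Jac m n) (x y : Vec n) : EReal :=
  (p.f (w + J (y - x)) : EReal) + p.h y + ((M / 2 * ‖y - x‖ ^ 2 : ℝ) : EReal)

/-- The model at `x` built from the exact `g(x)` and `g'(x)`. -/
def exactModel (p : Problem m n Ξ) (M : ℝ) (x : Vec n) : Vec n → EReal :=
  p.model M (p.g x) (fderiv ℝ p.g x) x

/-- The exact prox-linear step `x₊ = argmin_y f(g(x) + g'(x)(y - x)) + h(y) + (M/2) ‖y - x‖²`. -/
def proxLinearStep (p : Problem m n Ξ) (M : ℝ) (x : Vec n) : Vec n :=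
  Classical.epsilon fun y => IsMinOn (p.exactModel M x) univ y

/-- The generalized gradient `𝒢_M(x) = M (x - x₊)`. -/
def genGrad (p : Problem m n Ξ) (M : ℝ) (x : Vec n) : Vec n := M • (x - p.proxLinearStep M x)

/-- The standing assumptions: the oracles are measurable, `g_ξ'` is the
Jacobian of `g_ξ`, the expectation defining `g` exists, `f` is convex and `lf`-Lipschitz, `g` is
differentiable and `lg`-Lipschitz with an `Lg`-Lipschitz Jacobian, `h` is closed, convex, proper. -/
structure Standing (p : Problem m n Ξ) (lf lg Lg : ℝ≥0) : Prop where
  measurable_sample : Measurable fun q : Ξ × Vec n => p.sample q.1 q.2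
  measurable_sampleJac : Measurable fun q : Ξ × Vec n => p.sampleJac q.1 q.2
  hasFDerivAt : ∀ᵐ ξ ∂p.D, ∀ x, HasFDerivAt (p.sample ξ) (p.sampleJac ξ x) x
  integrable : ∀ x, Integrable (fun ξ => p.sample ξ x) p.D
  f_convex : ConvexOn ℝ univ p.f
  f_lipschitz : LipschitzWith lf p.f
  g_differentiable : Differentiable ℝ p.g
  g_lipschitz : LipschitzWith lg p.g
  jac_lipschitz : LipschitzWith Lg (fderiv ℝ p.g)
  h_ccp : ClosedConvexProper p.h

/-- Uniformly bounded deviations of the samples from their means. -/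
structure BoundedDeviation (p : Problem m n Ξ) (σg σJ : ℝ) : Prop where
  value : ∀ᵐ ξ ∂p.D, ∀ x, ‖p.sample ξ x - p.g x‖ ≤ σg
  jac : ∀ᵐ ξ ∂p.D, ∀ x, ‖p.sampleJac ξ x - fderiv ℝ p.g x‖ ≤ σJ

/-- `g_ξ` and `g_ξ'` are Lipschitz uniformly in `ξ`. -/
structure UniformLipschitz (p : Problem m n Ξ) (lhat Lhat : ℝ≥0) : Prop where
  value : ∀ᵐ ξ ∂p.D, LipschitzWith lhat (p.sample ξ)
  jac : ∀ᵐ ξ ∂p.D, LipschitzWith Lhat (p.sampleJac ξ)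

end Problem

/-! ### The solver for the subproblems -/

/-- A randomized solver: on tolerances `εbar`, `δbar`, on the data `(w, J, x)` of the subproblem
`min_y f(w + J (y - x)) + h(y) + (M/2) ‖y - x‖²` and on a random seed, it returns a point. -/
structure Solver (m n : ℕ) (S : Type v) [MeasurableSpace S] where
  law : Measure S
  [isProb : IsProbabilityMeasure law]
  solve : ℝ → ℝ → Vec m × Jac m n × Vec n → S → Vec n

attribute [instance] Solver.isProb

/-- With probability at least `1 - δbar` over its seed, the solver returns an `εbar`-optimal point
of the given subproblem. -/
structure Solver.Valid {m n : ℕ} {Ξ : Type u} [MeasurableSpace Ξ] {S : Type v} [MeasurableSpace S]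
    (sol : Solver m n S) (p : Problem m n Ξ) (M : ℝ) : Prop where
  measurable : ∀ εbar δbar : ℝ, 0 < εbar → 0 < δbar →
    Measurable fun q : (Vec m × Jac m n × Vec n) × S => sol.solve εbar δbar q.1 q.2
  accurate : ∀ εbar δbar : ℝ, 0 < εbar → 0 < δbar → ∀ (w : Vec m) (J : Jac m n) (x : Vec n),
    HoldsWithProb sol.law (1 - δbar) fun s =>
      p.model M w J x (sol.solve εbar δbar (w, J, x) s) ≤ (⨅ y, p.model M w J x y) + (εbar : EReal)

/-! ### Oracle calls and the variance reduced estimator -/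

/-- A value together with the numbers of calls to the oracles for `g_ξ` and `g_ξ'` that were made
to compute it. -/
structure Counted (α : Type) where
  val : α
  evals : ℕ
  jacs : ℕ

namespace Counted

/-- Combine two computed values; the calls add up. -/
def map₂ {α β γ : Type} (φ : α → β → γ) (s : Counted α) (t : Counted β) : Counted γ :=
  ⟨φ s.val t.val, s.evals + t.evals, s.jacs + t.jacs⟩

/-- The average of `N` computed values; the calls add up. -/
def mean {α : Type} [AddCommMonoid α] [Module ℝ α] (N : ℕ) (s : ℕ → Counted α) : Counted α :=
  ⟨(N : ℝ)⁻¹ • ∑ r ∈ Finset.range N, (s r).val, ∑ r ∈ Finset.range N, (s r).evals,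
    ∑ r ∈ Finset.range N, (s r).jacs⟩

end Counted

/-- Batch sizes `θ = (A, B, a, b)`. -/
structure BatchSizes where
  A : ℕ
  B : ℕ
  a : ℕ
  b : ℕ

namespace Problem

variable {m n : ℕ} {Ξ : Type u} [MeasurableSpace Ξ]

/-- One call to the oracle for `g_ξ`. -/
def callEval (p : Problem m n Ξ) (ξ : Ξ) (x : Vec n) : Counted (Vec m) := ⟨p.sample ξ x, 1, 0⟩

/-- One call to the oracle for `g_ξ'`. -/
def callJac (p : Problem m n Ξ) (ξ : Ξ) (x : Vec n) : Counted (Jac m n) :=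
  ⟨p.sampleJac ξ x, 0, 1⟩

/-- The estimates at the start `x₀` of an epoch: means over batches of sizes `A` and `B`. -/
def estStart (p : Problem m n Ξ) (θ : BatchSizes) (α β : ℕ → Ξ) (x₀ : Vec n) :
    Counted (Vec m × Jac m n) :=
  Counted.map₂ Prod.mk
    (Counted.mean θ.A fun r => p.callEval (α r) x₀)
    (Counted.mean θ.B fun r => p.callJac (β r) x₀)

/-- The later estimates of an epoch at the point `x`: mean differences between `x` and `x₀` over
batches of sizes `a` and `b`, added to the remembered estimates `mem` at `x₀`. -/
def estInner (p : Problem m n Ξ) (θ : BatchSizes) (α β : ℕ → Ξ) (mem : Vec m × Jac m n)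
    (x₀ x : Vec n) : Counted (Vec m × Jac m n) :=
  Counted.map₂ (fun d e => (d + mem.1, e + mem.2))
    (Counted.mean θ.a fun r =>
      Counted.map₂ (fun s t => s - t) (p.callEval (α r) x) (p.callEval (α r) x₀))
    (Counted.mean θ.b fun r =>
      Counted.map₂ (fun s t => s - t) (p.callJac (β r) x) (p.callJac (β r) x₀))

end Problem

/-! ### The algorithm -/

/-- All random draws of a run: the samples for `g` and those for `g'`, indexed by
`(epoch k, inner step i, position r in the batch)`, and the solver seeds, indexed by `(k, i)`. -/
abbrev Draws (Ξ : Type u) (S : Type v) : Type (max u v) :=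
  (ℕ × ℕ × ℕ → Ξ) × (ℕ × ℕ × ℕ → Ξ) × (ℕ × ℕ → S)

/-- All draws are independent, the samples with law `D` and the seeds with law `ν`. -/
def drawLaw {Ξ : Type u} {S : Type v} [MeasurableSpace Ξ] [MeasurableSpace S]
    (D : Measure Ξ) [IsProbabilityMeasure D] (ν : Measure S) [IsProbabilityMeasure ν] :
    Measure (Draws Ξ S) :=
  (Measure.infinitePi fun _ : ℕ × ℕ × ℕ => D).prod
    ((Measure.infinitePi fun _ : ℕ × ℕ × ℕ => D).prod (Measure.infinitePi fun _ : ℕ × ℕ => ν))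

/-- A setup of the algorithm: problem, solver, starting point `x_0^0`, epoch length `τ`, batch
sizes `θ` and solver tolerances. (The parameter `M` is built into the solver's task.) -/
structure Setup (m n : ℕ) (Ξ : Type u) [MeasurableSpace Ξ] (S : Type v) [MeasurableSpace S] where
  p : Problem m n Ξ
  sol : Solver m n S
  start : Vec n
  τ : ℕ
  θ : BatchSizes
  εbar : ℝ
  δbar : ℝ

namespace Setup

variable {m n : ℕ} {Ξ : Type u} [MeasurableSpace Ξ] {S : Type v} [MeasurableSpace S]

/-- The estimates at inner step `i` of epoch `k`, for the epoch's first point `x₀` and the current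
point `x`. -/
def estimate (a : Setup m n Ξ S) (ω : Draws Ξ S) (k : ℕ) (x₀ : Vec n) (i : ℕ) (x : Vec n) :
    Counted (Vec m × Jac m n) :=
  let first := a.p.estStart a.θ (fun r => ω.1 (k, 0, r)) (fun r => ω.2.1 (k, 0, r)) x₀
  if i = 0 then first
  else a.p.estInner a.θ (fun r => ω.1 (k, i, r)) (fun r => ω.2.1 (k, i, r)) first.val x₀ x

/-- The `i`-th point of epoch `k` when the epoch starts at `x₀`. -/
def inner (a : Setup m n Ξ S) (ω : Draws Ξ S) (k : ℕ) (x₀ : Vec n) : ℕ → Vec n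
  | 0 => x₀
  | i + 1 =>
    let x := inner a ω k x₀ i
    let e := (a.estimate ω k x₀ i x).val
    a.sol.solve a.εbar a.δbar (e.1, e.2, x) (ω.2.2 (k, i))

/-- The first point `x_0^k` of epoch `k`. -/
def epochStart (a : Setup m n Ξ S) (ω : Draws Ξ S) : ℕ → Vec n
  | 0 => a.start
  | k + 1 => a.inner ω k (epochStart a ω k) a.τ

/-- The iterate `x_i^k`. -/
def iterate (a : Setup m n Ξ S) (ω : Draws Ξ S) (k i : ℕ) : Vec n :=
  a.inner ω k (a.epochStart ω k) i

/-- The average `(1 / (K τ)) ∑_{k < K} ∑_{i < τ} ‖𝒢_M(x_i^k)‖²`. -/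
def avgSqGenGrad (a : Setup m n Ξ S) (M : ℝ) (K : ℕ) (ω : Draws Ξ S) : ℝ :=
  1 / ((K : ℝ) * a.τ) *
    ∑ k ∈ Finset.range K, ∑ i ∈ Finset.range a.τ, ‖a.p.genGrad M (a.iterate ω k i)‖ ^ 2

/-- The number of evaluations of `g_ξ` made in `K` epochs. -/
def totalEvals (a : Setup m n Ξ S) (K : ℕ) (ω : Draws Ξ S) : ℕ :=
  ∑ k ∈ Finset.range K, ∑ i ∈ Finset.range a.τ,
    (a.estimate ω k (a.epochStart ω k) i (a.iterate ω k i)).evals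

/-- The number of evaluations of `g_ξ'` made in `K` epochs. -/
def totalJacs (a : Setup m n Ξ S) (K : ℕ) (ω : Draws Ξ S) : ℕ :=
  ∑ k ∈ Finset.range K, ∑ i ∈ Finset.range a.τ,
    (a.estimate ω k (a.epochStart ω k) i (a.iterate ω k i)).jacs

end Setup

/-! ### The parameter choices -/

/-- The constants in the parameter choices. -/
structure Constants where
  CS : ℝ
  CA : ℝ
  CB : ℝ
  Ca : ℝ
  Cb : ℝ

namespace Constants

/-- All constants are positive. -/
def Pos (c : Constants) : Prop := 0 < c.CS ∧ 0 < c.CA ∧ 0 < c.CB ∧ 0 < c.Ca ∧ 0 < c.Cb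

/-- The number of epochs `K = ⌈CS ε⁻¹ / τ⌉`. -/
def epochs (c : Constants) (ε : ℝ) (τ : ℕ) : ℕ := ⌈c.CS * ε⁻¹ / τ⌉₊

/-- The batch sizes, for dimensions `m`, `n`, accuracy `ε`, failure probability `Δ` and epoch
length `τ`. -/
def batchSizes (c : Constants) (m n : ℕ) (ε Δ : ℝ) (τ : ℕ) : BatchSizes where
  A := ⌈c.CA * (ε ^ 2)⁻¹ * Real.log (4 * (m + 1) * c.epochs ε τ * τ / Δ)⌉₊
  B := ⌈c.CB * ε⁻¹ * Real.log (4 * (m + n) * c.epochs ε τ * τ / Δ)⌉₊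
  a := ⌈c.Ca * (τ : ℝ) ^ 2 * ε⁻¹ * Real.log (4 * (m + 1) * c.epochs ε τ * τ / Δ)⌉₊
  b := ⌈c.Cb * (τ : ℝ) ^ 2 * Real.log (4 * (m + n) * c.epochs ε τ * τ / Δ)⌉₊

/-- The algorithm with these batch sizes and the solver tolerances `εbar = ε / (5 · 30 M)` and
`δbar = Δ / (2 K τ)`. -/
def setup (c : Constants) {m n : ℕ} {Ξ : Type u} [MeasurableSpace Ξ] {S : Type v}
    [MeasurableSpace S] (p : Problem m n Ξ) (sol : Solver m n S) (x₀ : Vec n) (M ε Δ : ℝ) (τ : ℕ) :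
    Setup m n Ξ S where
  p := p
  sol := sol
  start := x₀
  τ := τ
  θ := c.batchSizes m n ε Δ τ
  εbar := ε / (5 * 30 * M)
  δbar := Δ / (2 * c.epochs ε τ * τ)

end Constants

/-- The rate `(ε⁻³ τ⁻¹ + ε⁻² τ²) log(1/Δ)` for evaluations. -/
def evalRate (ε Δ : ℝ) (τ : ℕ) : ℝ :=
  ((ε ^ 3)⁻¹ * (τ : ℝ)⁻¹ + (ε ^ 2)⁻¹ * (τ : ℝ) ^ 2) * Real.log (1 / Δ)

/-- The rate `(ε⁻² τ⁻¹ + ε⁻¹ τ²) log(1/Δ)` for Jacobians. -/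
def jacRate (ε Δ : ℝ) (τ : ℕ) : ℝ :=
  ((ε ^ 2)⁻¹ * (τ : ℝ)⁻¹ + ε⁻¹ * (τ : ℝ) ^ 2) * Real.log (1 / Δ)

/-- `X` agrees with `rate` up to the factors `c₁`, `c₂` and a power of `log(1/ε)`. -/
def SoftThetaBound (c₁ c₂ : ℝ) (q : ℕ) (ε rate : ℝ) (X : ℕ) : Prop :=
  c₁ * rate ≤ X ∧ (X : ℝ) ≤ c₂ * rate * Real.log (1 / ε) ^ q

end ProxLinearVR

end

/-! Descent. Write `x₊` for the exact prox-linear point at `x`. One inexact step from `x` to `y`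
lowers `Φ` by at least `(2M/5)‖x₊ - x‖² + (M/5)‖y - x‖²`, up to the solver tolerance, a term linear
in the error of the estimate of `g(x)`, and a term quadratic in the error of the estimate of `g'(x)`
(`Problem.Standing.descent`). The first gain comes from quadratic growth of the exact model at its
minimizer. The second is what remains of the solver's model after the linearization error of `g` is
paid for, which is where `M > 5 l_f L_g` enters.

Variance reduction. Only increments from `x_0^k` are sampled inside an epoch, so the estimation
error at `x_i^k` is at most the error at the start of the epoch plus a multiple of `‖x_i^k -
x_0^k‖`. Since `∑ ‖x_i - x_0‖² ≤ τ² ∑ ‖x_{j+1} - x_j‖²`, relative accuracies of order `√ε/τ` for `g`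
and `1/τ` for `g'` let the second gain absorb the drift. At the start of an epoch, accuracy `ε` for
`g` (linear error) and `√ε` for `g'` (squared error) suffice. Each step then loses `O(ε)`, and
telescoping over about `1/ε` steps gives (i). Accuracy `r` costs about `log(dim/δ)/r²` samples,
which explains `A`, `B`, `a`, `b`.

Probability. The accuracies come from a matrix Hoeffding inequality (`measure_norm_mean_gt_le`). It
is proved by bounding trace moments through an independent copy and the trace inequality
`opTrace_sub_mul_pow_sub_pow_le`, then applying Markov's inequality with a moment of logarithmic
order. It applies at the random iterates because each batch is independent of the points at which it
is evaluated (`infinitePi_freeze_le`). A union bound covers two estimates and one solver call at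
each of the `Kτ` steps.

Part (ii) is deterministic: the counts are `K(A + 2(τ-1)a)` and `K(B + 2(τ-1)b)`, estimated from
both sides in `exists_softThetaBound`. -/

noncomputable section

namespace ProxLinearVR

/-! ### A trace inequality for powers of symmetric operators -/

section Spectral

open Module
open scoped InnerProductSpace

variable {E : Type*} [NormedAddCommGroup E] [InnerProductSpace ℝ E]

/-- Symmetry of a bounded operator. -/
def IsSymm (A : E →L[ℝ] E) : Prop := ∀ x y, ⟪A x, y⟫_ℝ = ⟪x, A y⟫_ℝ

namespace IsSymm

lemma add {A B : E →L[ℝ] E} (hA : IsSymm A) (hB : IsSymm B) : IsSymm (A + B) := fun x y => by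
  simp [inner_add_left, inner_add_right, hA x y, hB x y]

lemma smul {A : E →L[ℝ] E} (hA : IsSymm A) (r : ℝ) : IsSymm (r • A) := fun x y => by
  simp [inner_smul_left, inner_smul_right, hA x y]

lemma zero : IsSymm (0 : E →L[ℝ] E) := fun x y => by simp

lemma sum {ι : Type*} (s : Finset ι) {A : ι → E →L[ℝ] E} (hA : ∀ i ∈ s, IsSymm (A i)) :
    IsSymm (∑ i ∈ s, A i) := by
  classical
  induction s using Finset.induction_on with
  | empty => simpa using zero
  | insert i s his ih =>
    rw [Finset.sum_insert his]
    exact (hA i (by simp)).add (ih fun j hj => hA j (by simp [hj]))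

lemma pow {A : E →L[ℝ] E} (hA : IsSymm A) (k : ℕ) : IsSymm (A ^ k) := by
  induction k with
  | zero => exact fun x y => by simp
  | succ k ih =>
    intro x y
    have h : (A ^ (k + 1)) y = A ((A ^ k) y) := by rw [pow_succ']; rfl
    rw [h, pow_succ, mul_apply_eq_comp, ih, hA]

end IsSymm

lemma pow_apply_eigenvector {A : E →L[ℝ] E} {v : E} {l : ℝ} (h : A v = l • v) (k : ℕ) :
    (A ^ k) v = l ^ k • v := by
  induction k with
  | zero => simp
  | succ k ih => rw [pow_succ, mul_apply_eq_comp, h, map_smul, ih, smul_smul, pow_succ']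

variable [FiniteDimensional ℝ E]

lemma IsSymm.exists_eigenbasis {A : E →L[ℝ] E} (hA : IsSymm A) :
    ∃ (b : OrthonormalBasis (Fin (finrank ℝ E)) ℝ E) (l : Fin (finrank ℝ E) → ℝ),
      ∀ i, A (b i) = l i • b i := by
  have h : (A : E →ₗ[ℝ] E).IsSymmetric := hA
  exact ⟨h.eigenvectorBasis rfl, h.eigenvalues rfl, fun i => h.apply_eigenvectorBasis rfl i⟩

/-- The trace as a continuous linear functional on operators. -/
def opTrace : (E →L[ℝ] E) →L[ℝ] ℝ :=
  LinearMap.toContinuousLinearMap (LinearMap.trace ℝ E ∘ₗ ContinuousLinearMap.coeLM ℝ)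

lemma opTrace_eq_sum_inner {ι : Type*} [Fintype ι] (b : OrthonormalBasis ι ℝ E)
    (A : E →L[ℝ] E) : opTrace A = ∑ i, ⟪b i, A (b i)⟫_ℝ := by
  simp [opTrace, LinearMap.trace_eq_sum_inner _ b]

lemma opTrace_mul_eq_sum_inner {ι κ : Type*} [Fintype ι] [Fintype κ]
    (b : OrthonormalBasis ι ℝ E) (c : OrthonormalBasis κ ℝ E) (A B : E →L[ℝ] E) :
    opTrace (A * B) = ∑ i, ∑ j, ⟪b i, A (c j)⟫_ℝ * ⟪c j, B (b i)⟫_ℝ := by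
  rw [opTrace_eq_sum_inner b]
  refine Finset.sum_congr rfl fun i _ => ?_
  rw [mul_apply_eq_comp]
  conv_lhs => rw [← c.sum_repr' (B (b i))]
  simp only [map_sum, map_smul, inner_sum, inner_smul_right]
  exact Finset.sum_congr rfl fun j _ => mul_comm _ _

lemma opTrace_pow_eq_sum {ι : Type*} [Fintype ι] {A : E →L[ℝ] E} (b : OrthonormalBasis ι ℝ E)
    {l : ι → ℝ} (h : ∀ i, A (b i) = l i • b i) (k : ℕ) : opTrace (A ^ k) = ∑ i, l i ^ k := by
  rw [opTrace_eq_sum_inner b]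
  refine Finset.sum_congr rfl fun i _ => ?_
  rw [pow_apply_eigenvector (h i), inner_smul_right, real_inner_self_eq_norm_sq]
  simp

/-- A rearrangement inequality: `|x|^i - |y|^i` and `|x|^j - |y|^j` have the same sign. Evenness of
`i + j` removes the absolute values on the right. -/
lemma pow_mul_pow_add_le (x y : ℝ) (i j : ℕ) (h : Even (i + j)) :
    x ^ i * y ^ j + x ^ j * y ^ i ≤ x ^ (i + j) + y ^ (i + j) := by
  have h1 : x ^ i * y ^ j + x ^ j * y ^ i ≤ |x| ^ i * |y| ^ j + |x| ^ j * |y| ^ i := by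
    refine add_le_add ?_ ?_ <;>
      (rw [← abs_pow, ← abs_pow, ← abs_mul]; exact le_abs_self _)
  have h2 : 0 ≤ (|x| ^ i - |y| ^ i) * (|x| ^ j - |y| ^ j) := by
    rcases le_total |x| |y| with hxy | hxy
    · exact mul_nonneg_of_nonpos_of_nonpos
        (sub_nonpos.2 (pow_le_pow_left₀ (abs_nonneg _) hxy _))
        (sub_nonpos.2 (pow_le_pow_left₀ (abs_nonneg _) hxy _))
    · exact mul_nonneg (sub_nonneg.2 (pow_le_pow_left₀ (abs_nonneg _) hxy _))
        (sub_nonneg.2 (pow_le_pow_left₀ (abs_nonneg _) hxy _))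
  rw [← h.pow_abs x, ← h.pow_abs y, pow_add, pow_add]
  nlinarith

/-- The difference of powers is `x - y` times `∑ x^i y^(2p-i)`. Pairing each term with its
reflection bounds that sum by the average of the extreme powers, `2p + 1` times. -/
lemma sub_mul_pow_sub_pow_le (x y : ℝ) (p : ℕ) :
    (x - y) * (x ^ (2 * p + 1) - y ^ (2 * p + 1)) ≤
      (2 * p + 1) / 2 * ((x - y) ^ 2 * (x ^ (2 * p) + y ^ (2 * p))) := by
  have hs := (Commute.all x y).geom_sum₂_mul (2 * p + 1)
  set S := ∑ i ∈ Finset.range (2 * p + 1), x ^ i * y ^ (2 * p + 1 - 1 - i) with hS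
  have hrefl : S = ∑ i ∈ Finset.range (2 * p + 1), x ^ (2 * p - i) * y ^ i := by
    rw [hS, ← Finset.sum_range_reflect]
    refine Finset.sum_congr rfl fun i hi => ?_
    have := Finset.mem_range.1 hi
    congr 2; omega
  have h2 : 2 * S ≤ (2 * p + 1) * (x ^ (2 * p) + y ^ (2 * p)) := by
    calc 2 * S = ∑ i ∈ Finset.range (2 * p + 1),
          (x ^ i * y ^ (2 * p - i) + x ^ (2 * p - i) * y ^ i) := by
          rw [Finset.sum_add_distrib, ← hrefl, two_mul]; simp [hS]
      _ ≤ ∑ i ∈ Finset.range (2 * p + 1), (x ^ (2 * p) + y ^ (2 * p)) := by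
          refine Finset.sum_le_sum fun i hi => ?_
          have hi' : i + (2 * p - i) = 2 * p := by have := Finset.mem_range.1 hi; omega
          have := pow_mul_pow_add_le x y i (2 * p - i) (by rw [hi']; exact even_two_mul p)
          rwa [hi'] at this
      _ = _ := by simp [mul_add]
  rw [← hs]
  nlinarith [mul_le_mul_of_nonneg_left h2 (sq_nonneg (x - y))]

/-- Between an eigenbasis `b` of `X` and an eigenbasis `c` of `Y`, both factors have entries of the
form (difference of eigenvalue powers) times `⟪b i, c j⟫`. The trace thus becomes a double sum to
which the scalar inequality applies termwise, although `X` and `Y` need not commute. -/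
lemma opTrace_sub_mul_pow_sub_pow_le {X Y : E →L[ℝ] E} (hX : IsSymm X) (hY : IsSymm Y)
    {L : ℝ} (hL : ‖X - Y‖ ≤ L) (p : ℕ) :
    opTrace ((X - Y) * (X ^ (2 * p + 1) - Y ^ (2 * p + 1))) ≤
      (2 * p + 1) / 2 * (L ^ 2 * (opTrace (X ^ (2 * p)) + opTrace (Y ^ (2 * p)))) := by
  obtain ⟨b, l, hb⟩ := hX.exists_eigenbasis
  obtain ⟨c, k, hc⟩ := hY.exists_eigenbasis
  have hXY : IsSymm (X - Y) := by simpa [sub_eq_add_neg] using hX.add (hY.smul (-1))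
  have hin : ∀ i j, ⟪b i, (X - Y) (c j)⟫_ℝ = (l i - k j) * ⟪b i, c j⟫_ℝ := fun i j => by
    rw [sub_apply, inner_sub_right, ← hX, hb, hc, inner_smul_left,
      inner_smul_right, sub_mul]; rfl
  have hpow : ∀ i j, ⟪c j, (X ^ (2 * p + 1) - Y ^ (2 * p + 1)) (b i)⟫_ℝ =
      (l i ^ (2 * p + 1) - k j ^ (2 * p + 1)) * ⟪b i, c j⟫_ℝ := fun i j => by
    rw [sub_apply, inner_sub_right, ← hY.pow, pow_apply_eigenvector (hb i),
      pow_apply_eigenvector (hc j), inner_smul_left, inner_smul_right, sub_mul,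
      real_inner_comm (c j)]; rfl
  have hL0 : 0 ≤ L := (norm_nonneg _).trans hL
  -- Parseval: row and column sums of squared entries are `‖(X - Y) b_i‖²` and `‖(X - Y) c_j‖²`. The
  -- operator norm alone controls them, with no loss of dimension.
  have hrow : ∀ i, ∑ j, ((l i - k j) * ⟪b i, c j⟫_ℝ) ^ 2 ≤ L ^ 2 := fun i => by
    have h1 := c.sum_sq_inner_right ((X - Y) (b i))
    have h2 : ‖(X - Y) (b i)‖ ≤ L := ((X - Y).le_opNorm _).trans (by simpa using hL)
    calc _ = ∑ j, ⟪c j, (X - Y) (b i)⟫_ℝ ^ 2 := by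
          refine Finset.sum_congr rfl fun j _ => ?_
          rw [← hXY, real_inner_comm (b i), hin]
      _ = ‖(X - Y) (b i)‖ ^ 2 := h1
      _ ≤ L ^ 2 := pow_le_pow_left₀ (norm_nonneg _) h2 2
  have hcol : ∀ j, ∑ i, ((l i - k j) * ⟪b i, c j⟫_ℝ) ^ 2 ≤ L ^ 2 := fun j => by
    have h1 := b.sum_sq_inner_right ((X - Y) (c j))
    have h2 : ‖(X - Y) (c j)‖ ≤ L := ((X - Y).le_opNorm _).trans (by simpa using hL)
    calc _ = ∑ i, ⟪b i, (X - Y) (c j)⟫_ℝ ^ 2 := by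
          refine Finset.sum_congr rfl fun i _ => ?_
          rw [hin]
      _ = ‖(X - Y) (c j)‖ ^ 2 := h1
      _ ≤ L ^ 2 := pow_le_pow_left₀ (norm_nonneg _) h2 2
  have hnn : ∀ t : ℝ, 0 ≤ t ^ (2 * p) := fun t => (even_two_mul p).pow_nonneg t
  rw [opTrace_mul_eq_sum_inner b c, opTrace_pow_eq_sum b hb, opTrace_pow_eq_sum c hc]
  calc _ = ∑ i, ∑ j, ((l i - k j) * (l i ^ (2 * p + 1) - k j ^ (2 * p + 1))) *
        ⟪b i, c j⟫_ℝ ^ 2 := by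
        refine Finset.sum_congr rfl fun i _ => Finset.sum_congr rfl fun j _ => ?_
        rw [hin, hpow]; ring
    _ ≤ ∑ i, ∑ j, (2 * p + 1) / 2 * (l i ^ (2 * p) * ((l i - k j) * ⟪b i, c j⟫_ℝ) ^ 2 +
          k j ^ (2 * p) * ((l i - k j) * ⟪b i, c j⟫_ℝ) ^ 2) := by
        refine Finset.sum_le_sum fun i _ => Finset.sum_le_sum fun j _ => ?_
        have := mul_le_mul_of_nonneg_right (sub_mul_pow_sub_pow_le (l i) (k j) p)
          (sq_nonneg ⟪b i, c j⟫_ℝ)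
        linarith
    _ = (2 * p + 1) / 2 * (∑ i, l i ^ (2 * p) * ∑ j, ((l i - k j) * ⟪b i, c j⟫_ℝ) ^ 2 +
          ∑ j, k j ^ (2 * p) * ∑ i, ((l i - k j) * ⟪b i, c j⟫_ℝ) ^ 2) := by
        simp only [← Finset.mul_sum, Finset.sum_add_distrib]
        rw [Finset.sum_comm (f := fun i j => k j ^ (2 * p) * _)]
        simp only [← Finset.mul_sum]
    _ ≤ (2 * p + 1) / 2 * (∑ i, l i ^ (2 * p) * L ^ 2 + ∑ j, k j ^ (2 * p) * L ^ 2) := by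
        gcongr with i _ j _
        · exact hnn _
        · exact hrow i
        · exact hnn _
        · exact hcol j
    _ = _ := by rw [← Finset.sum_mul, ← Finset.sum_mul]; ring

lemma opTrace_pow_even_nonneg {X : E →L[ℝ] E} (hX : IsSymm X) (p : ℕ) :
    0 ≤ opTrace (X ^ (2 * p)) := by
  obtain ⟨b, l, hb⟩ := hX.exists_eigenbasis
  rw [opTrace_pow_eq_sum b hb]
  exact Finset.sum_nonneg fun i _ => (even_two_mul p).pow_nonneg _

/-- The trace of an even power is a sum of nonnegative terms, so it dominates each `l_i^(2p)`; the
norm is then read off in the eigenbasis. -/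
lemma norm_le_of_opTrace_pow_le {X : E →L[ℝ] E} (hX : IsSymm X) {p : ℕ} (hp : p ≠ 0) {t : ℝ}
    (ht : 0 ≤ t) (h : opTrace (X ^ (2 * p)) ≤ t ^ (2 * p)) : ‖X‖ ≤ t := by
  obtain ⟨b, l, hb⟩ := hX.exists_eigenbasis
  rw [opTrace_pow_eq_sum b hb] at h
  have hl : ∀ i, l i ^ 2 ≤ t ^ 2 := fun i => by
    have h1 : l i ^ (2 * p) ≤ t ^ (2 * p) :=
      (Finset.single_le_sum (f := fun i => l i ^ (2 * p))
        (fun j _ => (even_two_mul p).pow_nonneg _) (Finset.mem_univ i)).trans h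
    rw [pow_mul, pow_mul] at h1
    exact le_of_pow_le_pow_left₀ hp (sq_nonneg t) h1
  refine ContinuousLinearMap.opNorm_le_bound _ ht fun v => ?_
  refine le_of_sq_le_sq ?_ (by positivity)
  rw [← b.sum_sq_inner_right (X v), mul_pow, ← b.sum_sq_inner_right v, Finset.mul_sum]
  refine Finset.sum_le_sum fun i _ => ?_
  rw [← hX, hb, inner_smul_left, mul_pow]
  exact mul_le_mul_of_nonneg_right (hl i) (sq_nonneg _)

lemma opTrace_one : opTrace (1 : E →L[ℝ] E) = finrank ℝ E := by
  rw [opTrace_eq_sum_inner (stdOrthonormalBasis ℝ E)]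
  simp

end Spectral

/-! ### Concentration of means of independent random operators -/

section Concentration

open Module ProbabilityTheory
open scoped InnerProductSpace

/-- Settles at once the integrability of every trace polynomial in bounded random operators: a
continuous function is bounded on a compact ball. -/
lemma integrable_of_continuous_of_ae_bounded {X F : Type*} [NormedAddCommGroup X] [ProperSpace X]
    [MeasurableSpace X] [OpensMeasurableSpace X] [NormedAddCommGroup F]
    [SecondCountableTopologyEither X F]
    {μ : Measure X} [IsFiniteMeasure μ] {φ : X → F} (hφ : Continuous φ) {C : ℝ}
    (hC : ∀ᵐ x ∂μ, ‖x‖ ≤ C) : Integrable φ μ := by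
  obtain ⟨B, hB⟩ := (isCompact_closedBall (0 : X) C).exists_bound_of_continuousOn hφ.continuousOn
  refine Integrable.of_bound hφ.aestronglyMeasurable B ?_
  filter_upwards [hC] with x hx
  exact hB x (by simpa using hx)

lemma integral_linearMap_comp {Ω V W : Type*} [MeasurableSpace Ω] {P : Measure Ω}
    [NormedAddCommGroup V] [NormedSpace ℝ V] [FiniteDimensional ℝ V] [NormedAddCommGroup W]
    [NormedSpace ℝ W] [CompleteSpace W] (T : V →ₗ[ℝ] W) {f : Ω → V} (hf : Integrable f P) :
    ∫ ω, T (f ω) ∂P = T (∫ ω, f ω ∂P) := by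
  have : CompleteSpace V := FiniteDimensional.complete ℝ V
  exact (LinearMap.toContinuousLinearMap T).integral_comp_comm hf

lemma ae_isSymm_and_norm_sum_le {E Ω ι : Type*} [NormedAddCommGroup E] [InnerProductSpace ℝ E]
    [MeasurableSpace Ω] {P : Measure Ω} {Y : ι → Ω → E →L[ℝ] E} {σ : ℝ}
    (hb : ∀ r, ∀ᵐ ω ∂P, IsSymm (Y r ω) ∧ ‖Y r ω‖ ≤ σ)
    (s : Finset ι) : ∀ᵐ ω ∂P, IsSymm (∑ r ∈ s, Y r ω) ∧ ‖∑ r ∈ s, Y r ω‖ ≤ s.card * σ := by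
  filter_upwards [(Finset.eventually_all s).2 fun r _ => hb r] with ω hω
  refine ⟨IsSymm.sum s fun r hr => (hω r hr).1, (norm_sum_le _ _).trans ?_⟩
  simpa using Finset.sum_le_card_nsmul s _ σ fun r hr => (hω r hr).2

variable {E : Type*} [NormedAddCommGroup E] [InnerProductSpace ℝ E] [FiniteDimensional ℝ E]

lemma integral_opTrace_mul_eq_zero {ν : Measure (E →L[ℝ] E)} (hi : Integrable id ν)
    (h0 : ∫ A, A ∂ν = 0) (Q : E →L[ℝ] E) : ∫ A, opTrace (A * Q) ∂ν = 0 := by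
  have := (opTrace ∘L (ContinuousLinearMap.mul ℝ (E →L[ℝ] E)).flip Q).integral_comp_comm hi
  simpa [h0] using this

/-- Symmetrization: for an independent copy `A'` of the centred `A`, the left side is half the mean
of `tr((A - A')((A + R)^(2p+1) - (A' + R)^(2p+1)))`. The trace inequality applies with `L = 2σ`. -/
lemma integral_opTrace_mul_pow_le {ν : Measure (E →L[ℝ] E)} [IsProbabilityMeasure ν] {σ : ℝ}
    (hν : ∀ᵐ A ∂ν, IsSymm A ∧ ‖A‖ ≤ σ) (h0 : ∫ A, A ∂ν = 0) {R : E →L[ℝ] E} (hR : IsSymm R)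
    (p : ℕ) :
    ∫ A, opTrace (A * (A + R) ^ (2 * p + 1)) ∂ν ≤
      2 * σ ^ 2 * (2 * p + 1) * ∫ A, opTrace ((A + R) ^ (2 * p)) ∂ν := by
  have hb : ∀ᵐ A ∂ν, ‖A‖ ≤ σ := hν.mono fun A h => h.2
  have hν1 := Measure.quasiMeasurePreserving_fst (μ := ν) (ν := ν) |>.ae hν
  have hν2 := Measure.quasiMeasurePreserving_snd (μ := ν) (ν := ν) |>.ae hν
  have hbp : ∀ᵐ z ∂ν.prod ν, ‖z‖ ≤ σ := by
    filter_upwards [hν1, hν2] with z h1 h2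
    exact max_le h1.2 h2.2
  have hint : ∀ φ : (E →L[ℝ] E) × (E →L[ℝ] E) → ℝ, Continuous φ → Integrable φ (ν.prod ν) :=
    fun φ hφ => integrable_of_continuous_of_ae_bounded hφ hbp
  have hmain : ∫ z, (opTrace (z.1 * (z.1 + R) ^ (2 * p + 1)) - opTrace (z.1 * (z.2 + R) ^ (2 * p + 1))
      - opTrace (z.2 * (z.1 + R) ^ (2 * p + 1)) + opTrace (z.2 * (z.2 + R) ^ (2 * p + 1))) ∂ν.prod ν
      ≤ ∫ z, (2 * p + 1) / 2 * ((2 * σ) ^ 2 *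
        (opTrace ((z.1 + R) ^ (2 * p)) + opTrace ((z.2 + R) ^ (2 * p)))) ∂ν.prod ν := by
    refine integral_mono_ae (hint _ (by fun_prop)) (hint _ (by fun_prop)) ?_
    filter_upwards [hν1, hν2] with z h1 h2
    have := opTrace_sub_mul_pow_sub_pow_le (h1.1.add hR) (h2.1.add hR) (L := 2 * σ)
      (by rw [add_sub_add_right_eq_sub]; exact (norm_sub_le _ _).trans (by linarith [h1.2, h2.2])) p
    refine le_trans (le_of_eq ?_) this
    rw [add_sub_add_right_eq_sub, mul_sub, sub_mul, sub_mul, map_sub, map_sub, map_sub]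
    ring
  -- In each of the two cross terms the first factor is independent of the power and has mean zero,
  -- so both vanish; the two diagonal terms are equal.
  rw [integral_add (hint _ (by fun_prop)) (hint _ (by fun_prop)),
    integral_sub (hint _ (by fun_prop)) (hint _ (by fun_prop)),
    integral_sub (hint _ (by fun_prop)) (hint _ (by fun_prop)),
    integral_const_mul, integral_const_mul,
    integral_add (hint _ (by fun_prop)) (hint _ (by fun_prop)),
    integral_fun_fst (fun A => opTrace (A * (A + R) ^ (2 * p + 1))),
    integral_fun_snd (fun A => opTrace (A * (A + R) ^ (2 * p + 1))),
    integral_fun_fst (fun A => opTrace ((A + R) ^ (2 * p))),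
    integral_fun_snd (fun A => opTrace ((A + R) ^ (2 * p))),
    integral_prod_symm _ (hint (fun z => opTrace (z.1 * (z.2 + R) ^ (2 * p + 1))) (by fun_prop)),
    integral_prod _ (hint (fun z => opTrace (z.2 * (z.1 + R) ^ (2 * p + 1))) (by fun_prop))] at hmain
  have hid : Integrable id ν := integrable_of_continuous_of_ae_bounded continuous_id hb
  simp only [integral_opTrace_mul_eq_zero hid h0, integral_zero, probReal_univ, one_smul] at hmain
  linarith

variable {Ω ι : Type*} [MeasurableSpace Ω] {P : Measure Ω} [IsProbabilityMeasure P]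
  {Y : ι → Ω → E →L[ℝ] E} {σ : ℝ}

lemma integrable_comp_of_ae_bounded {X : Ω → E →L[ℝ] E} (hX : Measurable X) {C : ℝ}
    (hC : ∀ᵐ ω ∂P, ‖X ω‖ ≤ C) {φ : (E →L[ℝ] E) → ℝ} (hφ : Continuous φ) :
    Integrable (fun ω => φ (X ω)) P := by
  have : IsProbabilityMeasure (P.map X) := Measure.isProbabilityMeasure_map hX.aemeasurable
  refine Integrable.comp_measurable (f := X) (g := φ) ?_ hX
  refine integrable_of_continuous_of_ae_bounded hφ (C := C) ?_
  rw [ae_map_iff hX.aemeasurable (measurableSet_le measurable_norm measurable_const)]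
  exact hC

lemma measurableSet_isSymm : MeasurableSet {A : E →L[ℝ] E | IsSymm A} := by
  have : {A : E →L[ℝ] E | IsSymm A} = ⋂ x, ⋂ y, {A | ⟪A x, y⟫_ℝ = ⟪x, A y⟫_ℝ} := by
    ext; simp [IsSymm]
  rw [this]
  refine (isClosed_iInter fun x => isClosed_iInter fun y => isClosed_eq ?_ ?_).measurableSet
  · fun_prop
  · fun_prop

/-- Peel one factor off the power and write it as `∑ Y r`. In the term of index `r`, the sum is `Y r
+ R` with `R` independent of `Y r`, so the one-variable bound applies conditionally on `R`. -/
lemma integral_opTrace_sum_pow_succ_le (hm : ∀ r, Measurable (Y r)) (hind : iIndepFun Y P)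
    (hb : ∀ r, ∀ᵐ ω ∂P, IsSymm (Y r ω) ∧ ‖Y r ω‖ ≤ σ) (h0 : ∀ r, ∫ ω, Y r ω ∂P = 0)
    (s : Finset ι) (p : ℕ) :
    ∫ ω, opTrace ((∑ r ∈ s, Y r ω) ^ (2 * (p + 1))) ∂P ≤
      s.card * (2 * σ ^ 2 * (2 * p + 1)) * ∫ ω, opTrace ((∑ r ∈ s, Y r ω) ^ (2 * p)) ∂P := by
  classical
  have hmS : ∀ t : Finset ι, Measurable fun ω => ∑ r ∈ t, Y r ω := fun t =>
    Finset.measurable_sum _ fun r _ => hm r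
  have hone : ∀ r ∈ s, Integrable (fun ω => opTrace (Y r ω * (∑ r ∈ s, Y r ω) ^ (2 * p + 1))) P ∧
      ∫ ω, opTrace (Y r ω * (∑ r ∈ s, Y r ω) ^ (2 * p + 1)) ∂P ≤
      2 * σ ^ 2 * (2 * p + 1) * ∫ ω, opTrace ((∑ r ∈ s, Y r ω) ^ (2 * p)) ∂P := by
    intro r hr
    set R : Ω → E →L[ℝ] E := fun ω => ∑ q ∈ s.erase r, Y q ω with hRdef
    have hsum : ∀ ω, ∑ q ∈ s, Y q ω = Y r ω + R ω := fun ω => (Finset.add_sum_erase s _ hr).symm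
    have hindR : IndepFun (Y r) R P := by
      have := (hind.indepFun_finsetSum_of_notMem hm (Finset.notMem_erase r s)).symm
      convert this using 1
      ext1 ω; simp [hRdef]
    have hmR : Measurable R := hmS _
    have hmap := hindR.map_prod_eq_prod_map_map (hm r).aemeasurable hmR.aemeasurable
    have : IsProbabilityMeasure (P.map (Y r)) :=
      Measure.isProbabilityMeasure_map (hm r).aemeasurable
    have : IsProbabilityMeasure (P.map R) := Measure.isProbabilityMeasure_map hmR.aemeasurable
    have hmp : Measurable fun ω => (Y r ω, R ω) := (hm r).prodMk hmR
    have hY : ∀ᵐ A ∂P.map (Y r), IsSymm A ∧ ‖A‖ ≤ σ := by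
      exact (ae_map_iff (hm r).aemeasurable (measurableSet_isSymm.inter
        (measurableSet_le measurable_norm measurable_const))).2 (hb r)
    have hRb : ∀ᵐ A ∂P.map R, IsSymm A ∧ ‖A‖ ≤ (s.erase r).card * σ := by
      exact (ae_map_iff hmR.aemeasurable (measurableSet_isSymm.inter
        (measurableSet_le measurable_norm measurable_const))).2 (ae_isSymm_and_norm_sum_le hb _)
    have hY0 : ∫ A, A ∂P.map (Y r) = 0 := by
      rw [integral_map (hm r).aemeasurable (by fun_prop), h0]
    have hbp : ∀ᵐ z ∂(P.map (Y r)).prod (P.map R), ‖z‖ ≤ max σ ((s.erase r).card * σ) := by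
      filter_upwards [Measure.quasiMeasurePreserving_fst.ae hY,
        Measure.quasiMeasurePreserving_snd.ae hRb] with z h1 h2
      exact max_le_max h1.2 h2.2
    have hint : ∀ φ : (E →L[ℝ] E) × (E →L[ℝ] E) → ℝ, Continuous φ →
        Integrable φ ((P.map (Y r)).prod (P.map R)) :=
      fun φ hφ => integrable_of_continuous_of_ae_bounded hφ hbp
    -- The joint law is a product, so `Y r` can be integrated first with the rest frozen.
    have hpush : ∀ φ : (E →L[ℝ] E) × (E →L[ℝ] E) → ℝ, Continuous φ →
        Integrable (fun ω => φ (Y r ω, R ω)) P ∧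
        ∫ ω, φ (Y r ω, R ω) ∂P = ∫ B, ∫ A, φ (A, B) ∂P.map (Y r) ∂P.map R := fun φ hφ => by
      have hi := hint φ hφ
      rw [← integral_prod_symm _ hi]
      rw [← hmap] at hi ⊢
      exact ⟨hi.comp_measurable hmp, (integral_map hmp.aemeasurable (by fun_prop)).symm⟩
    simp only [hsum]
    obtain ⟨i1, e1⟩ := hpush (fun z => opTrace (z.1 * (z.1 + z.2) ^ (2 * p + 1))) (by fun_prop)
    obtain ⟨-, e2⟩ := hpush (fun z => opTrace ((z.1 + z.2) ^ (2 * p))) (by fun_prop)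
    refine ⟨i1, ?_⟩
    simp only at e1 e2
    rw [e1, e2, ← integral_const_mul]
    refine integral_mono_ae (hint (fun z => opTrace (z.1 * (z.1 + z.2) ^ (2 * p + 1)))
      (by fun_prop)).integral_prod_right
      ((hint (fun z => opTrace ((z.1 + z.2) ^ (2 * p))) (by fun_prop)).integral_prod_right.const_mul
        _) ?_
    filter_upwards [hRb] with B hB
    exact integral_opTrace_mul_pow_le hY hY0 hB.1 p
  calc ∫ ω, opTrace ((∑ r ∈ s, Y r ω) ^ (2 * (p + 1))) ∂P
      = ∑ r ∈ s, ∫ ω, opTrace (Y r ω * (∑ r ∈ s, Y r ω) ^ (2 * p + 1)) ∂P := by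
        rw [← integral_finsetSum _ fun r hr => (hone r hr).1]
        refine integral_congr_ae (Filter.Eventually.of_forall fun ω => ?_)
        simp only
        rw [show 2 * (p + 1) = 2 * p + 1 + 1 by ring, pow_succ', Finset.sum_mul, map_sum]
    _ ≤ ∑ r ∈ s, 2 * σ ^ 2 * (2 * p + 1) * ∫ ω, opTrace ((∑ r ∈ s, Y r ω) ^ (2 * p)) ∂P :=
        Finset.sum_le_sum fun r hr => (hone r hr).2
    _ = _ := by rw [Finset.sum_const, nsmul_eq_mul]; ring

/-- Iterates the recursion `p` times from `tr 1 = dim E`, replacing each factor `2(2q + 1)` by the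
crude `4p`. -/
lemma integral_opTrace_sum_pow_le (hm : ∀ r, Measurable (Y r)) (hind : iIndepFun Y P)
    (hb : ∀ r, ∀ᵐ ω ∂P, IsSymm (Y r ω) ∧ ‖Y r ω‖ ≤ σ) (h0 : ∀ r, ∫ ω, Y r ω ∂P = 0)
    (s : Finset ι) (p : ℕ) :
    ∫ ω, opTrace ((∑ r ∈ s, Y r ω) ^ (2 * p)) ∂P ≤
      finrank ℝ E * (4 * p * σ ^ 2 * s.card) ^ p := by
  have key : ∀ q, q ≤ p → ∫ ω, opTrace ((∑ r ∈ s, Y r ω) ^ (2 * q)) ∂P ≤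
      finrank ℝ E * (4 * p * σ ^ 2 * s.card) ^ q := by
    intro q hq
    induction q with
    | zero => simp [opTrace_one]
    | succ q ih =>
      refine (integral_opTrace_sum_pow_succ_le hm hind hb h0 s q).trans ?_
      have hq' : (q : ℝ) + 1 ≤ p := by exact_mod_cast hq
      have hn : 0 ≤ ∫ ω, opTrace ((∑ r ∈ s, Y r ω) ^ (2 * q)) ∂P :=
        integral_nonneg_of_ae ((ae_isSymm_and_norm_sum_le hb s).mono fun ω h =>
          opTrace_pow_even_nonneg h.1 q)
      calc _ ≤ (4 * p * σ ^ 2 * s.card) * (finrank ℝ E * (4 * p * σ ^ 2 * s.card) ^ q) := by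
            refine mul_le_mul ?_ (ih (by omega)) hn (by positivity)
            have : 0 ≤ (s.card : ℝ) * σ ^ 2 := by positivity
            nlinarith
        _ = _ := by ring
  exact key p le_rfl

lemma measure_norm_sum_gt_le (hm : ∀ r, Measurable (Y r)) (hind : iIndepFun Y P)
    (hb : ∀ r, ∀ᵐ ω ∂P, IsSymm (Y r ω) ∧ ‖Y r ω‖ ≤ σ) (h0 : ∀ r, ∫ ω, Y r ω ∂P = 0)
    (s : Finset ι) {p : ℕ} (hp : p ≠ 0) {t : ℝ} (ht : 0 < t) :
    P.real {ω | t < ‖∑ r ∈ s, Y r ω‖} ≤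
      finrank ℝ E * (4 * p * σ ^ 2 * s.card / t ^ 2) ^ p := by
  have hae := ae_isSymm_and_norm_sum_le hb s
  have hmark := mul_meas_ge_le_integral_of_nonneg (μ := P)
    (f := fun ω => opTrace ((∑ r ∈ s, Y r ω) ^ (2 * p)))
    (hae.mono fun ω h => opTrace_pow_even_nonneg h.1 p)
    (integrable_comp_of_ae_bounded (Finset.measurable_sum _ fun r _ => hm r)
      (hae.mono fun ω h => h.2) (φ := fun A => opTrace (A ^ (2 * p))) (by fun_prop)) (t ^ (2 * p))
  have hsub : P.real {ω | t < ‖∑ r ∈ s, Y r ω‖} ≤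
      P.real {ω | t ^ (2 * p) ≤ opTrace ((∑ r ∈ s, Y r ω) ^ (2 * p))} := by
    refine ENNReal.toReal_mono (measure_ne_top _ _) (measure_mono_ae ?_)
    filter_upwards [hae] with ω h hlt
    by_contra hcon
    exact absurd (norm_le_of_opTrace_pow_le h.1 hp ht.le (not_le.1 hcon).le) (not_le.2 hlt)
  have ht' : 0 < t ^ (2 * p) := by positivity
  rw [div_pow, ← pow_mul, ← mul_div_assoc, le_div_iff₀ ht', mul_comm]
  exact (mul_le_mul_of_nonneg_left hsub ht'.le).trans
    (hmark.trans (integral_opTrace_sum_pow_le hm hind hb h0 s p))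

lemma measure_norm_mean_symm_gt_le (hm : ∀ r, Measurable (Y r)) (hind : iIndepFun Y P)
    (hb : ∀ r, ∀ᵐ ω ∂P, IsSymm (Y r ω) ∧ ‖Y r ω‖ ≤ σ) (h0 : ∀ r, ∫ ω, Y r ω ∂P = 0)
    (s : Finset ι) {c δ : ℝ} (hc : 0 < c) (hδ : 0 < δ) (hlog : 1 ≤ Real.log (finrank ℝ E / δ))
    (hN : 24 * Real.log (finrank ℝ E / δ) ≤ s.card * c ^ 2) :
    P {ω | c * σ < ‖(s.card : ℝ)⁻¹ • ∑ r ∈ s, Y r ω‖} ≤ ENNReal.ofReal δ := by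
  set l := Real.log (finrank ℝ E / δ) with hl
  have hN0 : (0 : ℝ) < s.card := by
    rcases (Nat.cast_nonneg s.card : (0 : ℝ) ≤ s.card).eq_or_lt with h | h
    · rw [← h] at hN; linarith
    · exact h
  obtain ⟨r₀, hr₀⟩ : s.Nonempty := Finset.card_pos.1 (by exact_mod_cast hN0)
  have hσ : 0 ≤ σ := by
    obtain ⟨ω, hω⟩ := (hb r₀).exists
    exact (norm_nonneg _).trans hω.2
  -- For `σ = 0` the Markov threshold would be zero, but the sum vanishes almost surely.
  rcases hσ.eq_or_lt with rfl | hσ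
  · refine le_of_eq_of_le ?_ zero_le
    rw [← nonpos_iff_eq_zero, ← measure_empty (μ := P)]
    refine measure_mono_ae ?_
    filter_upwards [ae_isSymm_and_norm_sum_le hb s] with ω h hlt
    have h1 : ‖∑ r ∈ s, Y r ω‖ ≤ 0 := by simpa using h.2
    have h2 : c * 0 < ‖(s.card : ℝ)⁻¹ • ∑ r ∈ s, Y r ω‖ := hlt
    rw [norm_smul, le_antisymm h1 (norm_nonneg _)] at h2
    simp at h2
  have hd : (0 : ℝ) < finrank ℝ E := by
    -- In dimension zero the convention `Real.log 0 = 0` contradicts `hlog`.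
    rcases (Nat.cast_nonneg (finrank ℝ E) : (0 : ℝ) ≤ finrank ℝ E).eq_or_lt with h | h
    · rw [hl, ← h] at hlog; simp at hlog; linarith
    · exact h
  -- The moment order `p ≈ log(d/δ)` turns a base of at most `e⁻¹` into `d e^(-p) ≤ δ`.
  set p := ⌈l⌉₊ with hpdef
  have hp1 : l ≤ p := Nat.le_ceil l
  have hp2 : (p : ℝ) ≤ 2 * l := by linarith [Nat.ceil_lt_add_one (show 0 ≤ l by linarith)]
  have hp0 : p ≠ 0 := by rintro h; rw [h] at hp1; norm_num at hp1; linarith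
  have hset : {ω | c * σ < ‖(s.card : ℝ)⁻¹ • ∑ r ∈ s, Y r ω‖} =
      {ω | s.card * (c * σ) < ‖∑ r ∈ s, Y r ω‖} := by
    ext ω
    simp only [mem_ofPred_eq, norm_smul, norm_inv, Real.norm_natCast]
    rw [inv_mul_eq_div, lt_div_iff₀ hN0, mul_comm]
  rw [hset, ← ofReal_measureReal]
  refine ENNReal.ofReal_le_ofReal
    ((measure_norm_sum_gt_le hm hind hb h0 s hp0 (by positivity)).trans ?_)
  -- Here `4p ≤ 8l` and `N c² ≥ 24 l`, so the base is at most `1/3 < e⁻¹`; this is the source of the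
  -- constant 24.
  have hfrac : 4 * p * σ ^ 2 * s.card / (s.card * (c * σ)) ^ 2 ≤ Real.exp (-1) := by
    have h1 : 4 * p * σ ^ 2 * s.card / (s.card * (c * σ)) ^ 2 = 4 * p / (s.card * c ^ 2) := by
      field_simp
    have h3 : (3 : ℝ)⁻¹ ≤ Real.exp (-1) := by
      rw [Real.exp_neg]
      exact inv_anti₀ (Real.exp_pos _) (by linarith [Real.exp_one_lt_d9])
    rw [h1]
    refine le_trans ?_ h3
    rw [div_le_iff₀ (by positivity)]
    linarith
  calc (finrank ℝ E : ℝ) * (4 * p * σ ^ 2 * s.card / (s.card * (c * σ)) ^ 2) ^ p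
      ≤ finrank ℝ E * Real.exp (-1) ^ p := by gcongr
    _ = finrank ℝ E * Real.exp (-p) := by rw [← Real.exp_nat_mul]; simp
    _ ≤ finrank ℝ E * Real.exp (-l) := by gcongr
    _ = δ := by rw [hl, Real.exp_neg, Real.exp_log (by positivity)]; field_simp

/-- The self-adjoint dilation `(x, y) ↦ (Aᵀ y, A x)` of an operator `A`. -/
def dilation {F G : Type*} [NormedAddCommGroup F] [InnerProductSpace ℝ F] [FiniteDimensional ℝ F]
    [NormedAddCommGroup G] [InnerProductSpace ℝ G] [FiniteDimensional ℝ G] :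
    (F →L[ℝ] G) →ₗ[ℝ] (WithLp 2 (F × G) →L[ℝ] WithLp 2 (F × G)) where
  toFun A := LinearMap.toContinuousLinearMap
    { toFun := fun z => WithLp.toLp 2 (ContinuousLinearMap.adjoint A z.snd, A z.fst)
      map_add' := fun x y => by simp [← WithLp.toLp_add]
      map_smul' := fun r x => by simp [← WithLp.toLp_smul] }
  map_add' A B := by
    ext1 z
    change WithLp.toLp 2 (ContinuousLinearMap.adjoint (A + B) z.snd, (A + B) z.fst) =
      WithLp.toLp 2 (ContinuousLinearMap.adjoint A z.snd, A z.fst) +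
      WithLp.toLp 2 (ContinuousLinearMap.adjoint B z.snd, B z.fst)
    simp [← WithLp.toLp_add]
  map_smul' r A := by
    ext1 z
    change WithLp.toLp 2 (ContinuousLinearMap.adjoint (r • A) z.snd, (r • A) z.fst) =
      r • WithLp.toLp 2 (ContinuousLinearMap.adjoint A z.snd, A z.fst)
    simp [← WithLp.toLp_smul]

/-! ### Matrix Hoeffding for rectangular operators, by passing to the dilation. -/

section Dilation

variable {F G : Type*} [NormedAddCommGroup F] [InnerProductSpace ℝ F] [FiniteDimensional ℝ F]
    [NormedAddCommGroup G] [InnerProductSpace ℝ G] [FiniteDimensional ℝ G]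

lemma dilation_apply (A : F →L[ℝ] G) (z : WithLp 2 (F × G)) :
    dilation A z = WithLp.toLp 2 (ContinuousLinearMap.adjoint A z.snd, A z.fst) := rfl

lemma isSymm_dilation (A : F →L[ℝ] G) : IsSymm (dilation A) := fun x y => by
  simp only [dilation_apply, WithLp.prod_inner_apply, ContinuousLinearMap.adjoint_inner_left,
    ContinuousLinearMap.adjoint_inner_right]
  exact add_comm _ _

lemma norm_dilation (A : F →L[ℝ] G) : ‖dilation A‖ = ‖A‖ := by
  refine le_antisymm ?_ ?_
  · refine ContinuousLinearMap.opNorm_le_bound _ (norm_nonneg _) fun z => ?_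
    refine le_of_sq_le_sq ?_ (by positivity)
    rw [dilation_apply, mul_pow, WithLp.prod_norm_sq_eq_of_L2, WithLp.prod_norm_sq_eq_of_L2]
    have h1 := pow_le_pow_left₀ (norm_nonneg _) (A.le_opNorm z.fst) 2
    have h2 := pow_le_pow_left₀ (norm_nonneg _) ((ContinuousLinearMap.adjoint A).le_opNorm z.snd) 2
    rw [LinearIsometryEquiv.norm_map] at h2
    change ‖ContinuousLinearMap.adjoint A z.snd‖ ^ 2 + ‖A z.fst‖ ^ 2 ≤ _
    nlinarith
  · refine ContinuousLinearMap.opNorm_le_bound A (norm_nonneg (dilation A)) fun v => ?_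
    have h := (dilation A).le_opNorm (WithLp.toLp 2 (v, 0))
    simpa [dilation_apply] using h

/-- A matrix Hoeffding inequality for the operator norm of a mean of independent centred bounded
random operators. -/
lemma measure_norm_mean_gt_le {Z : ι → Ω → F →L[ℝ] G} (hm : ∀ r, Measurable (Z r))
    (hind : iIndepFun Z P) (hb : ∀ r, ∀ᵐ ω ∂P, ‖Z r ω‖ ≤ σ) (h0 : ∀ r, ∫ ω, Z r ω ∂P = 0)
    (s : Finset ι) {c δ : ℝ} (hc : 0 < c) (hδ : 0 < δ)
    (hlog : 1 ≤ Real.log ((finrank ℝ F + finrank ℝ G) / δ))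
    (hN : 24 * Real.log ((finrank ℝ F + finrank ℝ G) / δ) ≤ s.card * c ^ 2) :
    P {ω | c * σ < ‖(s.card : ℝ)⁻¹ • ∑ r ∈ s, Z r ω‖} ≤ ENNReal.ofReal δ := by
  have hcont : Continuous (dilation : (F →L[ℝ] G) →ₗ[ℝ] _) :=
    LinearMap.continuous_of_finiteDimensional _
  -- The dilation acts on the sum of both spaces: hence `m + n` in the logarithms for Jacobians and
  -- `m + 1` for vectors.
  have hdim : (finrank ℝ (WithLp 2 (F × G)) : ℝ) = finrank ℝ F + finrank ℝ G := by
    rw [(WithLp.linearEquiv 2 ℝ (F × G)).finrank_eq]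
    simp
  have hint : ∀ r, Integrable (Z r) P := fun r =>
    Integrable.of_bound (hm r).aestronglyMeasurable σ (hb r)
  have := measure_norm_mean_symm_gt_le (P := P) (σ := σ) (Y := fun r ω => dilation (Z r ω))
    (fun r => hcont.measurable.comp (hm r)) (hind.comp _ fun _ => hcont.measurable)
    (fun r => (hb r).mono fun ω h => ⟨isSymm_dilation _, (norm_dilation _).trans_le h⟩)
    (fun r => by
      have := integral_linearMap_comp (W := WithLp 2 (F × G) →L[ℝ] WithLp 2 (F × G)) dilation (hint r)
      rw [h0, map_zero] at this
      exact this) s hc hδ (by rwa [hdim]) (by rwa [hdim])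
  simp only [← map_sum, ← map_smul, norm_dilation] at this
  exact this

end Dilation

end Concentration

/-! ### Means over batches of fresh samples -/

section Sampling

open Module ProbabilityTheory

variable {Ξ ι : Type*} [MeasurableSpace Ξ] {D : Measure Ξ} [IsProbabilityMeasure D]
  {G : Type*} [NormedAddCommGroup G] [InnerProductSpace ℝ G] [FiniteDimensional ℝ G]

lemma integrable_of_ae_norm_sub_le {V : Type*} [NormedAddCommGroup V] {F : Ξ → V}
    (hF : AEStronglyMeasurable F D) {v : V} {σ : ℝ} (hb : ∀ᵐ ξ ∂D, ‖F ξ - v‖ ≤ σ) :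
    Integrable F D := by
  have h1 : Integrable (fun ξ => F ξ - v) D :=
    Integrable.of_bound (hF.sub aestronglyMeasurable_const) σ hb
  exact (h1.add (integrable_const v)).congr (Filter.Eventually.of_forall fun ξ => by simp)

lemma infinitePi_batch_operator_gt_le {F' : Type*} [NormedAddCommGroup F'] [InnerProductSpace ℝ F']
    [FiniteDimensional ℝ F'] {F : Ξ → F' →L[ℝ] G} (hF : Measurable F) {v : F' →L[ℝ] G} {σ : ℝ}
    (hb : ∀ᵐ ξ ∂D, ‖F ξ - v‖ ≤ σ) (hv : ∫ ξ, F ξ ∂D = v) {e : ℕ → ι}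
    (he : Function.Injective e) {N : ℕ} (hN0 : 0 < N) {c δ : ℝ} (hc : 0 < c) (hδ : 0 < δ)
    (hlog : 1 ≤ Real.log ((finrank ℝ F' + finrank ℝ G) / δ))
    (hN : 24 * Real.log ((finrank ℝ F' + finrank ℝ G) / δ) ≤ N * c ^ 2) :
    Measure.infinitePi (fun _ : ι => D)
      {ω | c * σ < ‖(N : ℝ)⁻¹ • ∑ r ∈ Finset.range N, F (ω (e r)) - v‖} ≤ ENNReal.ofReal δ := by
  have hmp : ∀ j : ι, MeasurePreserving (fun ω : ι → Ξ => ω j)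
      (Measure.infinitePi fun _ : ι => D) D := fun j =>
    ⟨measurable_pi_apply j, Measure.infinitePi_map_eval (fun _ : ι => D) j⟩
  have hm : Measurable fun ξ => F ξ - v := hF.sub_const v
  have hind : iIndepFun (fun (r : ℕ) (ω : ι → Ξ) => F (ω (e r)) - v)
      (Measure.infinitePi fun _ : ι => D) :=
    (iIndepFun_infinitePi (P := fun _ : ι => D) (X := fun _ ξ => F ξ - v)
      fun _ => hm).precomp he
  have h := measure_norm_mean_gt_le (P := Measure.infinitePi fun _ : ι => D) (σ := σ)
    (Z := fun (r : ℕ) (ω : ι → Ξ) => F (ω (e r)) - v)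
    (fun r => hm.comp (measurable_pi_apply _)) hind
    (fun r => (hmp (e r)).quasiMeasurePreserving.ae hb)
    (fun r => by
      have hi : Integrable F D := integrable_of_ae_norm_sub_le hF.aestronglyMeasurable hb
      have h2 : ∫ ω, (F (ω (e r)) - v) ∂(Measure.infinitePi fun _ : ι => D) =
          ∫ ξ, (F ξ - v) ∂D := by
        conv_rhs => rw [← (hmp (e r)).map_eq]
        rw [integral_map (measurable_pi_apply _).aemeasurable hm.aestronglyMeasurable]
      rw [h2, integral_sub hi (integrable_const v), hv]
      simp)
    (Finset.range N) hc hδ hlog (by simpa using hN)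
  have hN' : (N : ℝ) ≠ 0 := by positivity
  convert h using 6 with ω
  rw [Finset.sum_sub_distrib, smul_sub]
  simp only [Finset.sum_const, Finset.card_range]
  rw [← Nat.cast_smul_eq_nsmul ℝ, smul_smul, inv_mul_cancel₀ hN', one_smul]

lemma infinitePi_batch_vector_gt_le [MeasurableSpace G] [BorelSpace G] {F : Ξ → G}
    (hF : Measurable F) {v : G} {σ : ℝ}
    (hb : ∀ᵐ ξ ∂D, ‖F ξ - v‖ ≤ σ) (hv : ∫ ξ, F ξ ∂D = v) {e : ℕ → ι}
    (he : Function.Injective e) {N : ℕ} (hN0 : 0 < N) {c δ : ℝ} (hc : 0 < c) (hδ : 0 < δ)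
    (hlog : 1 ≤ Real.log ((finrank ℝ G + 1) / δ))
    (hN : 24 * Real.log ((finrank ℝ G + 1) / δ) ≤ N * c ^ 2) :
    Measure.infinitePi (fun _ : ι => D)
      {ω | c * σ < ‖(N : ℝ)⁻¹ • ∑ r ∈ Finset.range N, F (ω (e r)) - v‖} ≤ ENNReal.ofReal δ := by
  -- A vector is isometrically an operator from `ℝ`, so the operator case covers vectors.
  let T : G →ₗ[ℝ] (ℝ →L[ℝ] G) :=
    { toFun := fun v => ContinuousLinearMap.toSpanSingleton ℝ v
      map_add' := fun x y => ContinuousLinearMap.toSpanSingleton_add ℝ x y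
      map_smul' := fun r x => ContinuousLinearMap.toSpanSingleton_smul ℝ r x }
  have hT : ∀ v, ‖T v‖ = ‖v‖ := fun v => ContinuousLinearMap.norm_toSpanSingleton v
  have hTc : Continuous T := LinearMap.continuous_of_finiteDimensional T
  have hfr : ((finrank ℝ ℝ : ℝ) + finrank ℝ G) = finrank ℝ G + 1 := by
    rw [finrank_self]; push_cast; ring
  have hi : Integrable F D := integrable_of_ae_norm_sub_le hF.aestronglyMeasurable hb
  have h := infinitePi_batch_operator_gt_le (D := D) (ι := ι) (F := fun ξ => T (F ξ)) (v := T v)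
    (σ := σ) (hTc.measurable.comp hF)
    (hb.mono fun ξ h => by rw [← map_sub, hT]; exact h)
    (by rw [integral_linearMap_comp T hi, hv]) he hN0 hc hδ (by rwa [hfr]) (by rwa [hfr])
  simpa only [← map_sum, ← map_smul, ← map_sub, hT] using h

end Sampling

/-! ### Freshness of the draws -/

section Freeze

variable {Ξ ι Z : Type*} [MeasurableSpace Ξ] [MeasurableSpace Z]

/-- Overwrite the coordinates in `T` of the first family by those of the second. -/
def splice (T : Set ι) [DecidablePred (· ∈ T)] (q : (ι → Ξ) × (ι → Ξ)) (j : ι) : Ξ :=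
  if j ∈ T then q.2 j else q.1 j

/-- Tested on finite boxes: the preimage of a box is the product of its part off `T` and its part on
`T`. -/
lemma measurePreserving_splice (D : Measure Ξ) [IsProbabilityMeasure D] (T : Set ι)
    [DecidablePred (· ∈ T)] :
    MeasurePreserving (splice T) ((Measure.infinitePi fun _ : ι => D).prod
      (Measure.infinitePi fun _ : ι => D)) (Measure.infinitePi fun _ : ι => D) := by
  have hm : Measurable (splice (Ξ := Ξ) T) := by
    refine measurable_pi_lambda _ fun j => ?_
    unfold splice
    split_ifs <;> fun_prop
  refine ⟨hm, Measure.eq_infinitePi _ fun s t ht => ?_⟩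
  classical
  rw [Measure.map_apply hm (MeasurableSet.pi s.countable_toSet fun i _ => ht i)]
  have hpre : splice (Ξ := Ξ) T ⁻¹' (Set.pi s t) =
      (Set.pi (s.filter fun j => j ∉ T : Finset ι) t) ×ˢ
      (Set.pi (s.filter fun j => j ∈ T : Finset ι) t) := by
    ext q
    simp only [mem_preimage, mem_prod, Set.mem_pi, Finset.coe_filter, mem_ofPred_eq, splice,
      Finset.mem_coe]
    constructor
    · exact fun h => ⟨fun j hj => by simpa [hj.2] using h j hj.1,
        fun j hj => by simpa [hj.2] using h j hj.1⟩
    · intro h j hj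
      by_cases hT : j ∈ T
      · simpa [hT] using h.2 j ⟨hj, hT⟩
      · simpa [hT] using h.1 j ⟨hj, hT⟩
  rw [hpre, Measure.prod_prod, Measure.infinitePi_pi _ fun i _ => ht i,
    Measure.infinitePi_pi _ fun i _ => ht i, mul_comm]
  exact Finset.prod_filter_mul_prod_filter_not s (fun j => j ∈ T) _

/-- If `F` does not look at the coordinates in `T` and an event concerning these coordinates has
probability at most `δ` for each fixed parameter, then so it has for the random parameter `F`. -/
lemma infinitePi_freeze_le {D : Measure Ξ} [IsProbabilityMeasure D] (T : Set ι)
    {F : (ι → Ξ) → Z} (hF : Measurable F)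
    (hFT : ∀ ω ω', (∀ j, j ∉ T → ω j = ω' j) → F ω = F ω') {Bad : Z → (ι → Ξ) → Prop}
    (hBad : MeasurableSet {q : Z × (ι → Ξ) | Bad q.1 q.2})
    (hBadT : ∀ z ω ω', (∀ j ∈ T, ω j = ω' j) → (Bad z ω ↔ Bad z ω')) {δ : ℝ≥0∞}
    (hδ : ∀ z, Measure.infinitePi (fun _ : ι => D) {ω | Bad z ω} ≤ δ) :
    Measure.infinitePi (fun _ : ι => D) {ω | Bad (F ω) ω} ≤ δ := by
  classical
  set μ := Measure.infinitePi fun _ : ι => D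
  have hS : MeasurableSet {ω | Bad (F ω) ω} := (hF.prodMk measurable_id) hBad
  have hS' : MeasurableSet {q : (ι → Ξ) × (ι → Ξ) | Bad (F q.1) q.2} :=
    ((hF.comp measurable_fst).prodMk measurable_snd) hBad
  -- Resampling `T` separates the parameter, which sees only the first copy, from the event, which
  -- sees only the second. Fubini then applies the bound at each fixed parameter.
  have hpre : splice T ⁻¹' {ω | Bad (F ω) ω} = {q : (ι → Ξ) × (ι → Ξ) | Bad (F q.1) q.2} := by
    ext q
    have h1 : F (splice T q) = F q.1 := hFT _ _ fun j hj => by simp [splice, hj]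
    simp only [mem_preimage, mem_ofPred_eq, h1]
    exact hBadT _ _ _ fun j hj => by simp [splice, hj]
  rw [← (measurePreserving_splice D T).measure_preimage hS.nullMeasurableSet, hpre,
    Measure.prod_apply hS']
  calc ∫⁻ ω, μ (Prod.mk ω ⁻¹' {q : (ι → Ξ) × (ι → Ξ) | Bad (F q.1) q.2}) ∂μ
      ≤ ∫⁻ _, δ ∂μ := lintegral_mono fun ω => hδ (F ω)
    _ = δ := by simp [μ]

lemma prod_le_of_forall_left {α β : Type*} [MeasurableSpace α] [MeasurableSpace β] {μ : Measure α}
    {ν : Measure β} [IsProbabilityMeasure μ] [IsProbabilityMeasure ν] {s : Set (α × β)}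
    (hs : MeasurableSet s) {δ : ℝ≥0∞} (h : ∀ y, μ {x | (x, y) ∈ s} ≤ δ) : μ.prod ν s ≤ δ := by
  rw [Measure.prod_apply_symm hs]
  exact (lintegral_mono fun y => h y).trans (by simp)

lemma prod_le_of_forall_right {α β : Type*} [MeasurableSpace α] [MeasurableSpace β] {μ : Measure α}
    {ν : Measure β} [IsProbabilityMeasure μ] [IsProbabilityMeasure ν] {s : Set (α × β)}
    (hs : MeasurableSet s) {δ : ℝ≥0∞} (h : ∀ x, ν {y | (x, y) ∈ s} ≤ δ) : μ.prod ν s ≤ δ := by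
  rw [Measure.prod_apply hs]
  exact (lintegral_mono fun x => h x).trans (by simp)

end Freeze

/-! ### Consequences of the standing assumptions -/

namespace Problem

variable {m n : ℕ} {Ξ : Type u} [MeasurableSpace Ξ] {p : Problem m n Ξ} {lf lg Lg lhat Lhat : ℝ≥0}

/-- Differentiation under the integral sign; the uniform Lipschitz constant dominates the difference
quotients. This makes the sampled Jacobians unbiased. -/
lemma Standing.integral_sampleJac (h : p.Standing lf lg Lg) (hu : p.UniformLipschitz lhat Lhat) (x : Vec n) :
    ∫ ξ, p.sampleJac ξ x ∂p.D = fderiv ℝ p.g x := by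
  have hJm : Measurable fun ξ => p.sampleJac ξ x :=
    h.measurable_sampleJac.comp (measurable_id.prodMk measurable_const)
  refine ((hasFDerivAt_integral_of_dominated_loc_of_lip (μ := p.D) (s := univ)
    (F := fun x ξ => p.sample ξ x) (F' := fun ξ => p.sampleJac ξ x) (bound := fun _ => (lhat : ℝ))
    Filter.univ_mem (Filter.Eventually.of_forall fun y => (h.integrable y).aestronglyMeasurable)
    (h.integrable x) hJm.aestronglyMeasurable ?_ (integrable_const _) ?_).2.fderiv).symm
  · filter_upwards [hu.value] with ξ hξ
    simpa using hξ
  · filter_upwards [h.hasFDerivAt] with ξ hξ using hξ x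

lemma Standing.measurable_g (h : p.Standing lf lg Lg) : Measurable p.g :=
  h.g_lipschitz.continuous.measurable

lemma Standing.measurable_fderiv_g (h : p.Standing lf lg Lg) : Measurable (fderiv ℝ p.g) :=
  h.jac_lipschitz.continuous.measurable

lemma Standing.measurable_model (h : p.Standing lf lg Lg) (M : ℝ) :
    Measurable fun q : (Vec m × Jac m n × Vec n) × Vec n =>
      p.model M q.1.1 q.1.2.1 q.1.2.2 q.2 := by
  have hf : Continuous p.f := h.f_lipschitz.continuous
  unfold model
  refine (Measurable.add ?_ (h.h_ccp.closed.measurable.comp measurable_snd)).add ?_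
  · exact (Continuous.measurable (by fun_prop)).coe_real_ereal
  · exact (Continuous.measurable (by fun_prop)).coe_real_ereal

/-- For fixed `y` the model is continuous in the data (constant where `h y` is infinite), so this
uncountable infimum is upper semicontinuous. It is needed to make the solver's failure an event. -/
lemma Standing.measurable_iInf_model (h : p.Standing lf lg Lg) (M : ℝ) :
    Measurable fun q : Vec m × Jac m n × Vec n => ⨅ y, p.model M q.1 q.2.1 q.2.2 y := by
  have hf : Continuous p.f := h.f_lipschitz.continuous
  refine (upperSemicontinuous_iInf fun y => Continuous.upperSemicontinuous ?_).measurable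
  unfold model
  generalize p.h y = r
  induction r with
  | bot => simpa using continuous_const
  | top =>
    have : ∀ a b : ℝ, (a : EReal) + ⊤ + (b : EReal) = ⊤ := fun a b => by simp
    simpa only [this] using continuous_const
  | coe r =>
    simp only [← EReal.coe_add]
    refine continuous_coe_real_ereal.comp ?_
    fun_prop

end Problem

/-! ### The iterates as functions of the draws -/

namespace Setup

variable {m n : ℕ} {Ξ : Type u} [MeasurableSpace Ξ] {S : Type v} [MeasurableSpace S]
  (a : Setup m n Ξ S)

/-- `ω` and `ω'` have the same draws at step `i` of epoch `k`. -/
def SameAt {Ξ : Type u} {S : Type v} (ω ω' : Draws Ξ S) (k i : ℕ) : Prop :=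
  (∀ r, ω.1 (k, i, r) = ω'.1 (k, i, r)) ∧ (∀ r, ω.2.1 (k, i, r) = ω'.2.1 (k, i, r)) ∧
    ω.2.2 (k, i) = ω'.2.2 (k, i)

lemma estimate_congr {ω ω' : Draws Ξ S} {k i : ℕ}
    (h0 : (∀ r, ω.1 (k, 0, r) = ω'.1 (k, 0, r)) ∧ ∀ r, ω.2.1 (k, 0, r) = ω'.2.1 (k, 0, r))
    (hi : (∀ r, ω.1 (k, i, r) = ω'.1 (k, i, r)) ∧ ∀ r, ω.2.1 (k, i, r) = ω'.2.1 (k, i, r))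
    (x₀ x : Vec n) : a.estimate ω k x₀ i x = a.estimate ω' k x₀ i x := by
  simp only [estimate, h0.1, h0.2, hi.1, hi.2]

lemma inner_congr {ω ω' : Draws Ξ S} {k : ℕ} (x₀ : Vec n) (i : ℕ)
    (h : ∀ j < i, SameAt ω ω' k j) : a.inner ω k x₀ i = a.inner ω' k x₀ i := by
  induction i with
  | zero => rfl
  | succ i ih =>
    have h0 := h 0 (by omega)
    have hi := h i (by omega)
    simp only [inner]
    rw [ih fun j hj => h j (by omega), estimate_congr a ⟨h0.1, h0.2.1⟩ ⟨hi.1, hi.2.1⟩, hi.2.2]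

lemma epochStart_congr {ω ω' : Draws Ξ S} (k : ℕ) (h : ∀ l < k, ∀ j, SameAt ω ω' l j) :
    a.epochStart ω k = a.epochStart ω' k := by
  induction k with
  | zero => rfl
  | succ k ih =>
    simp only [epochStart]
    rw [ih fun l hl => h l (by omega), a.inner_congr _ _ fun j _ => h k (by omega) j]

/-- The point `x_i^k` is computed from earlier draws only. Agreement off `(k, i)` is the form that
the freezing argument uses. -/
lemma iterate_congr {ω ω' : Draws Ξ S} (k i : ℕ)
    (h : ∀ l j, (l, j) ≠ (k, i) → SameAt ω ω' l j) :
    a.epochStart ω k = a.epochStart ω' k ∧ a.iterate ω k i = a.iterate ω' k i := by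
  have h1 : a.epochStart ω k = a.epochStart ω' k := a.epochStart_congr k fun l hl j =>
    h l j fun he => hl.ne (Prod.ext_iff.1 he).1
  refine ⟨h1, ?_⟩
  rw [iterate, iterate, h1]
  exact a.inner_congr _ _ fun j hj => h k j fun he => hj.ne (Prod.ext_iff.1 he).2

lemma iterate_zero (ω : Draws Ξ S) (k : ℕ) : a.iterate ω k 0 = a.epochStart ω k := rfl

lemma estimate_zero_val (ω : Draws Ξ S) (k : ℕ) (x₀ x : Vec n) :
    (a.estimate ω k x₀ 0 x).val =
      ((a.θ.A : ℝ)⁻¹ • ∑ r ∈ Finset.range a.θ.A, a.p.sample (ω.1 (k, 0, r)) x₀,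
        (a.θ.B : ℝ)⁻¹ • ∑ r ∈ Finset.range a.θ.B, a.p.sampleJac (ω.2.1 (k, 0, r)) x₀) := rfl

lemma estimate_val_of_ne_zero (ω : Draws Ξ S) (k : ℕ) (x₀ x : Vec n) {i : ℕ} (hi : i ≠ 0) :
    (a.estimate ω k x₀ i x).val =
      ((a.θ.a : ℝ)⁻¹ • ∑ r ∈ Finset.range a.θ.a,
          (a.p.sample (ω.1 (k, i, r)) x - a.p.sample (ω.1 (k, i, r)) x₀) +
          (a.estimate ω k x₀ 0 x₀).val.1,
        (a.θ.b : ℝ)⁻¹ • ∑ r ∈ Finset.range a.θ.b,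
          (a.p.sampleJac (ω.2.1 (k, i, r)) x - a.p.sampleJac (ω.2.1 (k, i, r)) x₀) +
          (a.estimate ω k x₀ 0 x₀).val.2) := by
  simp only [estimate, if_neg hi]
  rfl

variable {a} {lf lg Lg : ℝ≥0} {M : ℝ}

lemma measurable_estimate (h : a.p.Standing lf lg Lg) {x₀ x : Draws Ξ S → Vec n}
    (hx₀ : Measurable x₀) (hx : Measurable x) (k i : ℕ) :
    Measurable fun ω => (a.estimate ω k (x₀ ω) i (x ω)).val := by
  have hs : ∀ {y : Draws Ξ S → Vec n} (j : ℕ × ℕ × ℕ), Measurable y →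
      Measurable fun ω => a.p.sample (ω.1 j) (y ω) := fun j hy =>
    h.measurable_sample.comp (((measurable_pi_apply j).comp measurable_fst).prodMk hy)
  have hJ : ∀ {y : Draws Ξ S → Vec n} (j : ℕ × ℕ × ℕ), Measurable y →
      Measurable fun ω => a.p.sampleJac (ω.2.1 j) (y ω) := fun j hy =>
    h.measurable_sampleJac.comp (((measurable_pi_apply j).comp
      (measurable_fst.comp measurable_snd)).prodMk hy)
  -- No measurability of `y` is required: at step `0` only `x₀` is used.
  have h0 : ∀ y : Draws Ξ S → Vec n, Measurable fun ω => (a.estimate ω k (x₀ ω) 0 (y ω)).val :=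
    fun y => by
    simp only [estimate_zero_val]
    have e1 : Measurable fun ω : Draws Ξ S =>
        ∑ r ∈ Finset.range a.θ.A, a.p.sample (ω.1 (k, 0, r)) (x₀ ω) :=
      Finset.measurable_sum _ fun r _ => hs _ hx₀
    have e2 : Measurable fun ω : Draws Ξ S =>
        ∑ r ∈ Finset.range a.θ.B, a.p.sampleJac (ω.2.1 (k, 0, r)) (x₀ ω) :=
      Finset.measurable_sum _ fun r _ => hJ _ hx₀
    exact (e1.const_smul (a.θ.A : ℝ)⁻¹).prodMk (e2.const_smul (a.θ.B : ℝ)⁻¹)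
  by_cases hi : i = 0
  · subst hi; exact h0 x
  · simp only [estimate_val_of_ne_zero _ _ _ _ _ hi]
    have e1 : Measurable fun ω : Draws Ξ S => ∑ r ∈ Finset.range a.θ.a,
        (a.p.sample (ω.1 (k, i, r)) (x ω) - a.p.sample (ω.1 (k, i, r)) (x₀ ω)) :=
      Finset.measurable_sum _ fun r _ => (hs _ hx).sub (hs _ hx₀)
    have e2 : Measurable fun ω : Draws Ξ S => ∑ r ∈ Finset.range a.θ.b,
        (a.p.sampleJac (ω.2.1 (k, i, r)) (x ω) - a.p.sampleJac (ω.2.1 (k, i, r)) (x₀ ω)) :=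
      Finset.measurable_sum _ fun r _ => (hJ _ hx).sub (hJ _ hx₀)
    exact ((e1.const_smul (a.θ.a : ℝ)⁻¹).add (h0 x₀).fst).prodMk
      ((e2.const_smul (a.θ.b : ℝ)⁻¹).add (h0 x₀).snd)

lemma measurable_inner (h : a.p.Standing lf lg Lg) (hsol : a.sol.Valid a.p M) (hε : 0 < a.εbar)
    (hδ : 0 < a.δbar) {x₀ : Draws Ξ S → Vec n} (hx₀ : Measurable x₀) (k i : ℕ) :
    Measurable fun ω => a.inner ω k (x₀ ω) i := by
  induction i with
  | zero => exact hx₀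
  | succ i ih =>
    simp only [inner]
    have he := measurable_estimate h hx₀ ih k i
    exact (hsol.measurable _ _ hε hδ).comp ((he.fst.prodMk (he.snd.prodMk ih)).prodMk
      ((measurable_pi_apply (k, i)).comp (measurable_snd.comp measurable_snd)))

lemma measurable_epochStart (h : a.p.Standing lf lg Lg) (hsol : a.sol.Valid a.p M)
    (hε : 0 < a.εbar) (hδ : 0 < a.δbar) (k : ℕ) : Measurable fun ω => a.epochStart ω k := by
  induction k with
  | zero => exact measurable_const
  | succ k ih => exact measurable_inner h hsol hε hδ ih k a.τ

lemma measurable_iterate (h : a.p.Standing lf lg Lg) (hsol : a.sol.Valid a.p M)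
    (hε : 0 < a.εbar) (hδ : 0 < a.δbar) (k i : ℕ) : Measurable fun ω => a.iterate ω k i :=
  measurable_inner h hsol hε hδ (measurable_epochStart h hsol hε hδ k) k i

end Setup

/-! ### Probability of failure of a single step -/

section Fresh

variable {Ξ : Type u} [MeasurableSpace Ξ] {S : Type v} [MeasurableSpace S]
  {D : Measure Ξ} [IsProbabilityMeasure D] {ν : Measure S} [IsProbabilityMeasure ν]
  {Z : Type*} [MeasurableSpace Z]

instance : IsProbabilityMeasure (drawLaw D ν) := by unfold drawLaw; infer_instance

variable {V : Type*} [NormedAddCommGroup V] [NormedSpace ℝ V] [FiniteDimensional ℝ V]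
  [MeasurableSpace V] [BorelSpace V]

lemma measurableSet_batch_bad {ι : Type*} {H : Ξ → Z → V}
    (hH : Measurable fun q : Ξ × Z => H q.1 q.2) {w : Z → V} (hw : Measurable w) {t : Z → ℝ}
    (ht : Measurable t) (N : ℕ) (e : ℕ → ι) :
    MeasurableSet {q : Z × (ι → Ξ) |
      t q.1 < ‖(N : ℝ)⁻¹ • ∑ r ∈ Finset.range N, H (q.2 (e r)) q.1 - w q.1‖} := by
  have : ProperSpace V := FiniteDimensional.proper_real V
  have hsum : Measurable fun q : Z × (ι → Ξ) => ∑ r ∈ Finset.range N, H (q.2 (e r)) q.1 :=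
    Finset.measurable_sum _ fun r _ => by
      have h : Measurable fun q : Z × (ι → Ξ) => (q.2 (e r), q.1) :=
        ((measurable_pi_apply (e r)).comp measurable_snd).prodMk measurable_fst
      exact hH.comp h
  exact measurableSet_lt (ht.comp measurable_fst)
    ((hsum.const_smul (N : ℝ)⁻¹).sub (hw.comp measurable_fst)).norm

/-- Transfers a tail bound at a deterministic point `z` to the random point `F ω`: the other draws
are fixed by Fubini, and the batch `(k, i)` is fresh for `F`. -/
lemma drawLaw_fresh_fst_le {F : Draws Ξ S → Z} (hF : Measurable F) {k i : ℕ}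
    (hFT : ∀ ω ω', (∀ l j, (l, j) ≠ (k, i) → Setup.SameAt ω ω' l j) → F ω = F ω')
    {H : Ξ → Z → V} (hH : Measurable fun q : Ξ × Z => H q.1 q.2) {w : Z → V} (hw : Measurable w)
    {t : Z → ℝ} (ht : Measurable t) {N : ℕ} {δ : ℝ≥0∞}
    (hδ : ∀ z, Measure.infinitePi (fun _ : ℕ × ℕ × ℕ => D)
      {ω | t z < ‖(N : ℝ)⁻¹ • ∑ r ∈ Finset.range N, H (ω (k, i, r)) z - w z‖} ≤ δ) :
    MeasurableSet {ω : Draws Ξ S |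
      t (F ω) < ‖(N : ℝ)⁻¹ • ∑ r ∈ Finset.range N, H (ω.1 (k, i, r)) (F ω) - w (F ω)‖} ∧
    drawLaw D ν {ω | t (F ω) <
      ‖(N : ℝ)⁻¹ • ∑ r ∈ Finset.range N, H (ω.1 (k, i, r)) (F ω) - w (F ω)‖} ≤ δ := by
  have hB := measurableSet_batch_bad hH hw ht N fun r => (k, i, r)
  have hS : MeasurableSet {ω : Draws Ξ S | t (F ω) <
      ‖(N : ℝ)⁻¹ • ∑ r ∈ Finset.range N, H (ω.1 (k, i, r)) (F ω) - w (F ω)‖} :=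
    (hF.prodMk measurable_fst) hB
  refine ⟨hS, prod_le_of_forall_left hS fun y => ?_⟩
  refine infinitePi_freeze_le {j : ℕ × ℕ × ℕ | (j.1, j.2.1) = (k, i)}
    (F := fun α => F (α, y)) (hF.comp measurable_prodMk_right) (fun α α' h => hFT _ _ ?_)
    (Bad := fun z α => t z < ‖(N : ℝ)⁻¹ • ∑ r ∈ Finset.range N, H (α (k, i, r)) z - w z‖) hB ?_ hδ
  · exact fun l j hlj => ⟨fun r => h _ hlj, fun r => rfl, rfl⟩
  · intro z α α' h
    have : ∀ r, α (k, i, r) = α' (k, i, r) := fun r => h _ rfl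
    simp only [this]

lemma drawLaw_fresh_snd_le {F : Draws Ξ S → Z} (hF : Measurable F) {k i : ℕ}
    (hFT : ∀ ω ω', (∀ l j, (l, j) ≠ (k, i) → Setup.SameAt ω ω' l j) → F ω = F ω')
    {H : Ξ → Z → V} (hH : Measurable fun q : Ξ × Z => H q.1 q.2) {w : Z → V} (hw : Measurable w)
    {t : Z → ℝ} (ht : Measurable t) {N : ℕ} {δ : ℝ≥0∞}
    (hδ : ∀ z, Measure.infinitePi (fun _ : ℕ × ℕ × ℕ => D)
      {ω | t z < ‖(N : ℝ)⁻¹ • ∑ r ∈ Finset.range N, H (ω (k, i, r)) z - w z‖} ≤ δ) :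
    MeasurableSet {ω : Draws Ξ S |
      t (F ω) < ‖(N : ℝ)⁻¹ • ∑ r ∈ Finset.range N, H (ω.2.1 (k, i, r)) (F ω) - w (F ω)‖} ∧
    drawLaw D ν {ω | t (F ω) <
      ‖(N : ℝ)⁻¹ • ∑ r ∈ Finset.range N, H (ω.2.1 (k, i, r)) (F ω) - w (F ω)‖} ≤ δ := by
  have hB := measurableSet_batch_bad hH hw ht N fun r => (k, i, r)
  have hS : MeasurableSet {ω : Draws Ξ S | t (F ω) <
      ‖(N : ℝ)⁻¹ • ∑ r ∈ Finset.range N, H (ω.2.1 (k, i, r)) (F ω) - w (F ω)‖} :=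
    (hF.prodMk (measurable_fst.comp measurable_snd)) hB
  refine ⟨hS, prod_le_of_forall_right hS fun α => ?_⟩
  refine prod_le_of_forall_left (measurable_prodMk_left hS) fun s => ?_
  refine infinitePi_freeze_le {j : ℕ × ℕ × ℕ | (j.1, j.2.1) = (k, i)}
    (F := fun β => F (α, β, s)) (hF.comp (measurable_prodMk_left.comp measurable_prodMk_right))
    (fun β β' h => hFT _ _ ?_)
    (Bad := fun z β => t z < ‖(N : ℝ)⁻¹ • ∑ r ∈ Finset.range N, H (β (k, i, r)) z - w z‖) hB ?_ hδ
  · exact fun l j hlj => ⟨fun r => rfl, fun r => h _ hlj, rfl⟩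
  · intro z β β' h
    have : ∀ r, β (k, i, r) = β' (k, i, r) := fun r => h _ rfl
    simp only [this]

/-- Here `F` may depend on the samples of step `(k, i)`, since the subproblem is built from them;
only the seed of that step has to be fresh. -/
lemma drawLaw_fresh_seed_le {F : Draws Ξ S → Z} (hF : Measurable F) {k i : ℕ}
    (hFT : ∀ α β s s', (∀ j, j ≠ (k, i) → s j = s' j) → F (α, β, s) = F (α, β, s'))
    {Bad : Z → S → Prop} (hBad : MeasurableSet {q : Z × S | Bad q.1 q.2}) {δ : ℝ≥0∞}
    (hδ : ∀ z, ν {s | Bad z s} ≤ δ) :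
    MeasurableSet {ω : Draws Ξ S | Bad (F ω) (ω.2.2 (k, i))} ∧
    drawLaw D ν {ω | Bad (F ω) (ω.2.2 (k, i))} ≤ δ := by
  have hS : MeasurableSet {ω : Draws Ξ S | Bad (F ω) (ω.2.2 (k, i))} :=
    (hF.prodMk ((measurable_pi_apply (k, i)).comp (measurable_snd.comp measurable_snd))) hBad
  refine ⟨hS, prod_le_of_forall_right hS fun α => ?_⟩
  refine prod_le_of_forall_right (measurable_prodMk_left hS) fun β => ?_
  refine infinitePi_freeze_le {(k, i)} (F := fun s => F (α, β, s))
    (hF.comp (measurable_prodMk_left.comp measurable_prodMk_left)) (fun s s' h => hFT _ _ _ _ h)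
    (Bad := fun z s => Bad z (s (k, i))) ?_ ?_ fun z => ?_
  · have : Measurable fun q : Z × (ℕ × ℕ → S) => (q.1, q.2 (k, i)) :=
      measurable_fst.prodMk ((measurable_pi_apply (k, i)).comp measurable_snd)
    exact this hBad
  · intro z s s' h
    simp only [h (k, i) rfl]
  · have hm : MeasurableSet {s | Bad z s} := measurable_prodMk_left hBad
    calc _ = ν {s | Bad z s} := by
          conv_rhs => rw [← Measure.infinitePi_map_eval (fun _ : ℕ × ℕ => ν) (k, i)]
          rw [Measure.map_apply (measurable_pi_apply _) hm]
          rfl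
      _ ≤ δ := hδ z

end Fresh

/-! ### The good event -/

namespace Setup

variable {m n : ℕ} {Ξ : Type u} [MeasurableSpace Ξ] {S : Type v} [MeasurableSpace S]

/-- The estimates `(g̃, J̃)` at the `i`-th point of epoch `k`. -/
def est (a : Setup m n Ξ S) (ω : Draws Ξ S) (k i : ℕ) : Vec m × Jac m n :=
  (a.estimate ω k (a.epochStart ω k) i (a.iterate ω k i)).val

/-- The estimates made at step `i` of epoch `k` are accurate, and the solver succeeds. -/
structure GoodStep (a : Setup m n Ξ S) (M rA rB ra rb : ℝ) (ω : Draws Ξ S) (k i : ℕ) : Prop where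
  value_start : i = 0 → ‖(a.est ω k i).1 - a.p.g (a.epochStart ω k)‖ ≤ rA
  jac_start : i = 0 → ‖(a.est ω k i).2 - fderiv ℝ a.p.g (a.epochStart ω k)‖ ≤ rB
  value_inner : i ≠ 0 → ‖(a.est ω k i).1 - (a.est ω k 0).1 -
    (a.p.g (a.iterate ω k i) - a.p.g (a.epochStart ω k))‖ ≤
      ra * ‖a.iterate ω k i - a.epochStart ω k‖
  jac_inner : i ≠ 0 → ‖(a.est ω k i).2 - (a.est ω k 0).2 -
    (fderiv ℝ a.p.g (a.iterate ω k i) - fderiv ℝ a.p.g (a.epochStart ω k))‖ ≤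
      rb * ‖a.iterate ω k i - a.epochStart ω k‖
  solved : a.p.model M (a.est ω k i).1 (a.est ω k i).2 (a.iterate ω k i) (a.iterate ω k (i + 1)) ≤
    (⨅ y, a.p.model M (a.est ω k i).1 (a.est ω k i).2 (a.iterate ω k i) y) + (a.εbar : EReal)

lemma est_of_ne_zero (a : Setup m n Ξ S) (ω : Draws Ξ S) (k : ℕ) {i : ℕ} (hi : i ≠ 0) :
    a.est ω k i = ((a.θ.a : ℝ)⁻¹ • ∑ r ∈ Finset.range a.θ.a, (a.p.sample (ω.1 (k, i, r))
          (a.iterate ω k i) - a.p.sample (ω.1 (k, i, r)) (a.epochStart ω k)) + (a.est ω k 0).1,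
      (a.θ.b : ℝ)⁻¹ • ∑ r ∈ Finset.range a.θ.b, (a.p.sampleJac (ω.2.1 (k, i, r))
          (a.iterate ω k i) - a.p.sampleJac (ω.2.1 (k, i, r)) (a.epochStart ω k)) +
        (a.est ω k 0).2) :=
  a.estimate_val_of_ne_zero ω k _ _ hi

variable {a : Setup m n Ξ S} {lf lg Lg lhat Lhat : ℝ≥0} {σg σJ M : ℝ}

/-- For `i ≠ 0` the remembered start estimate cancels, leaving a batch mean of increments. Its
threshold is proportional to the distance moved, so it is itself a random quantity carried by the
frozen parameter. -/
lemma exists_value_failure (h : a.p.Standing lf lg Lg) (hd : a.p.BoundedDeviation σg σJ)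
    (hu : a.p.UniformLipschitz lhat Lhat) (hsol : a.sol.Valid a.p M) (hε : 0 < a.εbar)
    (hδ' : 0 < a.δbar) {δ cA ca : ℝ} (hδ : 0 < δ) (hcA : 0 < cA) (hca : 0 < ca)
    (hlog : 1 ≤ Real.log ((m + 1) / δ)) (hA : 24 * Real.log ((m + 1) / δ) ≤ a.θ.A * cA ^ 2)
    (ha : 24 * Real.log ((m + 1) / δ) ≤ a.θ.a * ca ^ 2) (k i : ℕ) :
    ∃ B : Set (Draws Ξ S), MeasurableSet B ∧ drawLaw a.p.D a.sol.law B ≤ ENNReal.ofReal δ ∧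
      ∀ ω ∉ B, (i = 0 → ‖(a.est ω k i).1 - a.p.g (a.epochStart ω k)‖ ≤ cA * σg) ∧
        (i ≠ 0 → ‖(a.est ω k i).1 - (a.est ω k 0).1 -
          (a.p.g (a.iterate ω k i) - a.p.g (a.epochStart ω k))‖ ≤
          ca * (lhat + lg) * ‖a.iterate ω k i - a.epochStart ω k‖) := by
  have hpos : ∀ {N : ℕ} {c : ℝ}, 24 * Real.log ((m + 1) / δ) ≤ N * c ^ 2 → 0 < N := by
    intro N c hN
    rcases Nat.eq_zero_or_pos N with rfl | h0
    · rw [Nat.cast_zero, zero_mul] at hN; linarith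
    · exact h0
  have hinj : Function.Injective fun r : ℕ => (k, i, r) := fun r s hrs => by simpa using hrs
  have hfr : Module.finrank ℝ (Vec m) = m := finrank_euclideanSpace_fin
  have hmem := measurable_epochStart h hsol hε hδ' k
  have hmit := measurable_iterate h hsol hε hδ' k i
  by_cases hi : i = 0
  · obtain ⟨h1, h2⟩ := drawLaw_fresh_fst_le (D := a.p.D) (ν := a.sol.law) (k := k) (i := i)
      (F := fun ω => a.epochStart ω k) hmem (fun ω ω' hω => (a.iterate_congr k i hω).1)
      (H := fun ξ x => a.p.sample ξ x) h.measurable_sample (w := a.p.g) h.measurable_g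
      (t := fun _ => cA * σg) measurable_const (N := a.θ.A) (δ := ENNReal.ofReal δ)
      fun x => infinitePi_batch_vector_gt_le
        (h.measurable_sample.comp (measurable_id.prodMk measurable_const))
        (hd.value.mono fun ξ hξ => hξ x) rfl hinj (hpos hA) hcA hδ (by rwa [hfr]) (by rwa [hfr])
    refine ⟨_, h1, h2, fun ω hω => ⟨fun _ => ?_, fun hne => absurd hi hne⟩⟩
    subst hi
    exact not_lt.1 hω
  · obtain ⟨h1, h2⟩ := drawLaw_fresh_fst_le (D := a.p.D) (ν := a.sol.law) (k := k) (i := i)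
      (F := fun ω => (a.epochStart ω k, a.iterate ω k i)) (hmem.prodMk hmit)
      (fun ω ω' hω => Prod.ext (a.iterate_congr k i hω).1 (a.iterate_congr k i hω).2)
      (H := fun ξ z => a.p.sample ξ z.2 - a.p.sample ξ z.1)
      ((h.measurable_sample.comp (measurable_fst.prodMk measurable_snd.snd)).sub
        (h.measurable_sample.comp (measurable_fst.prodMk measurable_snd.fst)))
      (w := fun z => a.p.g z.2 - a.p.g z.1)
      ((h.measurable_g.comp measurable_snd).sub (h.measurable_g.comp measurable_fst))
      (t := fun z => ca * ((lhat + lg) * ‖z.2 - z.1‖)) (by fun_prop) (N := a.θ.a)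
      (δ := ENNReal.ofReal δ) fun z => infinitePi_batch_vector_gt_le
        (F := fun ξ => a.p.sample ξ z.2 - a.p.sample ξ z.1)
        ((h.measurable_sample.comp (measurable_id.prodMk measurable_const)).sub
          (h.measurable_sample.comp (measurable_id.prodMk measurable_const)))
        -- A sampled increment deviates from its mean by at most `(lhat + lg)` times the distance of
        -- the two points.
        (hu.value.mono fun ξ hξ => (norm_sub_le _ _).trans (by
          rw [add_mul]
          exact add_le_add (hξ.norm_sub_le _ _) (h.g_lipschitz.norm_sub_le _ _)))
        (integral_sub (h.integrable _) (h.integrable _)) hinj (hpos ha) hca hδ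
        (by rwa [hfr]) (by rwa [hfr])
    refine ⟨_, h1, h2, fun ω hω => ⟨fun he => absurd he hi, fun _ => ?_⟩⟩
    rw [est_of_ne_zero _ _ _ hi, mul_assoc]
    simp only [add_sub_cancel_right]
    exact not_lt.1 hω

lemma exists_jac_failure (h : a.p.Standing lf lg Lg) (hd : a.p.BoundedDeviation σg σJ)
    (hu : a.p.UniformLipschitz lhat Lhat) (hsol : a.sol.Valid a.p M) (hε : 0 < a.εbar)
    (hδ' : 0 < a.δbar) {δ cB cb : ℝ} (hδ : 0 < δ) (hcB : 0 < cB) (hcb : 0 < cb)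
    (hlog : 1 ≤ Real.log ((m + n) / δ)) (hB : 24 * Real.log ((m + n) / δ) ≤ a.θ.B * cB ^ 2)
    (hb : 24 * Real.log ((m + n) / δ) ≤ a.θ.b * cb ^ 2) (k i : ℕ) :
    ∃ B : Set (Draws Ξ S), MeasurableSet B ∧ drawLaw a.p.D a.sol.law B ≤ ENNReal.ofReal δ ∧
      ∀ ω ∉ B, (i = 0 → ‖(a.est ω k i).2 - fderiv ℝ a.p.g (a.epochStart ω k)‖ ≤ cB * σJ) ∧
        (i ≠ 0 → ‖(a.est ω k i).2 - (a.est ω k 0).2 -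
          (fderiv ℝ a.p.g (a.iterate ω k i) - fderiv ℝ a.p.g (a.epochStart ω k))‖ ≤
          cb * (Lhat + Lg) * ‖a.iterate ω k i - a.epochStart ω k‖) := by
  have hpos : ∀ {N : ℕ} {c : ℝ}, 24 * Real.log ((m + n) / δ) ≤ N * c ^ 2 → 0 < N := by
    intro N c hN
    rcases Nat.eq_zero_or_pos N with rfl | h0
    · rw [Nat.cast_zero, zero_mul] at hN; linarith
    · exact h0
  have hinj : Function.Injective fun r : ℕ => (k, i, r) := fun r s hrs => by simpa using hrs
  have hfr : ((Module.finrank ℝ (Vec n) : ℝ) + Module.finrank ℝ (Vec m)) = m + n := by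
    rw [finrank_euclideanSpace_fin, finrank_euclideanSpace_fin, add_comm]
  have hmem := measurable_epochStart h hsol hε hδ' k
  have hmit := measurable_iterate h hsol hε hδ' k i
  have hJm : ∀ x, Measurable fun ξ => a.p.sampleJac ξ x := fun x =>
    h.measurable_sampleJac.comp (measurable_id.prodMk measurable_const)
  -- Integrability of the Jacobians is not a standing assumption; it follows from their bounded
  -- deviation.
  have hJi : ∀ x, Integrable (fun ξ => a.p.sampleJac ξ x) a.p.D := fun x =>
    integrable_of_ae_norm_sub_le (hJm x).aestronglyMeasurable (hd.jac.mono fun ξ hξ => hξ x)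
  by_cases hi : i = 0
  · obtain ⟨h1, h2⟩ := drawLaw_fresh_snd_le (D := a.p.D) (ν := a.sol.law) (k := k) (i := i)
      (F := fun ω => a.epochStart ω k) hmem (fun ω ω' hω => (a.iterate_congr k i hω).1)
      (H := fun ξ x => a.p.sampleJac ξ x) h.measurable_sampleJac (w := fderiv ℝ a.p.g)
      h.measurable_fderiv_g
      (t := fun _ => cB * σJ) measurable_const (N := a.θ.B) (δ := ENNReal.ofReal δ)
      fun x => infinitePi_batch_operator_gt_le (hJm x) (hd.jac.mono fun ξ hξ => hξ x)
        (h.integral_sampleJac hu x) hinj (hpos hB) hcB hδ (by rwa [hfr]) (by rwa [hfr])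
    refine ⟨_, h1, h2, fun ω hω => ⟨fun _ => ?_, fun hne => absurd hi hne⟩⟩
    subst hi
    exact not_lt.1 hω
  · obtain ⟨h1, h2⟩ := drawLaw_fresh_snd_le (D := a.p.D) (ν := a.sol.law) (k := k) (i := i)
      (F := fun ω => (a.epochStart ω k, a.iterate ω k i)) (hmem.prodMk hmit)
      (fun ω ω' hω => Prod.ext (a.iterate_congr k i hω).1 (a.iterate_congr k i hω).2)
      (H := fun ξ z => a.p.sampleJac ξ z.2 - a.p.sampleJac ξ z.1)
      ((h.measurable_sampleJac.comp (measurable_fst.prodMk measurable_snd.snd)).sub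
        (h.measurable_sampleJac.comp (measurable_fst.prodMk measurable_snd.fst)))
      (w := fun z => fderiv ℝ a.p.g z.2 - fderiv ℝ a.p.g z.1)
      ((h.measurable_fderiv_g.comp measurable_snd).sub (h.measurable_fderiv_g.comp measurable_fst))
      (t := fun z => cb * ((Lhat + Lg) * ‖z.2 - z.1‖)) (by fun_prop) (N := a.θ.b)
      (δ := ENNReal.ofReal δ) fun z => infinitePi_batch_operator_gt_le
        (F := fun ξ => a.p.sampleJac ξ z.2 - a.p.sampleJac ξ z.1) ((hJm _).sub (hJm _))
        (hu.jac.mono fun ξ hξ => (norm_sub_le _ _).trans (by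
          rw [add_mul]
          exact add_le_add (hξ.norm_sub_le _ _) (h.jac_lipschitz.norm_sub_le _ _)))
        (by rw [integral_sub (hJi _) (hJi _), h.integral_sampleJac hu, h.integral_sampleJac hu])
        hinj (hpos hb) hcb hδ (by rwa [hfr]) (by rwa [hfr])
    refine ⟨_, h1, h2, fun ω hω => ⟨fun he => absurd he hi, fun _ => ?_⟩⟩
    rw [est_of_ne_zero _ _ _ hi, mul_assoc]
    simp only [add_sub_cancel_right]
    exact not_lt.1 hω

lemma exists_solver_failure (h : a.p.Standing lf lg Lg) (hsol : a.sol.Valid a.p M)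
    (hε : 0 < a.εbar) (hδ : 0 < a.δbar) (k i : ℕ) :
    ∃ B : Set (Draws Ξ S), MeasurableSet B ∧ drawLaw a.p.D a.sol.law B ≤ ENNReal.ofReal a.δbar ∧
      ∀ ω ∉ B, a.p.model M (a.est ω k i).1 (a.est ω k i).2 (a.iterate ω k i)
        (a.iterate ω k (i + 1)) ≤
      (⨅ y, a.p.model M (a.est ω k i).1 (a.est ω k i).2 (a.iterate ω k i) y) +
        (a.εbar : EReal) := by
  have hmem := measurable_epochStart h hsol hε hδ k
  have hmit := measurable_iterate h hsol hε hδ k i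
  have hest : Measurable fun ω => a.est ω k i := measurable_estimate h hmem hmit k i
  obtain ⟨h1, h2⟩ := drawLaw_fresh_seed_le (D := a.p.D) (ν := a.sol.law) (k := k) (i := i)
    (F := fun ω => ((a.est ω k i).1, (a.est ω k i).2, a.iterate ω k i))
    (hest.fst.prodMk (hest.snd.prodMk hmit))
    (fun α β s s' hs => by
      obtain ⟨e1, e2⟩ := a.iterate_congr (ω := (α, β, s)) (ω' := (α, β, s')) k i
        fun l j hlj => ⟨fun _ => rfl, fun _ => rfl, hs _ hlj⟩
      simp only [est, e1, e2]
      rw [a.estimate_congr (ω := (α, β, s)) (ω' := (α, β, s')) ⟨fun _ => rfl, fun _ => rfl⟩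
        ⟨fun _ => rfl, fun _ => rfl⟩])
    (Bad := fun z s => ¬ (a.p.model M z.1 z.2.1 z.2.2 (a.sol.solve a.εbar a.δbar z s) ≤
      (⨅ y, a.p.model M z.1 z.2.1 z.2.2 y) + (a.εbar : EReal)))
    (by
      have e1 := (h.measurable_model M).comp
        (measurable_fst.prodMk (hsol.measurable _ _ hε hδ))
      have e2 : Measurable fun q : (Vec m × Jac m n × Vec n) × S =>
          (⨅ y, a.p.model M q.1.1 q.1.2.1 q.1.2.2 y) + (a.εbar : EReal) :=
        ((h.measurable_iInf_model M).comp measurable_fst).add measurable_const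
      exact (measurableSet_le e1 e2).compl)
    (δ := ENNReal.ofReal a.δbar) (fun z => by
      obtain ⟨E, hE, hPE, hgood⟩ := hsol.accurate _ _ hε hδ z.1 z.2.1 z.2.2
      refine (measure_mono (t := Eᶜ) ?_).trans ?_
      · exact fun s (hs : ¬ _) hsE => hs (hgood s hsE)
      rw [prob_compl_eq_one_sub hE, tsub_le_iff_right]
      calc (1 : ℝ≥0∞) = ENNReal.ofReal (a.δbar + (1 - a.δbar)) := by simp
        _ ≤ ENNReal.ofReal a.δbar + ENNReal.ofReal (1 - a.δbar) := ENNReal.ofReal_add_le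
        _ ≤ _ := by gcongr)
  exact ⟨_, h1, h2, fun ω hω => not_not.1 hω⟩

/-- Union bound: each of the `Kτ` steps can fail in the estimate of `g`, in that of `g'` (`δ` each),
or in the solver (`δbar`). -/
lemma holdsWithProb_goodStep (h : a.p.Standing lf lg Lg) (hd : a.p.BoundedDeviation σg σJ)
    (hu : a.p.UniformLipschitz lhat Lhat) (hsol : a.sol.Valid a.p M) (hε : 0 < a.εbar)
    (hδ' : 0 < a.δbar) {δ cA ca cB cb : ℝ} (hδ : 0 < δ) (hcA : 0 < cA) (hca : 0 < ca)
    (hcB : 0 < cB) (hcb : 0 < cb)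
    (hlog : 1 ≤ Real.log ((m + 1) / δ)) (hA : 24 * Real.log ((m + 1) / δ) ≤ a.θ.A * cA ^ 2)
    (ha : 24 * Real.log ((m + 1) / δ) ≤ a.θ.a * ca ^ 2)
    (hlog' : 1 ≤ Real.log ((m + n) / δ)) (hB : 24 * Real.log ((m + n) / δ) ≤ a.θ.B * cB ^ 2)
    (hb : 24 * Real.log ((m + n) / δ) ≤ a.θ.b * cb ^ 2) (K : ℕ) :
    HoldsWithProb (drawLaw a.p.D a.sol.law) (1 - K * a.τ * (2 * δ + a.δbar)) fun ω =>
      ∀ k < K, ∀ i < a.τ,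
        a.GoodStep M (cA * σg) (cB * σJ) (ca * (lhat + lg)) (cb * (Lhat + Lg)) ω k i := by
  have hstep : ∀ q : ℕ × ℕ, ∃ B : Set (Draws Ξ S), MeasurableSet B ∧
      drawLaw a.p.D a.sol.law B ≤ ENNReal.ofReal (2 * δ + a.δbar) ∧ ∀ ω ∉ B,
        a.GoodStep M (cA * σg) (cB * σJ) (ca * (lhat + lg)) (cb * (Lhat + Lg)) ω q.1 q.2 := by
    rintro ⟨k, i⟩
    obtain ⟨B₁, m₁, p₁, g₁⟩ := exists_value_failure h hd hu hsol hε hδ' hδ hcA hca hlog hA ha k i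
    obtain ⟨B₂, m₂, p₂, g₂⟩ := exists_jac_failure h hd hu hsol hε hδ' hδ hcB hcb hlog' hB hb k i
    obtain ⟨B₃, m₃, p₃, g₃⟩ := exists_solver_failure h hsol hε hδ' k i
    refine ⟨B₁ ∪ B₂ ∪ B₃, (m₁.union m₂).union m₃, ?_, fun ω hω => ?_⟩
    · rw [two_mul, ENNReal.ofReal_add (by positivity) hδ'.le, ENNReal.ofReal_add hδ.le hδ.le]
      refine (measure_union_le _ _).trans (add_le_add ((measure_union_le _ _).trans ?_) p₃)
      exact add_le_add p₁ p₂
    · have w₁ := g₁ ω fun hc => hω (Or.inl (Or.inl hc))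
      have w₂ := g₂ ω fun hc => hω (Or.inl (Or.inr hc))
      exact ⟨w₁.1, w₂.1, w₁.2, w₂.2, g₃ ω fun hc => hω (Or.inr hc)⟩
  choose B hBm hBp hBg using hstep
  set s := Finset.range K ×ˢ Finset.range a.τ
  have hU : MeasurableSet (⋃ q ∈ s, B q) := Finset.measurableSet_biUnion s fun q _ => hBm q
  refine ⟨(⋃ q ∈ s, B q)ᶜ, hU.compl, ?_, fun ω hω k hk i hi => hBg (k, i) ω fun hc => hω ?_⟩
  · rw [prob_compl_eq_one_sub hU]
    have hsum : drawLaw a.p.D a.sol.law (⋃ q ∈ s, B q) ≤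
        ENNReal.ofReal (K * a.τ * (2 * δ + a.δbar)) := by
      refine (measure_biUnion_finset_le s B).trans ?_
      refine (Finset.sum_le_sum fun q _ => hBp q).trans (le_of_eq ?_)
      rw [Finset.sum_const, nsmul_eq_mul, Finset.card_product, Finset.card_range,
        Finset.card_range, ENNReal.ofReal_mul (by positivity), ← Nat.cast_mul,
        ENNReal.ofReal_natCast]
    refine le_trans ?_ (tsub_le_tsub_left hsum 1)
    rw [← ENNReal.ofReal_one, ← ENNReal.ofReal_sub _ (by positivity)]
  · simp only [mem_iUnion]
    exact ⟨(k, i), by simp [s, hk, hi], hc⟩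

end Setup

/-! ### The prox-linear step and descent -/

namespace Problem

variable {m n : ℕ} {Ξ : Type u} [MeasurableSpace Ξ] {p : Problem m n Ξ} {lf lg Lg : ℝ≥0} {M : ℝ}

/-- The values of `h` as real numbers (meaningful where `h` is finite). -/
def hReal (p : Problem m n Ξ) (x : Vec n) : ℝ := (p.h x).toReal

/-- The objective as a real number (meaningful where `h` is finite). -/
def objReal (p : Problem m n Ξ) (x : Vec n) : ℝ := p.f (p.g x) + p.hReal x

/-- The prox-linear model as a real number (meaningful where `h` is finite). -/
def modelReal (p : Problem m n Ξ) (M : ℝ) (w : Vec m) (J : Jac m n) (x y : Vec n) : ℝ :=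
  p.f (w + J (y - x)) + p.hReal y + M / 2 * ‖y - x‖ ^ 2

lemma Standing.coe_hReal (h : p.Standing lf lg Lg) {x : Vec n} (hx : p.h x ≠ ⊤) :
    (p.hReal x : EReal) = p.h x := EReal.coe_toReal hx (h.h_ccp.ne_bot x)

lemma Standing.objective_eq (h : p.Standing lf lg Lg) {x : Vec n} (hx : p.h x ≠ ⊤) :
    p.objective x = (p.objReal x : EReal) := by
  rw [objective, ← h.coe_hReal hx, objReal, EReal.coe_add]

lemma Standing.model_eq (h : p.Standing lf lg Lg) (w : Vec m) (J : Jac m n) (x : Vec n)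
    {y : Vec n} (hy : p.h y ≠ ⊤) : p.model M w J x y = (p.modelReal M w J x y : EReal) := by
  rw [model, ← h.coe_hReal hy, modelReal, EReal.coe_add, EReal.coe_add]

lemma h_ne_top_of_objective_lt {x : Vec n} (hx : p.objective x < ⊤) : p.h x ≠ ⊤ := by
  rintro h
  rw [objective, h, EReal.coe_add_top] at hx
  exact lt_irrefl _ hx

lemma h_ne_top_of_model_lt {w : Vec m} {J : Jac m n} {x y : Vec n} (hy : p.model M w J x y < ⊤) :
    p.h y ≠ ⊤ := by
  rintro h
  rw [model, h, EReal.coe_add_top, EReal.top_add_coe] at hy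
  exact lt_irrefl _ hy

lemma Standing.hReal_segment (h : p.Standing lf lg Lg) {x y : Vec n} (hx : p.h x ≠ ⊤)
    (hy : p.h y ≠ ⊤) {s t : ℝ} (hs : 0 ≤ s) (ht : 0 ≤ t) (hst : s + t = 1) :
    p.h (s • x + t • y) ≠ ⊤ ∧ p.hReal (s • x + t • y) ≤ s * p.hReal x + t * p.hReal y := by
  have h1 : p.h (s • x + t • y) ≤ ((s * p.hReal x + t * p.hReal y : ℝ) : EReal) :=
    h.h_ccp.convex (x := (x, p.hReal x)) (y := (y, p.hReal y)) (h.coe_hReal hx).ge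
      (h.coe_hReal hy).ge hs ht hst
  have h2 : p.h (s • x + t • y) ≠ ⊤ := ne_top_of_le_ne_top (EReal.coe_ne_top _) h1
  refine ⟨h2, ?_⟩
  rw [← h.coe_hReal h2] at h1
  exact_mod_cast h1

lemma norm_sq_convex_combination {E : Type*} [NormedAddCommGroup E] [InnerProductSpace ℝ E]
    (x y : E) {s t : ℝ} (hst : s + t = 1) :
    ‖s • x + t • y‖ ^ 2 = s * ‖x‖ ^ 2 + t * ‖y‖ ^ 2 - s * t * ‖y - x‖ ^ 2 := by
  rw [norm_add_sq_real, norm_sub_sq_real, norm_smul, norm_smul, inner_smul_left, inner_smul_right,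
    mul_pow, mul_pow, Real.norm_eq_abs, Real.norm_eq_abs, sq_abs, sq_abs, real_inner_comm]
  obtain rfl : s = 1 - t := by linarith
  simp only [conj_trivial]
  ring

/-- Quadratic growth of the model at a minimizer. -/
lemma Standing.modelReal_add_le (h : p.Standing lf lg Lg) {w : Vec m} {J : Jac m n}
    {x y z : Vec n} (hy : p.h y ≠ ⊤) (hz : p.h z ≠ ⊤)
    (hmin : ∀ y', p.h y' ≠ ⊤ → p.modelReal M w J x y ≤ p.modelReal M w J x y') :
    p.modelReal M w J x y + M / 2 * ‖z - y‖ ^ 2 ≤ p.modelReal M w J x z := by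
  -- Compare the minimizer with a point of the segment towards `z`, using strong convexity of the
  -- quadratic term; divide by `t` and let `t → 0`.
  have key : ∀ t : ℝ, 0 < t → t < 1 →
      M / 2 * (1 - t) * ‖z - y‖ ^ 2 ≤ p.modelReal M w J x z - p.modelReal M w J x y := by
    intro t ht0 ht1
    have hst : (1 - t) + t = 1 := by ring
    obtain ⟨hd, hh⟩ := h.hReal_segment hy hz (sub_nonneg.2 ht1.le) ht0.le hst
    have h1 := hmin _ hd
    have h2 : p.f (w + J ((1 - t) • y + t • z - x)) ≤
        (1 - t) * p.f (w + J (y - x)) + t * p.f (w + J (z - x)) := by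
      have := h.f_convex.2 (mem_univ (w + J (y - x))) (mem_univ (w + J (z - x)))
        (sub_nonneg.2 ht1.le) ht0.le hst
      refine le_trans (le_of_eq ?_) this
      congr 1
      simp only [map_sub, map_add, map_smul]
      module
    have h3 : ‖(1 - t) • y + t • z - x‖ ^ 2 = (1 - t) * ‖y - x‖ ^ 2 + t * ‖z - x‖ ^ 2 -
        (1 - t) * t * ‖z - y‖ ^ 2 := by
      rw [show (1 - t) • y + t • z - x = (1 - t) • (y - x) + t • (z - x) by module,
        norm_sq_convex_combination _ _ hst, sub_sub_sub_cancel_right]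
    have h4 : 0 ≤ t * (p.modelReal M w J x z - p.modelReal M w J x y -
        M / 2 * (1 - t) * ‖z - y‖ ^ 2) := by
      simp only [modelReal] at h1 ⊢
      rw [h3] at h1
      linarith
    linarith [nonneg_of_mul_nonneg_right h4 ht0]
  have hlim : Filter.Tendsto (fun t : ℝ => M / 2 * (1 - t) * ‖z - y‖ ^ 2) (nhdsWithin 0 (Ioi 0))
      (nhds (M / 2 * (1 - 0) * ‖z - y‖ ^ 2)) :=
    (Continuous.tendsto (by fun_prop) 0).mono_left nhdsWithin_le_nhds
  have := le_of_tendsto hlim (b := p.modelReal M w J x z - p.modelReal M w J x y) (by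
    filter_upwards [Ioo_mem_nhdsGT (zero_lt_one (α := ℝ))] with t ht using key t ht.1 ht.2)
  linarith

lemma Standing.isMinOn_iff (h : p.Standing lf lg Lg) {w : Vec m} {J : Jac m n} {x y : Vec n} :
    IsMinOn (p.model M w J x) univ y ↔
      p.h y ≠ ⊤ ∧ ∀ y', p.h y' ≠ ⊤ → p.modelReal M w J x y ≤ p.modelReal M w J x y' := by
  rw [isMinOn_univ_iff]
  constructor
  · intro hmin
    obtain ⟨z, hz⟩ := h.h_ccp.exists_ne_top
    have hy : p.h y ≠ ⊤ := h_ne_top_of_model_lt (M := M) (w := w) (J := J) (x := x)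
      ((hmin z).trans_lt (by rw [h.model_eq _ _ _ hz]; exact EReal.coe_lt_top _))
    refine ⟨hy, fun y' hy' => ?_⟩
    have := hmin y'
    rwa [h.model_eq _ _ _ hy, h.model_eq _ _ _ hy', EReal.coe_le_coe_iff] at this
  · rintro ⟨hy, hmin⟩ y'
    by_cases hy' : p.h y' = ⊤
    · refine le_of_le_of_eq le_top ?_
      rw [model, hy', EReal.coe_add_top, EReal.top_add_coe]
    · rw [h.model_eq _ _ _ hy, h.model_eq _ _ _ hy', EReal.coe_le_coe_iff]
      exact hmin y' hy'

lemma Standing.lowerSemicontinuous_model (h : p.Standing lf lg Lg) (w : Vec m) (J : Jac m n)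
    (x : Vec n) : LowerSemicontinuous (p.model M w J x) := by
  have hf : Continuous p.f := h.f_lipschitz.continuous
  have h1 : LowerSemicontinuous fun y => (p.f (w + J (y - x)) : EReal) + p.h y :=
    LowerSemicontinuous.add'
      (continuous_coe_real_ereal.comp (by fun_prop :
        Continuous fun y => p.f (w + J (y - x)))).lowerSemicontinuous h.h_ccp.closed
      fun y => EReal.continuousAt_add (Or.inl (EReal.coe_ne_top _)) (Or.inl (EReal.coe_ne_bot _))
  exact LowerSemicontinuous.add' h1
    (continuous_coe_real_ereal.comp (by fun_prop :
      Continuous fun y => M / 2 * ‖y - x‖ ^ 2)).lowerSemicontinuous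
    fun y => EReal.continuousAt_add (Or.inr (EReal.coe_ne_bot _)) (Or.inr (EReal.coe_ne_top _))

lemma Standing.f_sub_le (h : p.Standing lf lg Lg) (u v : Vec m) :
    p.f u - p.f v ≤ lf * ‖u - v‖ :=
  (le_abs_self _).trans (by simpa [Real.norm_eq_abs] using h.f_lipschitz.norm_sub_le u v)

/-- Coercivity comes from the lower bound `φ` of `Φ`: the model differs from `Φ` plus the quadratic
by at most an affine function of `‖y - x‖`. A sublevel set therefore lies in a ball, where lower
semicontinuity yields a minimizer; quadratic growth makes it unique. -/
lemma Standing.existsUnique_isMinOn (h : p.Standing lf lg Lg) (hM : 0 < M)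
    {φ : ℝ} (hφ : ∀ y, p.h y ≠ ⊤ → φ ≤ p.objReal y) (w : Vec m) (J : Jac m n) (x : Vec n) :
    ∃! y, IsMinOn (p.model M w J x) univ y := by
  obtain ⟨z, hz⟩ := h.h_ccp.exists_ne_top
  set C : ℝ := lf * (lg + ‖J‖) with hC
  set T : ℝ := p.modelReal M w J x z - φ + lf * ‖p.g x - w‖ with hT
  set R : ℝ := 2 / M * (C + |T|) + 1 with hR
  have hC0 : 0 ≤ C := by positivity
  have hbig : ∀ y, p.h y ≠ ⊤ → p.modelReal M w J x y ≤ p.modelReal M w J x z →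
      ‖y - x‖ ≤ R := by
    intro y hy hle
    have h1 := hφ y hy
    have h2 : p.f (p.g y) - p.f (w + J (y - x)) ≤ lf * ‖p.g x - w‖ + C * ‖y - x‖ := by
      refine (h.f_sub_le _ _).trans ?_
      have e : p.g y - (w + J (y - x)) = (p.g y - p.g x) + (p.g x - w) - J (y - x) := by abel
      have e1 := (norm_sub_le (p.g y - p.g x + (p.g x - w)) (J (y - x)))
      have e2 := norm_add_le (p.g y - p.g x) (p.g x - w)
      have e3 := h.g_lipschitz.norm_sub_le y x
      have e4 := J.le_opNorm (y - x)
      rw [e, hC]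
      calc (lf : ℝ) * ‖p.g y - p.g x + (p.g x - w) - J (y - x)‖
          ≤ lf * (lg * ‖y - x‖ + ‖p.g x - w‖ + ‖J‖ * ‖y - x‖) := by
            gcongr; linarith
        _ = _ := by ring
    by_contra! hlt
    have h3 : M / 2 * ‖y - x‖ ^ 2 - C * ‖y - x‖ ≤ T := by
      simp only [objReal] at h1
      rw [hT]
      simp only [modelReal] at hle ⊢
      linarith
    have h4 : C + |T| < M / 2 * ‖y - x‖ := by
      have : M / 2 * R = C + |T| + M / 2 := by rw [hR]; field_simp
      have := mul_lt_mul_of_pos_left hlt (half_pos hM)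
      linarith
    have h5 : 1 < ‖y - x‖ := by
      have : 0 ≤ 2 / M * (C + |T|) := by positivity
      linarith
    have h6 : |T| * 1 ≤ |T| * ‖y - x‖ := mul_le_mul_of_nonneg_left h5.le (abs_nonneg T)
    nlinarith [le_abs_self T]
  have hzR := hbig z hz le_rfl
  obtain ⟨y, hyR, hymin⟩ := LowerSemicontinuousOn.exists_isMinOn (s := Metric.closedBall x R)
    ⟨z, by simpa [dist_eq_norm] using hzR⟩ (isCompact_closedBall x R)
    ((h.lowerSemicontinuous_model (M := M) w J x).lowerSemicontinuousOn _)
  have hyz : p.model M w J x y ≤ p.model M w J x z :=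
    hymin (by simpa [dist_eq_norm] using hzR : z ∈ Metric.closedBall x R)
  have hy : p.h y ≠ ⊤ := h_ne_top_of_model_lt (hyz.trans_lt
    (by rw [h.model_eq _ _ _ hz]; exact EReal.coe_lt_top _))
  rw [h.model_eq _ _ _ hy, h.model_eq _ _ _ hz, EReal.coe_le_coe_iff] at hyz
  have hmin : IsMinOn (p.model M w J x) univ y := by
    refine h.isMinOn_iff.2 ⟨hy, fun y' hy' => ?_⟩
    rcases le_total (p.modelReal M w J x y') (p.modelReal M w J x z) with hc | hc
    · have : p.model M w J x y ≤ p.model M w J x y' :=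
        hymin (by simpa [dist_eq_norm] using hbig y' hy' hc : y' ∈ Metric.closedBall x R)
      rwa [h.model_eq _ _ _ hy, h.model_eq _ _ _ hy', EReal.coe_le_coe_iff] at this
    · exact hyz.trans hc
  refine ⟨y, hmin, fun y' hy' => ?_⟩
  obtain ⟨e1, e2⟩ := h.isMinOn_iff.1 hmin
  obtain ⟨e3, e4⟩ := h.isMinOn_iff.1 hy'
  have h1 := h.modelReal_add_le e1 e3 e2
  have h2 := e4 y hy
  have h3 : ‖y' - y‖ ^ 2 ≤ 0 := by
    by_contra! hc
    have := mul_pos (half_pos hM) hc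
    linarith
  have h4 : ‖y' - y‖ = 0 := by simpa using le_antisymm h3 (sq_nonneg _)
  exact sub_eq_zero.1 (norm_eq_zero.1 h4)

/-- The mean value inequality for `g` minus its linearization on a ball. The sharper factor `1/2` is
not needed for the descent. -/
lemma Standing.norm_g_sub_linear_le (h : p.Standing lf lg Lg) (x y : Vec n) :
    ‖p.g y - (p.g x + fderiv ℝ p.g x (y - x))‖ ≤ Lg * ‖y - x‖ ^ 2 := by
  have hx : x ∈ Metric.closedBall x ‖y - x‖ := by simp
  have hy : y ∈ Metric.closedBall x ‖y - x‖ := by simp [dist_eq_norm]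
  have := (convex_closedBall x ‖y - x‖).norm_image_sub_le_of_norm_hasFDerivWithin_le'
    (f := p.g) (f' := fderiv ℝ p.g) (φ := fderiv ℝ p.g x) (C := Lg * ‖y - x‖)
    (fun z _ => (h.g_differentiable z).hasFDerivAt.hasFDerivWithinAt)
    (fun z hz => (h.jac_lipschitz.norm_sub_le z x).trans (by
      gcongr
      simpa [dist_eq_norm] using hz)) hx hy
  rw [← sub_sub]
  calc _ ≤ Lg * ‖y - x‖ * ‖y - x‖ := this
    _ = _ := by ring

/-- One inexact prox-linear step decreases the objective, up to the errors of the estimates. -/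
lemma Standing.descent (h : p.Standing lf lg Lg) (hM : 5 * lf * Lg < M)
    {φ : ℝ} (hφ : ∀ y, p.h y ≠ ⊤ → φ ≤ p.objReal y) {w : Vec m} {J : Jac m n} {x y : Vec n}
    (hx : p.h x ≠ ⊤) {ε : ℝ}
    (hy : p.model M w J x y ≤ (⨅ z, p.model M w J x z) + (ε : EReal)) :
    p.h y ≠ ⊤ ∧ 2 * M / 5 * ‖p.proxLinearStep M x - x‖ ^ 2 + M / 5 * ‖y - x‖ ^ 2 + p.objReal y ≤
      p.objReal x + ε + 2 * lf * ‖w - p.g x‖ +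
        5 * lf ^ 2 / M * ‖J - fderiv ℝ p.g x‖ ^ 2 := by
  have hM0 : 0 < M := lt_of_le_of_lt (by positivity) hM
  have hle : ∀ z, p.model M w J x y ≤ p.model M w J x z + (ε : EReal) := fun z =>
    hy.trans (by gcongr; exact iInf_le _ z)
  have hyt : p.h y ≠ ⊤ := h_ne_top_of_model_lt ((hle x).trans_lt (by
    rw [h.model_eq _ _ _ hx, ← EReal.coe_add]; exact EReal.coe_lt_top _))
  refine ⟨hyt, ?_⟩
  set q := p.proxLinearStep M x with hq
  -- `proxLinearStep` is a choice; existence of a minimizer is what gives it content.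
  have hqmin : IsMinOn (p.model M (p.g x) (fderiv ℝ p.g x) x) univ q :=
    Classical.epsilon_spec (h.existsUnique_isMinOn hM0 hφ (p.g x) (fderiv ℝ p.g x) x).exists
  obtain ⟨hqt, hqm⟩ := h.isMinOn_iff.1 hqmin
  -- At `x` itself the exact model equals `Φ(x)`. Growth adds a second `M/2 ‖q - x‖²`, which
  -- survives the comparison of `y` with `q`.
  have hgrow := h.modelReal_add_le hqt hx hqm
  have hsol : p.modelReal M w J x y ≤ p.modelReal M w J x q + ε := by
    have := hle q
    rwa [h.model_eq _ _ _ hyt, h.model_eq _ _ _ hqt, ← EReal.coe_add, EReal.coe_le_coe_iff] at this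
  have hlin : ∀ u v : Vec m, ∀ A B : Jac m n, ∀ d : Vec n,
      p.f (u + A d) - p.f (v + B d) ≤ lf * (‖u - v‖ + ‖A - B‖ * ‖d‖) := fun u v A B d => by
    refine (h.f_sub_le _ _).trans ?_
    gcongr
    rw [add_sub_add_comm, ← sub_apply]
    exact (norm_add_le _ _).trans (by gcongr; exact (A - B).le_opNorm d)
  have h1 := hlin (p.g x) w (fderiv ℝ p.g x) J (y - x)
  have h2 := hlin w (p.g x) J (fderiv ℝ p.g x) (q - x)
  rw [norm_sub_rev (p.g x), norm_sub_rev (fderiv ℝ p.g x)] at h1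
  have h3 : p.f (p.g y) - p.f (p.g x + fderiv ℝ p.g x (y - x)) ≤ lf * (Lg * ‖y - x‖ ^ 2) :=
    (h.f_sub_le _ _).trans (by gcongr; exact h.norm_g_sub_linear_le x y)
  set e := ‖J - fderiv ℝ p.g x‖ with he
  -- Young's inequality, used at `y` and at `q`: each `M/2` drops to `2M/5`, and the Jacobian error
  -- becomes quadratic.
  have hyoung : ∀ d : ℝ, lf * (e * d) ≤ M / 10 * d ^ 2 + 5 * lf ^ 2 / (2 * M) * e ^ 2 := fun d => by
    have : M / 10 * d ^ 2 + 5 * lf ^ 2 / (2 * M) * e ^ 2 - lf * (e * d) =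
        (M * d - 5 * (lf * e)) ^ 2 / (10 * M) := by field_simp; ring
    have : 0 ≤ (M * d - 5 * (lf * e)) ^ 2 / (10 * M) := by positivity
    linarith
  have h4 := hyoung ‖y - x‖
  have h5 := hyoung ‖q - x‖
  -- The linearization error consumes half of the remaining `2M/5` at `y`.
  have h6 : (lf : ℝ) * (Lg * ‖y - x‖ ^ 2) ≤ M / 5 * ‖y - x‖ ^ 2 := by
    rw [← mul_assoc]; gcongr; linarith
  have h7 : 5 * lf ^ 2 / (2 * M) * e ^ 2 + 5 * lf ^ 2 / (2 * M) * e ^ 2 =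
      5 * lf ^ 2 / M * e ^ 2 := by field_simp; ring
  rw [norm_sub_rev x q] at hgrow
  simp only [modelReal, sub_self, map_zero, add_zero, norm_zero] at hgrow hsol
  simp only [objReal]
  linarith

end Problem

/-! ### Summing the descent over an epoch and over a run -/

/-- Telescoping and Cauchy–Schwarz for each `i`; summing over `i` costs the second factor `τ`. -/
lemma sum_norm_sub_first_sq_le {E : Type*} [SeminormedAddCommGroup E] (x : ℕ → E) (τ : ℕ) :
    ∑ i ∈ Finset.range τ, ‖x i - x 0‖ ^ 2 ≤
      (τ : ℝ) ^ 2 * ∑ j ∈ Finset.range τ, ‖x (j + 1) - x j‖ ^ 2 := by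
  have hi : ∀ i ∈ Finset.range τ, ‖x i - x 0‖ ^ 2 ≤
      τ * ∑ j ∈ Finset.range τ, ‖x (j + 1) - x j‖ ^ 2 := by
    intro i hi
    have hiτ := (Finset.mem_range.1 hi).le
    calc ‖x i - x 0‖ ^ 2 = ‖∑ j ∈ Finset.range i, (x (j + 1) - x j)‖ ^ 2 := by
          rw [Finset.sum_range_sub]
      _ ≤ (∑ j ∈ Finset.range i, ‖x (j + 1) - x j‖) ^ 2 := by
          gcongr; exact norm_sum_le _ _
      _ ≤ i * ∑ j ∈ Finset.range i, ‖x (j + 1) - x j‖ ^ 2 := by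
          simpa using sq_sum_le_card_mul_sum_sq (s := Finset.range i)
            (f := fun j => ‖x (j + 1) - x j‖)
      _ ≤ τ * ∑ j ∈ Finset.range τ, ‖x (j + 1) - x j‖ ^ 2 := by
          gcongr
  calc _ ≤ ∑ i ∈ Finset.range τ, τ * ∑ j ∈ Finset.range τ, ‖x (j + 1) - x j‖ ^ 2 :=
        Finset.sum_le_sum hi
    _ = _ := by rw [Finset.sum_const, Finset.card_range, nsmul_eq_mul]; ring

namespace Setup

variable {m n : ℕ} {Ξ : Type u} [MeasurableSpace Ξ] {S : Type v} [MeasurableSpace S]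
  {a : Setup m n Ξ S} {lf lg Lg : ℝ≥0} {M rA rB ra rb φ : ℝ} {ω : Draws Ξ S} {k : ℕ}

lemma norm_est_fst_sub_le (h0 : a.GoodStep M rA rB ra rb ω k 0) {i : ℕ}
    (hi : a.GoodStep M rA rB ra rb ω k i) :
    ‖(a.est ω k i).1 - a.p.g (a.iterate ω k i)‖ ≤
      rA + ra * ‖a.iterate ω k i - a.iterate ω k 0‖ := by
  have h1 := h0.value_start rfl
  by_cases h : i = 0
  · subst h; simpa [iterate_zero] using h1
  · refine le_trans (le_of_eq ?_) ((norm_add_le _ _).trans (add_le_add h1 (hi.value_inner h)))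
    congr 1; abel

lemma norm_est_snd_sub_le (h0 : a.GoodStep M rA rB ra rb ω k 0) {i : ℕ}
    (hi : a.GoodStep M rA rB ra rb ω k i) :
    ‖(a.est ω k i).2 - fderiv ℝ a.p.g (a.iterate ω k i)‖ ≤
      rB + rb * ‖a.iterate ω k i - a.iterate ω k 0‖ := by
  have h1 := h0.jac_start rfl
  by_cases h : i = 0
  · subst h; simpa [iterate_zero] using h1
  · refine le_trans (le_of_eq ?_) ((norm_add_le _ _).trans (add_le_add h1 (hi.jac_inner h)))
    congr 1; abel

/-- The drift terms of both estimates are kept below `M/(10τ²) ‖x_i - x_0‖²`, whose sum is at most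
`M/10 ∑ ‖x_{j+1} - x_j‖²`, half of the available gain. What is left is the fixed error per step.
Finiteness of `h` along the epoch is carried along, since descent requires it. -/
lemma epoch_descent (h : a.p.Standing lf lg Lg) (hM : 5 * lf * Lg < M)
    (hφ : ∀ y, a.p.h y ≠ ⊤ → φ ≤ a.p.objReal y) (hτ : 0 < a.τ)
    (hrb : 200 * (lf * rb * a.τ) ^ 2 ≤ M ^ 2)
    (hgood : ∀ i < a.τ, a.GoodStep M rA rB ra rb ω k i) (hk : a.p.h (a.epochStart ω k) ≠ ⊤) :
    a.p.h (a.epochStart ω (k + 1)) ≠ ⊤ ∧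
    2 * M / 5 * ∑ i ∈ Finset.range a.τ,
        ‖a.p.proxLinearStep M (a.iterate ω k i) - a.iterate ω k i‖ ^ 2 +
      a.p.objReal (a.epochStart ω (k + 1)) ≤ a.p.objReal (a.epochStart ω k) +
        a.τ * (a.εbar + 2 * lf * rA + 10 / M * (lf * rB) ^ 2 + 20 / M * (lf * ra * a.τ) ^ 2) := by
  have hM0 : 0 < M := lt_of_le_of_lt (by positivity) hM
  have hτ' : (0 : ℝ) < a.τ := by exact_mod_cast hτ
  set x := a.iterate ω k with hx
  have hfin : ∀ i ≤ a.τ, a.p.h (x i) ≠ ⊤ := by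
    intro i
    induction i with
    | zero => exact fun _ => hk
    | succ i ih =>
      exact fun hi => (h.descent hM hφ (ih (by omega)) (hgood i (by omega)).solved).1
  refine ⟨hfin a.τ le_rfl, ?_⟩
  set e := a.εbar + 2 * lf * rA + 10 / M * (lf * rB) ^ 2 + 20 / M * (lf * ra * a.τ) ^ 2 with he
  have hstep : ∀ i ∈ Finset.range a.τ, 2 * M / 5 * ‖a.p.proxLinearStep M (x i) - x i‖ ^ 2 +
      M / 5 * ‖x (i + 1) - x i‖ ^ 2 + (a.p.objReal (x (i + 1)) - a.p.objReal (x i)) ≤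
      e + M / (10 * a.τ ^ 2) * ‖x i - x 0‖ ^ 2 := by
    intro i hi
    have hi' := Finset.mem_range.1 hi
    have h1 := (h.descent hM hφ (hfin i hi'.le) (hgood i hi').solved).2
    have h2 := norm_est_fst_sub_le (hgood 0 hτ) (hgood i hi')
    have h3 := norm_est_snd_sub_le (hgood 0 hτ) (hgood i hi')
    set d := ‖x i - x 0‖ with hd
    have h4 : 2 * lf * ‖(a.est ω k i).1 - a.p.g (x i)‖ ≤ 2 * lf * rA + 2 * (lf * ra) * d := by
      calc _ ≤ 2 * lf * (rA + ra * d) := by gcongr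
        _ = _ := by ring
    have h5 : 5 * lf ^ 2 / M * ‖(a.est ω k i).2 - fderiv ℝ a.p.g (x i)‖ ^ 2 ≤
        10 / M * (lf * rB) ^ 2 + 10 / M * (lf * rb) ^ 2 * d ^ 2 := by
      calc _ ≤ 5 * lf ^ 2 / M * (rB + rb * d) ^ 2 := by gcongr
        _ ≤ 5 * lf ^ 2 / M * (2 * rB ^ 2 + 2 * (rb * d) ^ 2) := by
            gcongr; nlinarith [sq_nonneg (rB - rb * d)]
        _ = _ := by ring
    -- The value error is linear in `d`, so Young's inequality leaves a constant of order `(ra τ)²`;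
    -- this forces `ra` to be of order `√ε/τ`.
    have h6 : 2 * (lf * ra) * d ≤ 20 / M * (lf * ra * a.τ) ^ 2 + M / (20 * a.τ ^ 2) * d ^ 2 := by
      have : 20 / M * (lf * ra * a.τ) ^ 2 + M / (20 * a.τ ^ 2) * d ^ 2 - 2 * (lf * ra) * d =
          (M * d - 20 * (lf * ra) * a.τ ^ 2) ^ 2 / (20 * M * a.τ ^ 2) := by field_simp; ring
      have : 0 ≤ (M * d - 20 * (lf * ra) * a.τ ^ 2) ^ 2 / (20 * M * a.τ ^ 2) := by positivity
      linarith
    -- The Jacobian drift is already quadratic in `d`, so `rb` of order `1/τ` suffices, whatever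
    -- `ε`.
    have h7 : 10 / M * (lf * rb) ^ 2 * d ^ 2 ≤ M / (20 * a.τ ^ 2) * d ^ 2 := by
      gcongr
      rw [div_mul_eq_mul_div, div_le_div_iff₀ hM0 (by positivity)]
      linarith
    have h8 : M / (10 * a.τ ^ 2) * d ^ 2 =
        M / (20 * a.τ ^ 2) * d ^ 2 + M / (20 * a.τ ^ 2) * d ^ 2 := by field_simp; ring
    linarith
  have hsum := Finset.sum_le_sum hstep
  simp only [Finset.sum_add_distrib, ← Finset.mul_sum, Finset.sum_range_sub
    (fun i => a.p.objReal (x i)), Finset.sum_const, Finset.card_range, nsmul_eq_mul] at hsum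
  have h9 := mul_le_mul_of_nonneg_left (sum_norm_sub_first_sq_le x a.τ)
    (show 0 ≤ M / (10 * (a.τ : ℝ) ^ 2) by positivity)
  have h10 : M / (10 * (a.τ : ℝ) ^ 2) * ((a.τ : ℝ) ^ 2 *
      ∑ j ∈ Finset.range a.τ, ‖x (j + 1) - x j‖ ^ 2) =
      M / 10 * ∑ j ∈ Finset.range a.τ, ‖x (j + 1) - x j‖ ^ 2 := by field_simp
  have h11 : 0 ≤ M / 10 * ∑ j ∈ Finset.range a.τ, ‖x (j + 1) - x j‖ ^ 2 := by positivity
  have h12 : a.p.objReal (a.epochStart ω (k + 1)) = a.p.objReal (x a.τ) := rfl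
  have h13 : a.p.objReal (a.epochStart ω k) = a.p.objReal (x 0) := rfl
  rw [h12, h13]
  linarith

lemma run_descent (h : a.p.Standing lf lg Lg) (hM : 5 * lf * Lg < M)
    (hφ : ∀ y, a.p.h y ≠ ⊤ → φ ≤ a.p.objReal y) (hτ : 0 < a.τ)
    (hrb : 200 * (lf * rb * a.τ) ^ 2 ≤ M ^ 2) (h0 : a.p.h a.start ≠ ⊤) (K : ℕ)
    (hgood : ∀ k < K, ∀ i < a.τ, a.GoodStep M rA rB ra rb ω k i) :
    a.p.h (a.epochStart ω K) ≠ ⊤ ∧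
    2 * M / 5 * ∑ k ∈ Finset.range K, ∑ i ∈ Finset.range a.τ,
        ‖a.p.proxLinearStep M (a.iterate ω k i) - a.iterate ω k i‖ ^ 2 +
      a.p.objReal (a.epochStart ω K) ≤ a.p.objReal a.start + K *
        (a.τ * (a.εbar + 2 * lf * rA + 10 / M * (lf * rB) ^ 2 +
          20 / M * (lf * ra * a.τ) ^ 2)) := by
  induction K with
  | zero => exact ⟨h0, by simp [epochStart]⟩
  | succ K ih =>
    obtain ⟨h1, h2⟩ := ih fun k hk => hgood k (by omega)
    obtain ⟨h3, h4⟩ := epoch_descent h hM hφ hτ hrb (hgood K (by omega)) h1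
    refine ⟨h3, ?_⟩
    rw [Finset.sum_range_succ, mul_add]
    push_cast
    linarith

lemma avgSqGenGrad_le (h : a.p.Standing lf lg Lg) (hM : 5 * lf * Lg < M)
    (hφ : ∀ y, a.p.h y ≠ ⊤ → φ ≤ a.p.objReal y) (hτ : 0 < a.τ)
    (hrb : 200 * (lf * rb * a.τ) ^ 2 ≤ M ^ 2) (h0 : a.p.h a.start ≠ ⊤) {K : ℕ} (hK : 0 < K)
    (hgood : ∀ k < K, ∀ i < a.τ, a.GoodStep M rA rB ra rb ω k i) :
    a.avgSqGenGrad M K ω ≤ 5 * M / 2 * ((a.p.objReal a.start - φ) / (K * a.τ) +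
      (a.εbar + 2 * lf * rA + 10 / M * (lf * rB) ^ 2 + 20 / M * (lf * ra * a.τ) ^ 2)) := by
  have hM0 : 0 < M := lt_of_le_of_lt (by positivity) hM
  have hτ' : (0 : ℝ) < a.τ := by exact_mod_cast hτ
  have hK' : (0 : ℝ) < K := by exact_mod_cast hK
  obtain ⟨h1, h2⟩ := run_descent h hM hφ hτ hrb h0 K hgood
  have h3 := hφ _ h1
  set e := a.εbar + 2 * lf * rA + 10 / M * (lf * rB) ^ 2 + 20 / M * (lf * ra * a.τ) ^ 2
  have hG : ∀ x, ‖a.p.genGrad M x‖ ^ 2 = M ^ 2 * ‖a.p.proxLinearStep M x - x‖ ^ 2 := fun x => by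
    rw [Problem.genGrad, norm_smul, mul_pow, Real.norm_eq_abs, sq_abs, norm_sub_rev]
  simp only [avgSqGenGrad, hG, ← Finset.mul_sum]
  set Q := ∑ k ∈ Finset.range K, ∑ i ∈ Finset.range a.τ,
    ‖a.p.proxLinearStep M (a.iterate ω k i) - a.iterate ω k i‖ ^ 2
  have h4 : 2 * M / 5 * Q ≤ (a.p.objReal a.start - φ) + K * (a.τ * e) := by linarith
  have h5 : 5 * M / 2 * ((a.p.objReal a.start - φ) / (K * a.τ) + e) =
      1 / (K * a.τ) * (5 * M / 2 * ((a.p.objReal a.start - φ) + K * (a.τ * e))) := by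
    field_simp
  rw [h5]
  refine mul_le_mul_of_nonneg_left ?_ (by positivity)
  calc M ^ 2 * Q = 5 * M / 2 * (2 * M / 5 * Q) := by ring
    _ ≤ _ := by gcongr

end Setup

/-! ### Oracle complexity -/

namespace Setup

variable {m n : ℕ} {Ξ : Type u} [MeasurableSpace Ξ] {S : Type v} [MeasurableSpace S]
  (a : Setup m n Ξ S)

/-- Each inner sample is evaluated at both `x` and `x₀`, hence the factor 2. -/
lemma estimate_evals (ω : Draws Ξ S) (k : ℕ) (x₀ : Vec n) (i : ℕ) (x : Vec n) :
    (a.estimate ω k x₀ i x).evals = if i = 0 then a.θ.A else 2 * a.θ.a := by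
  by_cases hi : i = 0 <;>
    simp [estimate, hi, Problem.estStart, Problem.estInner, Counted.map₂, Counted.mean,
      Problem.callEval, Problem.callJac, mul_comm]

lemma estimate_jacs (ω : Draws Ξ S) (k : ℕ) (x₀ : Vec n) (i : ℕ) (x : Vec n) :
    (a.estimate ω k x₀ i x).jacs = if i = 0 then a.θ.B else 2 * a.θ.b := by
  by_cases hi : i = 0 <;>
    simp [estimate, hi, Problem.estStart, Problem.estInner, Counted.map₂, Counted.mean,
      Problem.callEval, Problem.callJac, mul_comm]

lemma sum_range_ite_zero (N N' : ℕ) {τ : ℕ} (hτ : 0 < τ) :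
    (∑ i ∈ Finset.range τ, if i = 0 then N else N') = N + (τ - 1) * N' := by
  obtain ⟨t, rfl⟩ : ∃ t, τ = t + 1 := ⟨τ - 1, by omega⟩
  rw [Finset.sum_range_succ']
  simp [add_comm]

lemma totalEvals_eq (hτ : 0 < a.τ) (K : ℕ) (ω : Draws Ξ S) :
    a.totalEvals K ω = K * (a.θ.A + (a.τ - 1) * (2 * a.θ.a)) := by
  simp [totalEvals, estimate_evals, sum_range_ite_zero _ _ hτ]

lemma totalJacs_eq (hτ : 0 < a.τ) (K : ℕ) (ω : Draws Ξ S) :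
    a.totalJacs K ω = K * (a.θ.B + (a.τ - 1) * (2 * a.θ.b)) := by
  simp [totalJacs, estimate_jacs, sum_range_ite_zero _ _ hτ]

end Setup

lemma one_le_log_of_three_le {x : ℝ} (hx : 3 ≤ x) : 1 ≤ Real.log x := by
  rw [Real.le_log_iff_exp_le (by linarith)]
  linarith [Real.exp_one_lt_d9]

/-- Here `E = 1/ε`, `T = τ`, `P = ε^(-j)`, `l = log(1/Δ)`, `lam = log(1/ε)`, and `L` is the
logarithm in the batch sizes. The epoch starts produce the first summand of the rate and the inner
steps the second. -/
lemma softTheta_arithmetic {CS C₁ C₂ Cτ U T E P l L lam K N N' : ℝ} (hCS : 0 < CS) (hC₁ : 0 < C₁)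
    (hC₂ : 0 < C₂) (hCτ : 0 < Cτ) (hT : T = 1 ∨ 2 ≤ T) (hE : 1 ≤ E) (hP0 : 0 < P)
    (hlpos : 0 < l) (hLl : l ≤ L) (hLU : L ≤ U * (lam * l))
    (hK1 : CS * E / T ≤ K) (hK2 : K ≤ (CS + Cτ) * E / T)
    (hN1 : C₁ * (P * E) * L ≤ N) (hN2 : N ≤ (C₁ + 1) * (P * E) * L)
    (hN'1 : C₂ * T ^ 2 * P * L ≤ N') (hN'2 : N' ≤ (C₂ + 1) * (T ^ 2 * P * L)) :
    min (CS * C₁ / 2) (CS * C₂ / 2) * ((P * E ^ 2 * T⁻¹ + P * E * T ^ 2) * l) ≤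
      K * (N + (T - 1) * (2 * N')) ∧
    K * (N + (T - 1) * (2 * N')) ≤ (CS + Cτ) * (C₁ + 1 + 2 * (C₂ + 1)) * U *
      ((P * E ^ 2 * T⁻¹ + P * E * T ^ 2) * l) * lam := by
  have hT1' : 1 ≤ T := by rcases hT with h | h <;> linarith
  have hT0 : 0 < T := by linarith
  have hE0 : 0 < E := by linarith
  have hLpos : 0 < L := by linarith
  have hK0 : 0 < K := lt_of_lt_of_le (by positivity) hK1
  have hN0 : 0 < N := lt_of_lt_of_le (by positivity) hN1
  have hN'pos : 0 < N' := lt_of_lt_of_le (by positivity) hN'1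
  set r₁ := P * E ^ 2 * T⁻¹ with hr₁
  set r₂ := P * E * T ^ 2 with hr₂
  have hr₁0 : 0 < r₁ := by positivity
  have hr₂0 : 0 < r₂ := by positivity
  constructor
  · have hpart1 : CS * C₁ * r₁ * l ≤ K * N := by
      calc CS * C₁ * r₁ * l ≤ CS * C₁ * r₁ * L := by gcongr
        _ = (CS * E / T) * (C₁ * (P * E) * L) := by rw [hr₁]; field_simp
        _ ≤ K * N := by gcongr
    have hpart2 : 0 ≤ K * ((T - 1) * (2 * N')) :=
      mul_nonneg (by positivity) (mul_nonneg (by linarith) (by positivity))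
    have hmin1 := min_le_left (CS * C₁ / 2) (CS * C₂ / 2)
    have hmin2 := min_le_right (CS * C₁ / 2) (CS * C₂ / 2)
    set c := min (CS * C₁ / 2) (CS * C₂ / 2)
    have hc1 : c * (r₁ * l) ≤ CS * C₁ / 2 * (r₁ * l) := by gcongr
    -- For `τ = 1` there are no inner steps, but then the second summand is dominated by the first.
    -- For `τ ≥ 2`, `2(τ - 1) ≥ τ`.
    rcases hT with hT1 | hT2
    · have hr21 : r₂ ≤ r₁ := by
        rw [hr₁, hr₂, hT1]
        have : P * E * 1 ≤ P * E * E := by gcongr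
        linarith
      have hc2 : c * (r₂ * l) ≤ CS * C₁ / 2 * (r₁ * l) := by gcongr
      linarith
    · have hpart2' : CS * C₂ * r₂ * l ≤ K * ((T - 1) * (2 * N')) := by
        calc CS * C₂ * r₂ * l ≤ CS * C₂ * r₂ * L := by gcongr
          _ = (CS * E / T) * (T * (C₂ * T ^ 2 * P * L)) := by rw [hr₂]; field_simp
          _ ≤ K * (T * N') := by gcongr
          _ ≤ K * ((T - 1) * (2 * N')) := by
              have : T * N' ≤ (2 * (T - 1)) * N' := by gcongr; linarith
              exact mul_le_mul_of_nonneg_left (by linarith) hK0.le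
      have hc2 : c * (r₂ * l) ≤ CS * C₂ / 2 * (r₂ * l) := by gcongr
      have : 0 < CS * C₂ * (r₂ * l) := by positivity
      have : 0 < CS * C₁ * (r₁ * l) := by positivity
      linarith
  · calc K * (N + (T - 1) * (2 * N'))
        ≤ K * (N + T * (2 * N')) := by gcongr; linarith
      _ ≤ ((CS + Cτ) * E / T) * ((C₁ + 1) * (P * E) * L +
            T * (2 * ((C₂ + 1) * (T ^ 2 * P * L)))) := by gcongr
      _ = (CS + Cτ) * ((C₁ + 1) * r₁ + 2 * (C₂ + 1) * r₂) * L := by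
          rw [hr₁, hr₂]; field_simp
      _ ≤ (CS + Cτ) * ((C₁ + 1 + 2 * (C₂ + 1)) * (r₁ + r₂)) * (U * (lam * l)) := by
          have h1 : (C₁ + 1) * r₁ + 2 * (C₂ + 1) * r₂ ≤ (C₁ + 1 + 2 * (C₂ + 1)) * (r₁ + r₂) := by
            have : 0 ≤ (C₁ + 1) * r₂ + 2 * (C₂ + 1) * r₁ := by positivity
            linarith
          gcongr
      _ = _ := by ring

/-- Treats both oracles at once: `j = 1` for `g`, `j = 0` for `g'`. One power of `log(1/ε)`
suffices, because `Kτ = O(1/ε)` makes the batch logarithm `O(log(1/ε) + log(1/Δ))`, and `Δ ≤ Δmax <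
1` turns this sum into a product. -/
lemma exists_softThetaBound {CS C₁ C₂ d Cτ Δmax : ℝ} (hCS : 0 < CS) (hC₁ : 0 < C₁) (hC₂ : 0 < C₂)
    (hd : 1 ≤ d) (hCτ : 0 < Cτ) (hΔ0 : 0 < Δmax) (hΔ1 : Δmax < 1) (j : ℕ) :
    ∃ c₁ c₂ : ℝ, 0 < c₁ ∧ 0 < c₂ ∧ ∀ (Δ : ℝ) (τ : ℕ) (ε : ℝ), 0 < Δ → Δ ≤ Δmax → 0 < τ →
      (τ : ℝ) ≤ Cτ * ε⁻¹ → 0 < ε → ε < 1 / 3 → ∀ (K : ℕ), K = ⌈CS * ε⁻¹ / τ⌉₊ →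
      ∀ (N N' : ℕ), N = ⌈C₁ * (ε ^ (j + 1))⁻¹ * Real.log (4 * d * K * τ / Δ)⌉₊ →
      N' = ⌈C₂ * (τ : ℝ) ^ 2 * (ε ^ j)⁻¹ * Real.log (4 * d * K * τ / Δ)⌉₊ →
      SoftThetaBound c₁ c₂ 1 ε
        (((ε ^ (j + 2))⁻¹ * (τ : ℝ)⁻¹ + (ε ^ (j + 1))⁻¹ * (τ : ℝ) ^ 2) * Real.log (1 / Δ))
        (K * (N + (τ - 1) * (2 * N'))) := by
  set l₀ := Real.log (1 / Δmax) with hl₀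
  have hl₀pos : 0 < l₀ := Real.log_pos (by rw [lt_div_iff₀ hΔ0]; linarith)
  set W := 4 * d * (CS + Cτ) with hW
  have hWpos : 0 < W := by positivity
  set U := (|Real.log W| + 1) / l₀ + 1 with hU
  have hUpos : 0 < U := by positivity
  refine ⟨min (CS * C₁ / 2) (CS * C₂ / 2), (CS + Cτ) * (C₁ + 1 + 2 * (C₂ + 1)) * U,
    by positivity, by positivity, ?_⟩
  intro Δ τ ε hΔ hΔm hτ hτC hε hε1 K hK N N' hN hN'
  have hT : (1 : ℝ) ≤ τ := by exact_mod_cast hτ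
  set T : ℝ := (τ : ℝ) with hTdef
  have hT0 : 0 < T := by linarith
  simp only [← inv_pow] at hN hN' ⊢
  have hlogeq : Real.log (1 / ε) = Real.log ε⁻¹ := by rw [one_div]
  set E := ε⁻¹ with hE
  have hE3 : 3 < E := by rw [hE, lt_inv_comm₀ (by norm_num) hε]; linarith
  have hE0 : 0 < E := by linarith
  set P := E ^ j with hP
  have hP1 : 1 ≤ P := one_le_pow₀ (by linarith)
  have hP0 : 0 < P := by linarith
  have hlam : 1 ≤ Real.log E := one_le_log_of_three_le hE3.le
  set lam := Real.log E with hlamdef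
  set l := Real.log (1 / Δ) with hl
  have hll : l₀ ≤ l := Real.log_le_log (by positivity) (one_div_le_one_div_of_le hΔ hΔm)
  have hlpos : 0 < l := hl₀pos.trans_le hll
  -- bounds for `K`
  have hK1 : CS * E / T ≤ K := by rw [hK]; exact Nat.le_ceil _
  have hK2 : (K : ℝ) ≤ (CS + Cτ) * E / T := by
    -- The rounding of `K` is harmless exactly because `τ = O(1/ε)`.
    have h1 : (K : ℝ) ≤ CS * E / T + 1 := by
      rw [hK]; exact (Nat.ceil_lt_add_one (by positivity)).le
    have h2 : 1 ≤ Cτ * E / T := (one_le_div hT0).2 hτC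
    calc (K : ℝ) ≤ CS * E / T + Cτ * E / T := by linarith
      _ = _ := by ring
  have hKnat : 1 ≤ K := by rw [hK]; exact Nat.ceil_pos.2 (by positivity)
  have hKr : (1 : ℝ) ≤ K := by exact_mod_cast hKnat
  have hKT1 : 1 ≤ (K : ℝ) * T := one_le_mul_of_one_le_of_one_le hKr hT
  have hKT2 : (K : ℝ) * T ≤ (CS + Cτ) * E := by rwa [le_div_iff₀ hT0] at hK2
  -- bounds for the logarithm
  set L := Real.log (4 * d * K * T / Δ) with hL
  have hdKT : 4 ≤ 4 * d * K * T := by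
    have : 1 * 1 ≤ d * (K * T) := mul_le_mul hd hKT1 zero_le_one (by linarith)
    linarith
  have hL1 : 1 ≤ L := one_le_log_of_three_le (by
    rw [le_div_iff₀ hΔ]; linarith)
  have hLsplit : L = Real.log (4 * d * K * T) + l := by
    rw [hL, hl, div_eq_mul_one_div, Real.log_mul (by linarith) (by positivity)]
  have hLl : l ≤ L := by
    have := Real.log_nonneg (x := 4 * d * K * T) (by linarith)
    linarith
  have hLU : L ≤ U * (lam * l) := by
    have h1 : Real.log (4 * d * K * T) ≤ |Real.log W| + lam := by
      calc Real.log (4 * d * K * T) ≤ Real.log (W * E) := by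
            refine Real.log_le_log (by linarith) ?_
            calc 4 * d * K * T = 4 * d * (K * T) := by ring
              _ ≤ 4 * d * ((CS + Cτ) * E) := by gcongr
              _ = W * E := by rw [hW]; ring
        _ = Real.log W + lam := by rw [Real.log_mul hWpos.ne' hE0.ne']
        _ ≤ _ := by gcongr; exact le_abs_self _
    have h2 : |Real.log W| + lam ≤ (|Real.log W| + 1) * lam := by
      have := mul_le_mul_of_nonneg_left hlam (abs_nonneg (Real.log W))
      linarith
    have h3 : (|Real.log W| + 1) * lam ≤ (|Real.log W| + 1) / l₀ * (lam * l) := by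
      rw [div_mul_eq_mul_div, le_div_iff₀ hl₀pos, ← mul_assoc]
      gcongr
    have h4 : l ≤ lam * l := le_mul_of_one_le_left hlpos.le hlam
    rw [hLsplit, hU, add_mul, one_mul]
    linarith
  -- bounds for the batch sizes
  have hEj1 : E ^ (j + 1) = P * E := pow_succ E j
  have hEj2 : E ^ (j + 2) = P * E ^ 2 := pow_add E j 2
  rw [hEj1] at hN
  rw [hEj1, hEj2]
  have hN1 : C₁ * (P * E) * L ≤ N := by rw [hN]; exact Nat.le_ceil _
  have hN2 : (N : ℝ) ≤ (C₁ + 1) * (P * E) * L := by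
    have h1 : (N : ℝ) ≤ C₁ * (P * E) * L + 1 := by
      rw [hN]; exact (Nat.ceil_lt_add_one (by positivity)).le
    have h2 : 1 * 1 ≤ (P * E) * L :=
      mul_le_mul (one_le_mul_of_one_le_of_one_le hP1 (by linarith)) hL1 zero_le_one
        (by positivity)
    linarith
  have hN'1 : C₂ * T ^ 2 * P * L ≤ N' := by rw [hN']; exact Nat.le_ceil _
  have hN'2 : (N' : ℝ) ≤ (C₂ + 1) * (T ^ 2 * P * L) := by
    have h1 : (N' : ℝ) ≤ C₂ * T ^ 2 * P * L + 1 := by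
      rw [hN']; exact (Nat.ceil_lt_add_one (by positivity)).le
    have h2 : 1 * 1 ≤ (T ^ 2 * P) * L :=
      mul_le_mul (one_le_mul_of_one_le_of_one_le (one_le_pow₀ hT) hP1) hL1 zero_le_one
        (by positivity)
    linarith
  have hcast : ((K * (N + (τ - 1) * (2 * N')) : ℕ) : ℝ) = K * (N + (T - 1) * (2 * N')) := by
    push_cast [Nat.cast_sub hτ]
    ring
  unfold SoftThetaBound
  rw [hcast, hlogeq, pow_one]
  exact softTheta_arithmetic hCS hC₁ hC₂ hCτ (by
      rcases Nat.lt_or_ge 1 τ with hτ1 | hτ1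
      · right
        rw [hTdef]
        exact_mod_cast hτ1
      · left
        rw [hTdef, show τ = 1 by omega, Nat.cast_one])
    (by linarith) hP0 hlpos hLl hLU hK1 hK2 hN1 hN2 hN'1 hN'2

namespace Constants

variable {m n : ℕ} {Ξ : Type u} [MeasurableSpace Ξ] {S : Type v} [MeasurableSpace S]

lemma exists_complexity_bounds {c : Constants} (hc : c.Pos) (hm : 0 < m) (p : Problem m n Ξ)
    (sol : Solver m n S) (x₀ : Vec n) (M : ℝ) {Cτ Δmax : ℝ} (hCτ : 0 < Cτ) (hΔ0 : 0 < Δmax)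
    (hΔ1 : Δmax < 1) :
    ∃ (c₁ c₂ ε₁ : ℝ) (q : ℕ), 0 < c₁ ∧ 0 < c₂ ∧ 0 < ε₁ ∧
      ∀ (Δ : ℝ) (τ : ℕ) (ε : ℝ), 0 < Δ → Δ ≤ Δmax → 0 < τ → (τ : ℝ) ≤ Cτ * ε⁻¹ →
        0 < ε → ε < ε₁ → ∀ ω : Draws Ξ S,
        SoftThetaBound c₁ c₂ q ε (evalRate ε Δ τ)
          ((c.setup p sol x₀ M ε Δ τ).totalEvals (c.epochs ε τ) ω) ∧
        SoftThetaBound c₁ c₂ q ε (jacRate ε Δ τ)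
          ((c.setup p sol x₀ M ε Δ τ).totalJacs (c.epochs ε τ) ω) := by
  obtain ⟨hS, hA, hB, ha, hb⟩ := hc
  have hm1 : (1 : ℝ) ≤ m := by exact_mod_cast hm
  obtain ⟨d₁, d₂, hd₁, hd₂, H⟩ := exists_softThetaBound (d := m + 1) hS hA ha (by linarith) hCτ
    hΔ0 hΔ1 1
  obtain ⟨e₁, e₂, he₁, he₂, H'⟩ := exists_softThetaBound (d := m + n) hS hB hb
    (by have : (0 : ℝ) ≤ n := Nat.cast_nonneg n
        linarith) hCτ hΔ0 hΔ1 0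
  refine ⟨min d₁ e₁, max d₂ e₂, 1 / 3, 1, lt_min hd₁ he₁, lt_max_of_lt_left hd₂, by norm_num, ?_⟩
  intro Δ τ ε hΔ hΔm hτ hτC hε hε1 ω
  have hlog : 0 ≤ Real.log (1 / Δ) := Real.log_nonneg (by rw [le_div_iff₀ hΔ]; linarith)
  have hlam : 0 ≤ Real.log (1 / ε) := Real.log_nonneg (by rw [le_div_iff₀ hε]; linarith)
  have hmono : ∀ {a₁ a₂ b₁ b₂ r : ℝ} {X : ℕ}, b₁ ≤ a₁ → a₂ ≤ b₂ → 0 ≤ r →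
      SoftThetaBound a₁ a₂ 1 ε r X → SoftThetaBound b₁ b₂ 1 ε r X := by
    rintro a₁ a₂ b₁ b₂ r X h1 h2 hr ⟨h3, h4⟩
    exact ⟨(mul_le_mul_of_nonneg_right h1 hr).trans h3, h4.trans (by gcongr)⟩
  rw [Setup.totalEvals_eq _ hτ, Setup.totalJacs_eq _ hτ]
  constructor
  · refine hmono (min_le_left _ _) (le_max_left _ _) (by unfold evalRate; positivity) ?_
    exact H Δ τ ε hΔ hΔm hτ hτC hε hε1 (c.epochs ε τ) rfl (c.batchSizes m n ε Δ τ).A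
      (c.batchSizes m n ε Δ τ).a rfl (by simp [batchSizes])
  · refine hmono (min_le_right _ _) (le_max_right _ _) (by unfold jacRate; positivity) ?_
    have := H' Δ τ ε hΔ hΔm hτ hτC hε hε1 (c.epochs ε τ) rfl (c.batchSizes m n ε Δ τ).B
      (c.batchSizes m n ε Δ τ).b (by simp [batchSizes]) (by simp [batchSizes])
    rw [zero_add, pow_one] at this
    exact this

end Constants

/-! ### The choice of constants -/

section Choice

variable (lf lg Lg lhat Lhat : ℝ≥0) (σg σJ M gap : ℝ)

/-- Relative accuracy of the estimate of `g` at the start of an epoch. -/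
def accValueStart : ℝ := (30 * M * (lf * |σg| + 1))⁻¹

/-- Relative accuracy of the estimate of `g'` at the start of an epoch. -/
def accJacStart : ℝ := (150 * (lf * |σJ| + 1))⁻¹

/-- Relative accuracy of the estimated increments of `g` within an epoch. -/
def accValueInner : ℝ := (20 * ((lf : ℝ) * (lhat + lg) + 1))⁻¹

/-- Relative accuracy of the estimated increments of `g'` within an epoch. -/
def accJacInner : ℝ := M * (20 * ((lf : ℝ) * (Lhat + Lg) + 1))⁻¹

/-- The constants of the parameter choices. -/
def chosenConstants : Constants where
  CS := 10 * M * |gap| + 1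
  CA := 24 / accValueStart lf σg M ^ 2
  CB := 24 / accJacStart lf σJ ^ 2
  Ca := 24 / accValueInner lf lg lhat ^ 2
  Cb := 24 / accJacInner lf Lg Lhat M ^ 2

end Choice

/-! ### Error budget under the chosen accuracies. -/

variable {lf lg Lg lhat Lhat : ℝ≥0} {σg σJ M gap : ℝ}

lemma accValueStart_pos (hM : 0 < M) : 0 < accValueStart lf σg M := by
  unfold accValueStart; positivity

lemma accJacStart_pos : 0 < accJacStart lf σJ := by
  unfold accJacStart; positivity

lemma accValueInner_pos : 0 < accValueInner lf lg lhat := by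
  unfold accValueInner; positivity

lemma accJacInner_pos (hM : 0 < M) : 0 < accJacInner lf Lg Lhat M := by
  unfold accJacInner; positivity

lemma chosenConstants_pos (hM : 0 < M) :
    (chosenConstants lf lg Lg lhat Lhat σg σJ M gap).Pos := by
  have h1 := accValueStart_pos (lf := lf) (σg := σg) hM
  have h2 := accJacStart_pos (lf := lf) (σJ := σJ)
  have h3 := accValueInner_pos (lf := lf) (lg := lg) (lhat := lhat)
  have h4 := accJacInner_pos (lf := lf) (Lg := Lg) (Lhat := Lhat) hM
  refine ⟨?_, ?_, ?_, ?_, ?_⟩ <;> simp only [chosenConstants] <;> positivity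

lemma value_start_error_le (hM : 0 < M) {ε : ℝ} (hε : 0 < ε) :
    2 * lf * (ε * accValueStart lf σg M * σg) ≤ ε / (15 * M) := by
  have h : lf * σg ≤ lf * |σg| + 1 := by
    -- The absolute value and the added 1 in the accuracies keep them positive for every real `σg`
    -- and also when `lf = 0`.
    have := mul_le_mul_of_nonneg_left (le_abs_self σg) lf.coe_nonneg
    linarith
  calc 2 * lf * (ε * accValueStart lf σg M * σg)
      = 2 * ε * accValueStart lf σg M * (lf * σg) := by ring
    _ ≤ 2 * ε * accValueStart lf σg M * (lf * |σg| + 1) := by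
        have := accValueStart_pos (lf := lf) (σg := σg) hM
        gcongr
    _ = ε / (15 * M) := by unfold accValueStart; field_simp; norm_num

lemma jac_start_error_le (hM : 0 < M) {ε : ℝ} (hε : 0 < ε) :
    10 / M * (lf * (√ε * accJacStart lf σJ * σJ)) ^ 2 ≤ ε / (15 * M) := by
  have h : (lf * σJ) ^ 2 ≤ (lf * |σJ| + 1) ^ 2 := by
    refine sq_le_sq' ?_ ?_
    · have := mul_le_mul_of_nonneg_left (neg_abs_le σJ) lf.coe_nonneg
      linarith
    · have := mul_le_mul_of_nonneg_left (le_abs_self σJ) lf.coe_nonneg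
      linarith
  calc 10 / M * (lf * (√ε * accJacStart lf σJ * σJ)) ^ 2
      = 10 / M * (√ε ^ 2 * accJacStart lf σJ ^ 2) * (lf * σJ) ^ 2 := by ring
    _ ≤ 10 / M * (√ε ^ 2 * accJacStart lf σJ ^ 2) * (lf * |σJ| + 1) ^ 2 := by gcongr
    _ = ε / (2250 * M) := by
        rw [Real.sq_sqrt hε.le]; unfold accJacStart; field_simp; norm_num
    _ ≤ ε / (15 * M) := by gcongr; norm_num

lemma value_inner_error_le (hM : 0 < M) {ε T : ℝ} (hε : 0 < ε) (hT : 0 < T) :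
    20 / M * (lf * (√ε * accValueInner lf lg lhat / T * (lhat + lg)) * T) ^ 2 ≤ ε / (15 * M) := by
  calc 20 / M * (lf * (√ε * accValueInner lf lg lhat / T * (lhat + lg)) * T) ^ 2
      = 20 / M * (√ε ^ 2 * accValueInner lf lg lhat ^ 2) * (lf * (lhat + lg)) ^ 2 := by
        field_simp
    _ ≤ 20 / M * (√ε ^ 2 * accValueInner lf lg lhat ^ 2) * (lf * (lhat + lg) + 1) ^ 2 := by
        gcongr; linarith
    _ = ε / (20 * M) := by
        rw [Real.sq_sqrt hε.le]; unfold accValueInner; field_simp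
    _ ≤ ε / (15 * M) := by gcongr; norm_num

lemma jac_inner_error_le {T : ℝ} (hT : 0 < T) :
    200 * (lf * (accJacInner lf Lg Lhat M / T * (Lhat + Lg)) * T) ^ 2 ≤ M ^ 2 := by
  calc 200 * (lf * (accJacInner lf Lg Lhat M / T * (Lhat + Lg)) * T) ^ 2
      = 200 * accJacInner lf Lg Lhat M ^ 2 * (lf * (Lhat + Lg)) ^ 2 := by field_simp
    _ ≤ 200 * accJacInner lf Lg Lhat M ^ 2 * (lf * (Lhat + Lg) + 1) ^ 2 := by gcongr; linarith
    _ = M ^ 2 / 2 := by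
        have : (lf : ℝ) * (Lhat + Lg) + 1 ≠ 0 := by positivity
        rw [accJacInner, mul_pow, inv_pow, mul_pow]
        field_simp
        ring
    _ ≤ M ^ 2 := by linarith [sq_nonneg M]

/-- The accuracy `r` scales as `E^(-1/2)`, where `E` is the power of `ε` and `τ` in the batch size;
this matches each of the four batch sizes to its accuracy. -/
lemma batch_size_le {κ E L r : ℝ} (hκ : 0 < κ) (hr : r ^ 2 * E = κ ^ 2) {N : ℕ}
    (hN : N = ⌈24 / κ ^ 2 * E * L⌉₊) : 24 * L ≤ N * r ^ 2 := by
  have h : 24 / κ ^ 2 * E * L ≤ N := by rw [hN]; exact Nat.le_ceil _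
  calc 24 * L = 24 / κ ^ 2 * (r ^ 2 * E) * L := by rw [hr]; field_simp
    _ = 24 / κ ^ 2 * E * L * r ^ 2 := by ring
    _ ≤ N * r ^ 2 := by gcongr

variable {m n : ℕ} {Ξ : Type u} [MeasurableSpace Ξ] {S : Type v} [MeasurableSpace S]

/-- On the good event the argument is deterministic; it remains to split `ε` among the initial gap,
the solver tolerance and the estimation errors. -/
lemma holdsWithProb_avgSqGenGrad_le (hM : 5 * lf * Lg < M) (hm : 0 < m)
    (p : Problem m n Ξ) (sol : Solver m n S) (x₀ : Vec n) (h : p.Standing lf lg Lg)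
    (hd : p.BoundedDeviation σg σJ) (hu : p.UniformLipschitz lhat Lhat) (hsol : sol.Valid p M)
    {φ : ℝ} (hφ : ∀ y, p.h y ≠ ⊤ → φ ≤ p.objReal y) (hx₀ : p.h x₀ ≠ ⊤)
    (hgap : p.objReal x₀ - φ ≤ gap) {Δ ε : ℝ} {τ : ℕ} (hΔ : 0 < Δ) (hΔ1 : Δ < 1) (hτ : 0 < τ)
    (hε : 0 < ε) :
    HoldsWithProb (drawLaw p.D sol.law) (1 - Δ) fun ω =>
      ((chosenConstants lf lg Lg lhat Lhat σg σJ M gap).setup p sol x₀ M ε Δ τ).avgSqGenGrad M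
        ((chosenConstants lf lg Lg lhat Lhat σg σJ M gap).epochs ε τ) ω ≤ ε := by
  have hM0 : 0 < M := lt_of_le_of_lt (by positivity) hM
  set c := chosenConstants lf lg Lg lhat Lhat σg σJ M gap with hc
  have hCS : 0 < c.CS := (chosenConstants_pos hM0).1
  set K := c.epochs ε τ with hK
  set a := c.setup p sol x₀ M ε Δ τ with ha
  have hT : (0 : ℝ) < τ := by exact_mod_cast hτ
  have hT1 : (1 : ℝ) ≤ τ := by exact_mod_cast hτ
  have hKpos : 0 < K := Nat.ceil_pos.2 (by positivity)
  have hK0 : (0 : ℝ) < K := by exact_mod_cast hKpos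
  have hK1 : (1 : ℝ) ≤ K := by exact_mod_cast hKpos
  have hKT : c.CS ≤ K * τ * ε := by
    have h1 : c.CS * ε⁻¹ / τ ≤ K := Nat.le_ceil _
    calc c.CS = c.CS * ε⁻¹ / τ * τ * ε := by field_simp
      _ ≤ K * τ * ε := by gcongr
  have hm1 : (1 : ℝ) ≤ m := by exact_mod_cast hm
  have hn0 : (0 : ℝ) ≤ n := Nat.cast_nonneg n
  have hlog : ∀ d : ℝ, 1 ≤ d → 1 ≤ Real.log (4 * d * K * τ / Δ) := fun d hd => by
    refine one_le_log_of_three_le ?_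
    rw [le_div_iff₀ hΔ]
    have : 1 ≤ d * (K * τ) :=
      one_le_mul_of_one_le_of_one_le hd (one_le_mul_of_one_le_of_one_le hK1 hT1)
    linarith
  have hδ : 0 < Δ / (4 * K * τ) := by positivity
  have hdiv : ∀ d : ℝ, d / (Δ / (4 * K * τ)) = 4 * d * K * τ / Δ := fun d => by field_simp
  have hκA := accValueStart_pos (lf := lf) (σg := σg) hM0
  have hκB := accJacStart_pos (lf := lf) (σJ := σJ)
  have hκa := accValueInner_pos (lf := lf) (lg := lg) (lhat := lhat)
  have hκb := accJacInner_pos (lf := lf) (Lg := Lg) (Lhat := Lhat) hM0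
  have hs : √ε ^ 2 = ε := Real.sq_sqrt hε.le
  have hs0 : 0 < √ε := Real.sqrt_pos.2 hε
  obtain ⟨E, hE, hPE, hgood⟩ := Setup.holdsWithProb_goodStep (a := a) h hd hu hsol
    (show 0 < ε / (5 * 30 * M) by positivity) (show 0 < Δ / (2 * K * τ) by positivity)
    -- With this `δ`, two estimates cost `Δ/(2Kτ)` per step and the solver costs the same, for a
    -- total of `Δ`. Dividing the dimension by `δ` reproduces the logarithms in the batch sizes.
    (δ := Δ / (4 * K * τ)) (cA := ε * accValueStart lf σg M)
    (ca := √ε * accValueInner lf lg lhat / τ) (cB := √ε * accJacStart lf σJ)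
    (cb := accJacInner lf Lg Lhat M / τ) hδ (by positivity) (by positivity) (by positivity)
    (by positivity) (by rw [hdiv]; exact hlog _ (by linarith))
    (by rw [hdiv]; exact batch_size_le (E := (ε ^ 2)⁻¹) hκA (by field_simp) rfl)
    (by
      rw [hdiv]
      refine batch_size_le (E := (τ : ℝ) ^ 2 * ε⁻¹) hκa ?_ ?_
      · rw [div_pow, mul_pow, hs]; field_simp
      · rw [← mul_assoc]; rfl)
    (by rw [hdiv]; exact hlog _ (by linarith))
    (by
      rw [hdiv]
      refine batch_size_le (E := ε⁻¹) hκB ?_ rfl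
      rw [mul_pow, hs]; field_simp)
    (by rw [hdiv]; exact batch_size_le (E := (τ : ℝ) ^ 2) hκb (by field_simp) rfl) K
  have hprob : 1 - K * (a.τ : ℝ) * (2 * (Δ / (4 * K * τ)) + a.δbar) = 1 - Δ := by
    have h1 : a.τ = τ := rfl
    have h2 : a.δbar = Δ / (2 * K * τ) := rfl
    rw [h1, h2]
    field_simp
    ring
  rw [hprob] at hPE
  refine ⟨E, hE, hPE, fun ω hω => ?_⟩
  have hrb := jac_inner_error_le (lf := lf) (Lg := Lg) (Lhat := Lhat) (M := M) hT
  refine (Setup.avgSqGenGrad_le (a := a) h hM hφ hτ hrb hx₀ hKpos (hgood ω hω)).trans ?_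
  have e1 := value_start_error_le (lf := lf) (σg := σg) hM0 hε
  have e2 := jac_start_error_le (lf := lf) (σJ := σJ) hM0 hε
  have e3 := value_inner_error_le (lf := lf) (lg := lg) (lhat := lhat) hM0 hε hT
  have e4 : (p.objReal x₀ - φ) / (K * τ) ≤ ε / (10 * M) := by
    rw [div_le_div_iff₀ (by positivity) (by positivity)]
    have h1 : c.CS = 10 * M * |gap| + 1 := rfl
    calc (p.objReal x₀ - φ) * (10 * M) ≤ |gap| * (10 * M) := by
          gcongr
          exact hgap.trans (le_abs_self _)
      _ ≤ c.CS := by rw [h1]; linarith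
      _ ≤ ε * (K * τ) := by linarith
  have e5 : a.εbar = ε / (150 * M) := by
    change ε / (5 * 30 * M) = _
    norm_num
  -- The shares are, in order: initial gap, solver, value at the epoch start, Jacobian at the epoch
  -- start, value drift. The Jacobian drift was absorbed by the descent.
  have e6 : 5 * M / 2 * (ε / (10 * M) + (ε / (150 * M) + ε / (15 * M) + ε / (15 * M) +
      ε / (15 * M))) ≤ ε := by
    have : 5 * M / 2 * (ε / (10 * M) + (ε / (150 * M) + ε / (15 * M) + ε / (15 * M) +
      ε / (15 * M))) = 23 / 30 * ε := by field_simp; norm_num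
    rw [this]; linarith
  refine le_trans ?_ e6
  rw [e5]
  have hMM : 0 ≤ 5 * M / 2 := by positivity
  exact mul_le_mul_of_nonneg_left
    (add_le_add e4 (add_le_add (add_le_add (add_le_add le_rfl e1) e2) e3)) hMM

end ProxLinearVR
end

theorem corollary2 (lf lg Lg lhat Lhat : ℝ≥0) (σg σJ M gap : ℝ) (hM : 5 * lf * Lg < M) :
    ∃ c : ProxLinearVR.Constants, c.Pos ∧ ∃ ε₀ : ℝ, 0 < ε₀ ∧
    ∀ (m n : ℕ), 0 < m → 0 < n →
    ∀ (Ξ : Type u) [MeasurableSpace Ξ] (S : Type v) [MeasurableSpace S]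
      (p : ProxLinearVR.Problem m n Ξ) (sol : ProxLinearVR.Solver m n S)
      (x₀ : ProxLinearVR.Vec n),
      p.Standing lf lg Lg → p.BoundedDeviation σg σJ → p.UniformLipschitz lhat Lhat →
      sol.Valid p M →
      ⊥ < (⨅ x, p.objective x) → p.objective x₀ < ⊤ →
      p.objective x₀ - (⨅ x, p.objective x) ≤ (gap : EReal) →
      -- the prox-linear step, hence the generalized gradient, is well defined
      (∀ x, ∃! y, IsMinOn (p.exactModel M x) univ y) ∧
      -- (i) the average squared generalized gradient
      (∀ (Δ : ℝ) (τ : ℕ) (ε : ℝ), 0 < Δ → Δ < 1 → 0 < τ → 0 < ε → ε < ε₀ →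
        ProxLinearVR.HoldsWithProb (ProxLinearVR.drawLaw p.D sol.law) (1 - Δ) fun ω =>
          (c.setup p sol x₀ M ε Δ τ).avgSqGenGrad M (c.epochs ε τ) ω ≤ ε) ∧
      -- (ii) the oracle complexities, in every run, for `τ = O(1 / ε)`
      (∀ (Cτ Δmax : ℝ), 0 < Cτ → 0 < Δmax → Δmax < 1 →
        ∃ (c₁ c₂ ε₁ : ℝ) (q : ℕ), 0 < c₁ ∧ 0 < c₂ ∧ 0 < ε₁ ∧
        ∀ (Δ : ℝ) (τ : ℕ) (ε : ℝ), 0 < Δ → Δ ≤ Δmax → 0 < τ → (τ : ℝ) ≤ Cτ * ε⁻¹ →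
          0 < ε → ε < ε₁ → ∀ ω : ProxLinearVR.Draws Ξ S,
          ProxLinearVR.SoftThetaBound c₁ c₂ q ε (ProxLinearVR.evalRate ε Δ τ)
            ((c.setup p sol x₀ M ε Δ τ).totalEvals (c.epochs ε τ) ω) ∧
          ProxLinearVR.SoftThetaBound c₁ c₂ q ε (ProxLinearVR.jacRate ε Δ τ)
            ((c.setup p sol x₀ M ε Δ τ).totalJacs (c.epochs ε τ) ω)) := by
  have hM0 : 0 < M := lt_of_le_of_lt (by positivity) hM
  have hpos := ProxLinearVR.chosenConstants_pos (lf := lf) (lg := lg) (Lg := Lg) (lhat := lhat)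
    (Lhat := Lhat) (σg := σg) (σJ := σJ) (gap := gap) hM0
  refine ⟨_, hpos, 1, one_pos, ?_⟩
  intro m n hm hn Ξ _ S _ p sol x₀ h hd hu hsol hbot htop hgap
  have hx₀ := ProxLinearVR.Problem.h_ne_top_of_objective_lt htop
  obtain ⟨φ, hφ⟩ : ∃ φ : ℝ, (φ : EReal) = ⨅ x, p.objective x :=
    ⟨_, EReal.coe_toReal ((iInf_le _ x₀).trans_lt htop).ne hbot.ne'⟩
  have hlow : ∀ y, p.h y ≠ ⊤ → φ ≤ p.objReal y := fun y hy => by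
    have := iInf_le p.objective y
    rwa [← hφ, h.objective_eq hy, EReal.coe_le_coe_iff] at this
  rw [← hφ, h.objective_eq hx₀, ← EReal.coe_sub, EReal.coe_le_coe_iff] at hgap
  exact ⟨fun x => h.existsUnique_isMinOn hM0 hlow _ _ x,
    fun Δ τ ε hΔ hΔ1 hτ hε _ => ProxLinearVR.holdsWithProb_avgSqGenGrad_le hM hm p sol x₀ h hd hu
      hsol hlow hx₀ hgap hΔ hΔ1 hτ hε,
    fun Cτ Δmax hCτ hΔ0 hΔ1 => ProxLinearVR.Constants.exists_complexity_bounds hpos hm p sol x₀ M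
      hCτ hΔ0 hΔ1⟩
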